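/- Fix $n\ge 0$ and an ideal $I\subseteq\mathbb{Z}[T_1,\dots,T_n]$. A \emph{partitioned formula} is a quantifier-free formula $\varphi(X_1,\dots,X_m,\bar y)$ in the language of fields whose variables are divided into square matrices $X_j$ of sizes $k_j\times k_j$ ($k_j\ge 1$) and a tuple $\bar y$ of length $l$. It is \emph{homogeneous} if, over every field, its truth value depends on each $X_j$ only through the row space of $X_j$. For a set $\Phi$ of partitioned formulas let $\mathcal{L}_n(\Phi)$ be the many-sorted first-order language with - a sort $K$ with symbols $+,\cdot,0,1$, and a sort $M$ with symbols $+,0$ and $\cdot\colon K\times M\to M$; - for each $i\ge 1$ a sort $G^i$ and function symbols $\pi_i\colon K^{i^2}\to G^i$ and $D_i\colon M^i\to G^i$; - for each $\varphi\in\Phi$ a predicate $P_\varphi$ on $G^{k_1}\times\dots\times G^{k_m}\times K^l$; - function symbols $T_1,\dots,T_n\colon M\to M$. Let $\mathfrak{T}_I$ be the theory in $\mathcal{L}_n(\Phi)$ saying: $K$ is a field and $M$ is a $K$-vector space; $T_1,\dots,T_n$ are commuting $K$-linear operators on $M$ and $p(T_1,\dots,T_n)=0$ on $M$ for all $p\in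 I$ (so that $M$ is a module over $\mathbb{A}=K[T_1,\dots,T_n]/\langle I\rangle$); $\pi_i$ is surjective, and $\pi_i(X)=\pi_i(Y)$ if and only if the rows of $X$ and of $Y$ span the same subspace of $K^i$ (so that $G^i$ is the set of all subspaces of $K^i$); $P_\varphi(p_1,\dots,p_m,\bar y)$ holds if and only if there are matrices $X_j$ over $K$ with $\pi_{k_j}(X_j)=p_j$ for all $j$ and $\varphi(X_1,\dots,X_m,\bar y)$; and $D_i(v_1,\dots,v_i)$ is the subspace $\{\bar x\in K^i:\sum_j x_jv_j=0\}$. Consider the class of those models of $\mathfrak{T}_I$ in which $K$ is algebraically closed and the following holds: for all $f_1,\dots,f_m,g_1,\dots,g_k\in\mathbb{A}$ ($m,k\ge 0$), all $v_1,\dots,v_m\in M$ and all finite-dimensional $K$-subspaces $U_1,\dots,U_k$ of $M$ such that - $\sum_i t_if_i=0$ implies $\sum_i t_iv_i=0$, for all $t_1,\dots,t_m\in\mathbb{A}$, and - no $g_j$ lies in the ideal of $\mathbb{A}$ generated by $f_1,\dots,f_m$, there is $x\in M$ with $f_ix=v_i$ for all $i$ and $g_jx\notin U_j$ for all $j$.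 A theory $T'$ is the \emph{model completion} of a theory $T$ in the same language if every model of $T'$ is a model of $T$, every model of $T$ embeds into a model of $T'$, and, for every model $C$ of $T$, any two models of $T'$ extending $C$ satisfy the same first-order formulas with parameters from $C$. \textbf{Statement.} The class above is elementary, for every set $\Phi$ in (a) and (b) below; let $\tilde{\mathfrak{T}}$ be a theory axiomatizing it. Then: (a) If $\Phi$ is the set of all homogeneous partitioned formulas, then $\tilde{\mathfrak{T}}$ is the model completion of $\mathfrak{T}_I$. (b) If $\Phi$ is the set of all partitioned formulas, then $\tilde{\mathfrak{T}}$ is the model completion of the theory consisting of $\mathfrak{T}_I$ and the axioms saying that $K$ is algebraically closed. -/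

import Mathlib

universe u

/-! ### Many-sorted first-order logic with equality -/

/-- A many-sorted first-order language. The arguments of a symbol are indexed by a finite type. -/
structure MSLanguage : Type 1 where
  Srt : Type
  Fn : Type
  fnAr : Fn → Type
  fnFinite : ∀ f, Finite (fnAr f)
  fnDom : (f : Fn) → fnAr f → Srt
  fnCod : Fn → Srt
  Rel : Type
  relAr : Rel → Type
  relFinite : ∀ r, Finite (relAr r)
  relDom : (r : Rel) → relAr r → Srt

namespace MSLanguage

/-- Terms whose variables come from a context, i.e. a list of sorts. -/
inductive Term (L : MSLanguage) (Γ : List L.Srt) : L.Srt → Type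
  | var (i : Fin Γ.length) : Term L Γ (Γ.get i)
  | app (f : L.Fn) (ts : (a : L.fnAr f) → Term L Γ (L.fnDom f a)) : Term L Γ (L.fnCod f)

/-- First-order formulas in a context; a quantifier binds the head of the context. -/
inductive Formula (L : MSLanguage) : List L.Srt → Type
  | falsum {Γ : List L.Srt} : Formula L Γ
  | eq {Γ : List L.Srt} {s : L.Srt} (t₁ t₂ : Term L Γ s) : Formula L Γ
  | rel {Γ : List L.Srt} (r : L.Rel) (ts : (a : L.relAr r) → Term L Γ (L.relDom r a)) :
      Formula L Γ
  | imp {Γ : List L.Srt} (φ ψ : Formula L Γ) : Formula L Γ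
  | all {Γ : List L.Srt} (s : L.Srt) (φ : Formula L (s :: Γ)) : Formula L Γ

/-- A theory is a set of sentences. -/
abbrev Theory (L : MSLanguage) : Type := Set (Formula L [])

/-- A structure for a many-sorted language. -/
structure Struc (L : MSLanguage) : Type (u + 1) where
  carrier : L.Srt → Type u
  fn : (f : L.Fn) → ((a : L.fnAr f) → carrier (L.fnDom f a)) → carrier (L.fnCod f)
  rel : (r : L.Rel) → ((a : L.relAr r) → carrier (L.relDom r a)) → Prop

variable {L : MSLanguage}

/-- An assignment of elements of the structure to the variables of a context. -/
abbrev Struc.Assign (N : Struc.{u} L) (Γ : List L.Srt) : Type u :=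
  (i : Fin Γ.length) → N.carrier (Γ.get i)

/-- Extend an assignment by a value for a new head variable. -/
def Struc.Assign.cons {N : Struc.{u} L} {Γ : List L.Srt} {s : L.Srt} (x : N.carrier s)
    (c : N.Assign Γ) : N.Assign (s :: Γ) :=
  fun i => Fin.cases (motive := fun i => N.carrier ((s :: Γ).get i)) x c i

/-- The value of a term. -/
def Term.eval (N : Struc.{u} L) {Γ : List L.Srt} (c : N.Assign Γ) :
    {s : L.Srt} → Term L Γ s → N.carrier s
  | _, .var i => c i
  | _, .app f ts => N.fn f fun a => (ts a).eval N c

/-- Tarski's truth definition. -/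
def Formula.Realize (N : Struc.{u} L) : {Γ : List L.Srt} → Formula L Γ → N.Assign Γ → Prop
  | _, .falsum, _ => False
  | _, .eq t₁ t₂, c => t₁.eval N c = t₂.eval N c
  | _, .rel r ts, c => N.rel r fun a => (ts a).eval N c
  | _, .imp φ ψ, c => φ.Realize N c → ψ.Realize N c
  | _, .all s φ, c => ∀ x : N.carrier s, φ.Realize N (Struc.Assign.cons x c)

/-- `N` is a model of the theory `T`. -/
def Struc.Models (N : Struc.{u} L) (T : Theory L) : Prop :=
  ∀ φ ∈ T, φ.Realize N (fun i => i.elim0)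

/-- An embedding of structures: injective on every sort, commuting with the function symbols,
preserving and reflecting the relation symbols. -/
structure Embedding (N N' : Struc.{u} L) where
  toFun : (s : L.Srt) → N.carrier s → N'.carrier s
  inj : ∀ s, Function.Injective (toFun s)
  map_fn : ∀ (f : L.Fn) (x : (a : L.fnAr f) → N.carrier (L.fnDom f a)),
    toFun (L.fnCod f) (N.fn f x) = N'.fn f fun a => toFun (L.fnDom f a) (x a)
  map_rel : ∀ (r : L.Rel) (x : (a : L.relAr r) → N.carrier (L.relDom r a)),
    N.rel r x ↔ N'.rel r fun a => toFun (L.relDom r a) (x a)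

/-- `T'` is the model completion of `T`: it extends `T`, every model of `T` embeds into a model
of `T'`, and for every model `C` of `T` the theory `T'` together with the diagram of `C` is
complete, i.e. any two models of `T'` extending `C` satisfy the same formulas with parameters
from `C`. -/
structure IsModelCompletion (T' T : Theory L) : Prop where
  extends_base : ∀ N : Struc.{u} L, N.Models T' → N.Models T
  embeds : ∀ N : Struc.{u} L, N.Models T →
    ∃ N' : Struc.{u} L, N'.Models T' ∧ Nonempty (Embedding N N')
  complete : ∀ C N₁ N₂ : Struc.{u} L, C.Models T → N₁.Models T' → N₂.Models T' →
    ∀ (e₁ : Embedding C N₁) (e₂ : Embedding C N₂) (Γ : List L.Srt) (φ : Formula L Γ)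
      (c : C.Assign Γ),
      φ.Realize N₁ (fun i => e₁.toFun (Γ.get i) (c i)) ↔
        φ.Realize N₂ (fun i => e₂.toFun (Γ.get i) (c i))

end MSLanguage

/-! ### The language of modules with Grassmannians -/

namespace GrassModule

open MSLanguage

/-- The subspace of `F ^ k` spanned by the rows of a `k × k` matrix. -/
def rowSpan {F : Type*} [Field F] {k : ℕ} (X : Fin k → Fin k → F) : Submodule F (Fin k → F) :=
  Submodule.span F (Set.range X)

/-- A quantifier-free formula in the language of fields, with its variables partitioned into
`m` square matrices of sizes `k 0, …, k (m - 1)` and a tuple of length `l`. -/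
structure PartFormula : Type where
  m : ℕ
  k : Fin m → ℕ+
  l : ℕ
  φ : FirstOrder.Language.ring.Formula ((Σ j : Fin m, Fin (k j) × Fin (k j)) ⊕ Fin l)
  isQF : FirstOrder.Language.BoundedFormula.IsQF φ

/-- Truth of the formula in a field `F`, at the matrices `X j` and the tuple `y`. -/
def PartFormula.Holds (P : PartFormula) (F : Type*) [Field F]
    (X : (j : Fin P.m) → Fin (P.k j) → Fin (P.k j) → F) (y : Fin P.l → F) : Prop :=
  letI := FirstOrder.Ring.compatibleRingOfRing F
  P.φ.Realize (Sum.elim (fun q => X q.1 q.2.1 q.2.2) y)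

/-- The formula is homogeneous: over every field its truth depends on the matrices only through
their row spaces. (Since it is quantifier free, fields in the lowest universe suffice.) -/
def PartFormula.Homogeneous (P : PartFormula) : Prop :=
  ∀ (F : Type) [Field F] (X X' : (j : Fin P.m) → Fin (P.k j) → Fin (P.k j) → F)
    (y : Fin P.l → F), (∀ j, rowSpan (X j) = rowSpan (X' j)) →
      (P.Holds F X y ↔ P.Holds F X' y)

/-- The sorts: the field, the module, and the Grassmannians `G i` of all subspaces of `K ^ i`. -/
inductive GSort : Type
  | K
  | M
  | G (i : ℕ+)

/-- The function symbols. -/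
inductive GFn (n : ℕ) : Type
  | kZero
  | kOne
  | kAdd
  | kMul
  | mZero
  | mAdd
  | smul
  | pi (i : ℕ+)
  | D (i : ℕ+)
  | T (j : Fin n)

def GFn.ar {n : ℕ} : GFn n → Type
  | .kZero => Empty
  | .kOne => Empty
  | .kAdd => Fin 2
  | .kMul => Fin 2
  | .mZero => Empty
  | .mAdd => Fin 2
  | .smul => Unit ⊕ Unit
  | .pi i => Fin i × Fin i
  | .D i => Fin i
  | .T _ => Unit

theorem GFn.ar_finite {n : ℕ} (f : GFn n) : Finite f.ar := by
  cases f <;> (unfold GFn.ar; infer_instance)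

def GFn.dom {n : ℕ} : (f : GFn n) → f.ar → GSort
  | .kZero => fun _ => .K
  | .kOne => fun _ => .K
  | .kAdd => fun _ => .K
  | .kMul => fun _ => .K
  | .mZero => fun _ => .M
  | .mAdd => fun _ => .M
  | .smul => fun a => Sum.elim (fun _ => .K) (fun _ => .M) a
  | .pi _ => fun _ => .K
  | .D _ => fun _ => .M
  | .T _ => fun _ => .M

def GFn.cod {n : ℕ} : GFn n → GSort
  | .kZero => .K
  | .kOne => .K
  | .kAdd => .K
  | .kMul => .K
  | .mZero => .M
  | .mAdd => .M
  | .smul => .M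
  | .pi i => .G i
  | .D i => .G i
  | .T _ => .M

/-- The language with operators `T_1, …, T_n` and a predicate symbol on
`G ^ {k_1} × ⋯ × G ^ {k_m} × K ^ l` for every partitioned formula in `Φ`. -/
def lang (n : ℕ) (Φ : Set PartFormula) : MSLanguage where
  Srt := GSort
  Fn := GFn n
  fnAr := GFn.ar
  fnFinite := GFn.ar_finite
  fnDom := GFn.dom
  fnCod := GFn.cod
  Rel := Φ
  relAr P := Fin P.1.m ⊕ Fin P.1.l
  relFinite _ := inferInstance
  relDom P := Sum.elim (fun j => GSort.G (P.1.k j)) (fun _ => GSort.K)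

section Struc

variable {n : ℕ} {Φ : Set PartFormula} (N : Struc.{u} (lang n Φ))

/-- The field sort of a structure. -/
abbrev KS : Type u := N.carrier GSort.K

/-- The module sort of a structure. -/
abbrev MS : Type u := N.carrier GSort.M

/-- The `i`-th Grassmannian sort of a structure. -/
abbrev GS (i : ℕ+) : Type u := N.carrier (GSort.G i)

def kZero : KS N := N.fn GFn.kZero (fun a => Empty.elim a)
def kOne : KS N := N.fn GFn.kOne (fun a => Empty.elim a)
def kAdd (x y : KS N) : KS N := N.fn GFn.kAdd (![x, y] : Fin 2 → KS N)
def kMul (x y : KS N) : KS N := N.fn GFn.kMul (![x, y] : Fin 2 → KS N)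
def mZero : MS N := N.fn GFn.mZero (fun a => Empty.elim a)
def mAdd (v w : MS N) : MS N := N.fn GFn.mAdd (![v, w] : Fin 2 → MS N)

def smulS (x : KS N) (v : MS N) : MS N :=
  N.fn GFn.smul fun a => match a with
    | .inl _ => x
    | .inr _ => v

def piS (i : ℕ+) (X : Fin i → Fin i → KS N) : GS N i :=
  N.fn (GFn.pi i) (fun a : Fin i × Fin i => X a.1 a.2)

def dS (i : ℕ+) (v : Fin i → MS N) : GS N i := N.fn (GFn.D i) v

def tS (j : Fin n) (v : MS N) : MS N := N.fn (GFn.T j) (fun _ => v)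

def pS (P : Φ) (p : (j : Fin P.1.m) → GS N (P.1.k j)) (y : Fin P.1.l → KS N) : Prop :=
  N.rel P fun a => match a with
    | .inl j => p j
    | .inr a => y a

end Struc

/-! ### The two theories -/

/-- The algebra `K[T_1, …, T_n] / ⟨I⟩` for an ideal `I` of `ℤ[T_1, …, T_n]`. -/
abbrev Alg {n : ℕ} (I : Ideal (MvPolynomial (Fin n) ℤ)) (K : Type u) [Field K] : Type u :=
  MvPolynomial (Fin n) K ⧸ I.map (MvPolynomial.map (Int.castRingHom K))

/-- The space of all `x ∈ K ^ i` such that `∑ x_j v_j = 0`. -/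
def relations (K : Type*) {M : Type*} [Field K] [AddCommGroup M] [Module K M] {i : ℕ}
    (v : Fin i → M) : Submodule K (Fin i → K) :=
  LinearMap.ker (Fintype.linearCombination K v)

/-- The axioms of the base theory, for given algebraic structures on the sorts: the symbols of the
language denote the operations of the field `K` and of the `K[T_1, …, T_n] / ⟨I⟩`-module `M`;
`(G i, π_i)` is the set of all subspaces of `K ^ i`; the predicates are the sets induced on the
Grassmannians by their formulas; `D_i` is the space of linear relations. -/
structure Axioms {n : ℕ} {Φ : Set PartFormula} (I : Ideal (MvPolynomial (Fin n) ℤ))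
    (N : Struc.{u} (lang n Φ)) [Field (KS N)] [AddCommGroup (MS N)] [Module (KS N) (MS N)]
    [Module (Alg I (KS N)) (MS N)] : Prop where
  tower : IsScalarTower (KS N) (Alg I (KS N)) (MS N)
  kZero_eq : kZero N = 0
  kOne_eq : kOne N = 1
  kAdd_eq : ∀ x y, kAdd N x y = x + y
  kMul_eq : ∀ x y, kMul N x y = x * y
  mZero_eq : mZero N = 0
  mAdd_eq : ∀ v w, mAdd N v w = v + w
  smul_eq : ∀ x v, smulS N x v = x • v
  pi_surjective : ∀ i, Function.Surjective (piS N i)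
  pi_eq_iff : ∀ i X Y, piS N i X = piS N i Y ↔ rowSpan X = rowSpan Y
  pred_iff : ∀ (P : Φ) p y, pS N P p y ↔
    ∃ X : (j : Fin P.1.m) → Fin (P.1.k j) → Fin (P.1.k j) → KS N,
      P.1.Holds (KS N) X y ∧ ∀ j, piS N (P.1.k j) (X j) = p j
  d_eq : ∀ i v X, piS N i X = dS N i v → rowSpan X = relations (KS N) v
  t_eq : ∀ j v, tS N j v =
    (Ideal.Quotient.mk (I.map (MvPolynomial.map (Int.castRingHom (KS N))))
      (MvPolynomial.X j) : Alg I (KS N)) • v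

/-- Every finite system `f_i x = v_i`, `g_j x ∉ U_j` with finite-dimensional `U_j`, whose
equations are compatible and in which no `g_j` lies in the ideal generated by the `f_i`, has a
solution in the module. -/
def Solvable (K A M : Type*) [Field K] [CommRing A] [AddCommGroup M] [Module K M] [Module A M] :
    Prop :=
  ∀ (m k : ℕ) (f : Fin m → A) (v : Fin m → M) (g : Fin k → A) (U : Fin k → Submodule K M),
    (∀ j, FiniteDimensional K (U j)) →
    (∀ t : Fin m → A, ∑ i, t i * f i = 0 → ∑ i, t i • v i = 0) →
    (∀ j, g j ∉ Ideal.span (Set.range f)) →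
    ∃ x : M, (∀ i, f i • x = v i) ∧ ∀ j, g j • x ∉ U j

variable {n : ℕ} {Φ : Set PartFormula}

/-- `N` is (the structure of) a field `K` with a module over `K[T_1, …, T_n] / ⟨I⟩`. -/
def IsBase (I : Ideal (MvPolynomial (Fin n) ℤ)) (N : Struc.{u} (lang n Φ)) : Prop :=
  ∃ (_ : Field (KS N)) (_ : AddCommGroup (MS N)) (_ : Module (KS N) (MS N))
    (_ : Module (Alg I (KS N)) (MS N)), Axioms I N

/-- As `IsBase`, with `K` algebraically closed. -/
def IsBaseACF (I : Ideal (MvPolynomial (Fin n) ℤ)) (N : Struc.{u} (lang n Φ)) : Prop :=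
  ∃ (_ : Field (KS N)) (_ : AddCommGroup (MS N)) (_ : Module (KS N) (MS N))
    (_ : Module (Alg I (KS N)) (MS N)), Axioms I N ∧ IsAlgClosed (KS N)

/-- As `IsBase`, with `K` algebraically closed and all the solvability conditions. -/
def IsBig (I : Ideal (MvPolynomial (Fin n) ℤ)) (N : Struc.{u} (lang n Φ)) : Prop :=
  ∃ (_ : Field (KS N)) (_ : AddCommGroup (MS N)) (_ : Module (KS N) (MS N))
    (_ : Module (Alg I (KS N)) (MS N)),
    Axioms I N ∧ IsAlgClosed (KS N) ∧ Solvable (KS N) (Alg I (KS N)) (MS N)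

/-- The theory `T` axiomatizes the class `C` of structures. -/
def Axiomatizes (T : Theory (lang n Φ)) (C : Struc.{u} (lang n Φ) → Prop) : Prop :=
  ∀ N : Struc.{u} (lang n Φ), N.Models T ↔ C N

end GrassModule

/-! Elementarity. The delicate condition is solvability: it refers to all relations among the f_i
and to ideal membership, hence to polynomials of unbounded degree. Over the polynomial ring K[T], a
system f_i x = v_i becomes a submodule F of K[T] × M that is the graph of a homomorphism from an
ideal to M (`FSolvable`, `solvable_iff_fSolvable`). After passing to a Gröbner basis of that ideal,
compatibility only has to be checked on S-pairs, by a Buchberger criterion for pairs (polynomial,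
vector) (`GBSystem.eq_zero_or_exists_coeff`). Each g_j can be replaced by its remainder, which lies
outside the ideal exactly when it is nonzero. For a fixed shape of the basis and a fixed finite set
of exponents this is a single sentence, and these sentences together express solvability
(`fSolvable_of_gbSolvable`, `mElem_fSolvable`).

Embeddings. The symbols D_i force an embedding of models to send linearly independent vectors to
vectors independent over the larger field. Conversely, a field homomorphism with a semilinear map
that commutes with the operators and has this property extends to the Grassmannians
(`embAddHom_linExt`, `exists_embedding`), provided that the predicates transfer along the field
extension. They do so when the formulas are homogeneous, and also when the smaller field is
algebraically closed, by the Nullstellensatz. Cases (a) and (b) differ only here.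

Existence. Extend scalars to the algebraic closure, embed the module into an injective module
containing all cyclic modules, and take a countable power (`solvable_pi_of_injective`). Injectivity
solves the equations. The countable power leaves room to avoid finitely many finite-dimensional
subspaces.

Completeness. Let C embed into models A and B of the big theory, and let x be a vector of A. After
replacing B by an ultrapower, the field of A maps into that of B over the field of C
(`Mdl.IsBig.exists_amalgam`), and so does the space spanned over it by the vectors of C
(`exists_scalar_extension`). To send x to some y, one needs that y solves the system imposed by the
polynomials carrying x into the space already mapped, and that the remaining multiples of y are as
independent as those of x. The solvability axiom avoids only finitely many g_j, whereas independence
concerns all linear combinations at once. An Amitsur-type lemma (`exists_linearIndependent_apply`)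
bridges the gap: linear maps all of whose nontrivial combinations have infinite rank take
independent values at some point. One more ultrapower combines the finite approximations
(`Mdl.IsBig.exists_extension`). Induction on formulas then finishes (`realize_iff_of_isBig`). -/

namespace MSLanguage

open Filter

variable {L : MSLanguage}

/-! ### Ultrapowers -/

/-- The ultrapower of a structure. -/
noncomputable def Struc.ultrapower (N : Struc.{u} L) {ι : Type u} (U : Ultrafilter ι) :
    Struc.{u} L where
  carrier s := Germ (U : Filter ι) (N.carrier s)
  fn f x := ((fun i => N.fn f fun a => Quotient.out (x a) i : ι → _) : Germ (U : Filter ι) _)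
  rel r x := ∀ᶠ i in (U : Filter ι), N.rel r fun a => Quotient.out (x a) i

/-- The class of a sequence in the ultrapower. -/
def Struc.mkUP (N : Struc.{u} L) {ι : Type u} (U : Ultrafilter ι) {s : L.Srt}
    (g : ι → N.carrier s) : (N.ultrapower U).carrier s :=
  (g : Germ (U : Filter ι) (N.carrier s))

section Ultrapower

variable {N : Struc.{u} L} {ι : Type u} {U : Ultrafilter ι}

theorem mkUP_eq_iff {s : L.Srt} {g h : ι → N.carrier s} :
    N.mkUP U g = N.mkUP U h ↔ ∀ᶠ i in (U : Filter ι), g i = h i :=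
  Germ.coe_eq

theorem exists_mkUP {s : L.Srt} (x : (N.ultrapower U).carrier s) : ∃ g, N.mkUP U g = x :=
  ⟨Quotient.out x, Quotient.out_eq x⟩

/-- The ultrapower evaluates symbols at representatives picked by `Quotient.out`. Finiteness of the
arity allows the almost-everywhere agreements of the single arguments to be intersected. -/
theorem eventually_out {α : Type} [Finite α] {d : α → L.Srt} (g : (a : α) → ι → N.carrier (d a)) :
    ∀ᶠ i in (U : Filter ι), (fun a => Quotient.out (N.mkUP U (g a)) i) = fun a => g a i := by
  have : ∀ a, ∀ᶠ i in (U : Filter ι), Quotient.out (N.mkUP U (g a)) i = g a i := fun a =>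
    mkUP_eq_iff.1 (Quotient.out_eq (N.mkUP U (g a)))
  filter_upwards [eventually_all.2 this] with i hi
  exact funext hi

theorem fn_mkUP (f : L.Fn) (g : (a : L.fnAr f) → ι → N.carrier (L.fnDom f a)) :
    (N.ultrapower U).fn f (fun a => N.mkUP U (g a)) = N.mkUP U fun i => N.fn f fun a => g a i := by
  have := L.fnFinite f
  refine mkUP_eq_iff.2 ?_
  filter_upwards [eventually_out (U := U) g] with i hi
  rw [hi]

theorem rel_mkUP (r : L.Rel) (g : (a : L.relAr r) → ι → N.carrier (L.relDom r a)) :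
    (N.ultrapower U).rel r (fun a => N.mkUP U (g a)) ↔
      ∀ᶠ i in (U : Filter ι), N.rel r fun a => g a i := by
  have := L.relFinite r
  refine eventually_congr ?_
  filter_upwards [eventually_out (U := U) g] with i hi
  rw [hi]

theorem Term.eval_ultrapower {Γ : List L.Srt} (g : (k : Fin Γ.length) → ι → N.carrier (Γ.get k))
    {s : L.Srt} (t : Term L Γ s) :
    t.eval (N.ultrapower U) (fun k => N.mkUP U (g k)) =
      N.mkUP U fun i => t.eval N fun k => g k i := by
  induction t with
  | var k => rfl
  | app f ts ih =>
    simp only [Term.eval, ih]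
    exact fn_mkUP f _

/-- Łoś's theorem. -/
theorem Formula.realize_ultrapower {Γ : List L.Srt} (φ : Formula L Γ)
    (g : (k : Fin Γ.length) → ι → N.carrier (Γ.get k)) :
    φ.Realize (N.ultrapower U) (fun k => N.mkUP U (g k)) ↔
      ∀ᶠ i in (U : Filter ι), φ.Realize N fun k => g k i := by
  induction φ with
  | falsum => simp [Formula.Realize, U.neBot.ne]
  | eq t₁ t₂ =>
    simp only [Formula.Realize, Term.eval_ultrapower]
    exact mkUP_eq_iff
  | rel r ts =>
    simp only [Formula.Realize, Term.eval_ultrapower]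
    exact rel_mkUP r _
  | imp φ ψ ih₁ ih₂ =>
    simp only [Formula.Realize, ih₁ g, ih₂ g, Ultrafilter.eventually_imp]
  | @all Γ s φ ih =>
    have key : ∀ h : ι → N.carrier s,
        (Struc.Assign.cons (N.mkUP U h) (fun k => N.mkUP U (g k)) :
          (N.ultrapower U).Assign (s :: Γ)) =
        fun k => N.mkUP U ((Fin.cases (motive := fun k => ι → N.carrier ((s :: Γ).get k)) h g k :
          ι → N.carrier ((s :: Γ).get k))) := by
      intro h
      funext k
      refine Fin.cases ?_ (fun k => ?_) k <;> rfl
    have key2 : ∀ (h : ι → N.carrier s) (i : ι),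
        (fun k => (Fin.cases (motive := fun k => ι → N.carrier ((s :: Γ).get k)) h g k :
          ι → N.carrier ((s :: Γ).get k)) i) =
        (Struc.Assign.cons (h i) (fun k => g k i) : N.Assign (s :: Γ)) := by
      intro h i
      funext k
      refine Fin.cases ?_ (fun k => ?_) k <;> rfl
    simp only [Formula.Realize]
    constructor
    · intro H
      by_contra hne
      rw [← Ultrafilter.eventually_not] at hne
      simp only [not_forall] at hne
      -- A sort may be empty, so the default value used at indices without a counterexample is
      -- borrowed from an index that has one.
      obtain ⟨i₀, x₀, -⟩ := hne.exists
      have : ∀ i, ∃ x : N.carrier s, (∃ x, ¬ φ.Realize N (Struc.Assign.cons x fun k => g k i)) →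
          ¬ φ.Realize N (Struc.Assign.cons x fun k => g k i) := by
        intro i
        by_cases hx : ∃ x, ¬ φ.Realize N (Struc.Assign.cons x fun k => g k i)
        · exact ⟨hx.choose, fun _ => hx.choose_spec⟩
        · exact ⟨x₀, fun h => (hx h).elim⟩
      choose h hh using this
      have h1 := H (N.mkUP U h)
      rw [key, ih] at h1
      simp only [key2] at h1
      obtain ⟨i, h2, h3⟩ := (h1.and hne).exists
      exact hh i h3 h2
    · intro H x
      obtain ⟨h, rfl⟩ := exists_mkUP x
      rw [key, ih]
      simp only [key2]
      filter_upwards [H] with i hi using hi (h i)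

/-- The diagonal map into the ultrapower. -/
def diagUP (N : Struc.{u} L) {ι : Type u} (U : Ultrafilter ι) (s : L.Srt) (x : N.carrier s) :
    (N.ultrapower U).carrier s :=
  N.mkUP U fun _ => x

/-- The map between structures is elementary. -/
def Elementary (N N' : Struc.{u} L) (j : (s : L.Srt) → N.carrier s → N'.carrier s) : Prop :=
  ∀ (Γ : List L.Srt) (φ : Formula L Γ) (c : N.Assign Γ),
    φ.Realize N' (fun k => j (Γ.get k) (c k)) ↔ φ.Realize N c

theorem Elementary.comp {N N' N'' : Struc.{u} L} {j : (s : L.Srt) → N.carrier s → N'.carrier s}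
    {j' : (s : L.Srt) → N'.carrier s → N''.carrier s} (h' : Elementary N' N'' j')
    (h : Elementary N N' j) : Elementary N N'' fun s x => j' s (j s x) := fun Γ φ c =>
  (h' Γ φ _).trans (h Γ φ c)

theorem elementary_diagUP : Elementary N (N.ultrapower U) (diagUP N U) := fun Γ φ c =>
  (φ.realize_ultrapower fun k _ => c k).trans (by simp)

theorem Elementary.models {N N' : Struc.{u} L} {j : (s : L.Srt) → N.carrier s → N'.carrier s}
    (h : Elementary N N' j) {T : Theory L} (hN : N.Models T) : N'.Models T := by
  intro φ hφ
  have := (h [] φ fun i => i.elim0).2 (hN φ hφ)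
  convert this using 1
  funext i
  exact i.elim0

/-- The diagonal embedding into the ultrapower. -/
def embUP (N : Struc.{u} L) {ι : Type u} (U : Ultrafilter ι) : Embedding N (N.ultrapower U) where
  toFun := diagUP N U
  inj s x y h := by
    obtain ⟨i, hi⟩ := (mkUP_eq_iff.1 h).exists
    exact hi
  map_fn f x := (fn_mkUP f fun a _ => x a).symm
  map_rel r x := by
    refine Iff.symm ((rel_mkUP r fun a _ => x a).trans ?_)
    simp

end Ultrapower

/-! ### Weakening of terms -/

/-- Weakening of a term. -/
def Term.weaken {Γ : List L.Srt} (s' : L.Srt) : {s : L.Srt} → Term L Γ s → Term L (s' :: Γ) s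
  | _, .var i => .var (Γ := s' :: Γ) i.succ
  | _, .app f ts => .app f fun a => (ts a).weaken s'

theorem Term.eval_weaken (N : Struc.{u} L) {Γ : List L.Srt} {s' : L.Srt} (x : N.carrier s')
    (c : N.Assign Γ) {s : L.Srt} (t : Term L Γ s) :
    (t.weaken s').eval N (Struc.Assign.cons x c) = t.eval N c := by
  induction t with
  | var i => rfl
  | app f ts ih => simp only [Term.weaken, Term.eval, ih]

/-- The head variable of a context. -/
def Term.head {Γ : List L.Srt} (s : L.Srt) : Term L (s :: Γ) s :=
  .var (Γ := s :: Γ) ⟨0, Nat.succ_pos _⟩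

end MSLanguage

/-! ### Derived connectives and elementary classes. -/

namespace MSLanguage

variable {L : MSLanguage}

/-- Negation. -/
def Formula.neg {Γ : List L.Srt} (φ : Formula L Γ) : Formula L Γ := .imp φ .falsum

/-- Existential quantification. -/
def Formula.ex {Γ : List L.Srt} (s : L.Srt) (φ : Formula L (s :: Γ)) : Formula L Γ :=
  (Formula.all s φ.neg).neg

theorem Formula.realize_neg {N : Struc.{u} L} {Γ : List L.Srt} (φ : Formula L Γ)
    (c : N.Assign Γ) : φ.neg.Realize N c ↔ ¬ φ.Realize N c := Iff.rfl

theorem Formula.realize_ex {N : Struc.{u} L} {Γ : List L.Srt} {s : L.Srt}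
    (φ : Formula L (s :: Γ)) (c : N.Assign Γ) :
    (φ.ex s).Realize N c ↔ ∃ x, φ.Realize N (Struc.Assign.cons x c) := by
  simp only [Formula.ex, Formula.realize_neg, Formula.Realize, not_forall, not_not]

/-- The property of structures is expressed by a sentence. -/
def Sent (P : Struc.{u} L → Prop) : Prop :=
  ∃ φ : Formula L [], ∀ N : Struc.{u} L, φ.Realize N (fun i => i.elim0) ↔ P N

/-- The class of structures is elementary. -/
def Elem (C : Struc.{u} L → Prop) : Prop :=
  ∃ T : Theory L, ∀ N : Struc.{u} L, N.Models T ↔ C N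

theorem Sent.elem {P : Struc.{u} L → Prop} (h : Sent P) : Elem P := by
  obtain ⟨φ, hφ⟩ := h
  refine ⟨{φ}, fun N => ⟨fun h => (hφ N).1 (h φ rfl), fun h ψ hψ => ?_⟩⟩
  obtain rfl : ψ = φ := hψ
  exact (hφ N).2 h

theorem Elem.forall {J : Sort*} {C : J → Struc.{u} L → Prop} (h : ∀ j, Elem (C j)) :
    Elem fun N => ∀ j, C j N := by
  choose T hT using h
  refine ⟨⋃ j, T j, fun N => ?_⟩
  simp only [← hT, Struc.Models, Set.mem_iUnion]
  exact ⟨fun H j φ hφ => H φ ⟨j, hφ⟩, fun H φ ⟨j, hj⟩ => H j φ hj⟩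

theorem Elem.and {C D : Struc.{u} L → Prop} (h : Elem C) (h' : Elem D) :
    Elem fun N => C N ∧ D N := by
  obtain ⟨T, hT⟩ := h
  obtain ⟨T', hT'⟩ := h'
  refine ⟨T ∪ T', fun N => ?_⟩
  refine Iff.trans ?_ (and_congr (hT N) (hT' N))
  exact ⟨fun H => ⟨fun φ h => H φ (.inl h), fun φ h => H φ (.inr h)⟩,
    fun H φ h => h.elim (H.1 φ) (H.2 φ)⟩

theorem Elem.congr {C D : Struc.{u} L → Prop} (h : Elem C) (h' : ∀ N, C N ↔ D N) : Elem D := by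
  obtain ⟨T, hT⟩ := h
  exact ⟨T, fun N => (hT N).trans (h' N)⟩

end MSLanguage

/-! ### Axiomatizing fields, modules and Grassmannians. -/

namespace GrassModule

open MSLanguage MvPolynomial

/-! ### Modules over polynomial rings from commuting operators -/

open scoped IsMulCommutative in
/-- The representation of the polynomial ring given by commuting operators. -/
noncomputable def polyRep {n : ℕ} {R M : Type*} [CommRing R] [AddCommGroup M] [Module R M]
    (T : Fin n → Module.End R M) (h : ∀ i j, T i * T j = T j * T i) :
    MvPolynomial (Fin n) R →ₐ[R] Module.End R M :=
  -- The target of `aeval` must be commutative, which the full endomorphism ring is not; the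
  -- subalgebra generated by the operators is.
  haveI := Algebra.isMulCommutative_adjoin R (s := Set.range T) (by
    rintro _ ⟨i, rfl⟩ _ ⟨j, rfl⟩
    exact h i j)
  (Algebra.adjoin R (Set.range T)).val.comp
    (aeval (R := R) (S₁ := Algebra.adjoin R (Set.range T)) fun i => ⟨T i, Algebra.subset_adjoin ⟨i, rfl⟩⟩)

theorem polyRep_X {n : ℕ} {R M : Type*} [CommRing R] [AddCommGroup M] [Module R M]
    (T : Fin n → Module.End R M) (h : ∀ i j, T i * T j = T j * T i) (i : Fin n) :
    polyRep T h (X i) = T i := by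
  have h0 := Algebra.isMulCommutative_adjoin R (s := Set.range T) (by
    rintro _ ⟨i, rfl⟩ _ ⟨j, rfl⟩
    exact h i j)
  simp [polyRep]

/-- The module over the polynomial ring given by commuting operators. -/
noncomputable abbrev polyModule {n : ℕ} {R M : Type*} [CommRing R] [AddCommGroup M] [Module R M]
    (T : Fin n → Module.End R M) (h : ∀ i j, T i * T j = T j * T i) :
    Module (MvPolynomial (Fin n) R) M :=
  Module.compHom M (polyRep T h).toRingHom

theorem polyModule_tower {n : ℕ} {R M : Type*} [CommRing R] [AddCommGroup M] [Module R M]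
    (T : Fin n → Module.End R M) (h : ∀ i j, T i * T j = T j * T i) :
    letI := polyModule T h
    IsScalarTower R (MvPolynomial (Fin n) R) M := by
  let := polyModule T h
  refine ⟨fun c p v => ?_⟩
  change polyRep T h (c • p) v = c • polyRep T h p v
  rw [map_smul, LinearMap.smul_apply]

theorem polyModule_X_smul {n : ℕ} {R M : Type*} [CommRing R] [AddCommGroup M] [Module R M]
    (T : Fin n → Module.End R M) (h : ∀ i j, T i * T j = T j * T i) (i : Fin n) (v : M) :
    letI := polyModule T h
    (X i : MvPolynomial (Fin n) R) • v = T i v := by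
  let := polyModule T h
  change polyRep T h (X i) v = T i v
  rw [polyRep_X]

theorem C_smul_eq {n : ℕ} {K M : Type*} [CommRing K] [AddCommGroup M] [Module K M]
    [Module (MvPolynomial (Fin n) K) M] [IsScalarTower K (MvPolynomial (Fin n) K) M]
    (c : K) (v : M) : (C c : MvPolynomial (Fin n) K) • v = c • v := by
  rw [← algebraMap_eq, algebraMap_smul]

/-- An additive map between modules over polynomial rings that is semilinear for the scalars and
the variables is semilinear. -/
theorem map_poly_smul {n : ℕ} {K K' M M' : Type*} [CommRing K] [CommRing K'] [AddCommGroup M]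
    [AddCommGroup M'] [Module K M] [Module K' M'] [Module (MvPolynomial (Fin n) K) M]
    [Module (MvPolynomial (Fin n) K') M'] [IsScalarTower K (MvPolynomial (Fin n) K) M]
    [IsScalarTower K' (MvPolynomial (Fin n) K') M'] (σ : K →+* K') (e : M →+ M')
    (h₁ : ∀ c v, e (c • v) = σ c • e v)
    (h₂ : ∀ j v, e ((X j : MvPolynomial (Fin n) K) • v) =
      (X j : MvPolynomial (Fin n) K') • e v)
    (p : MvPolynomial (Fin n) K) (v : M) : e (p • v) = map σ p • e v := by
  induction p using MvPolynomial.induction_on generalizing v with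
  | C c => rw [map_C, C_smul_eq, C_smul_eq, h₁]
  | add p q hp hq => rw [add_smul, map_add, hp, hq, map_add, add_smul]
  | mul_X p j hp => rw [mul_smul, hp, h₂, map_mul, map_X, mul_smul]

/-! ### Bundled models of the algebraic part of the theory -/

variable {n : ℕ} {Φ : Set PartFormula}

/-- The symbols of the language, except those concerning the Grassmannians, denote the operations
of the field and of the module over the polynomial ring. -/
structure Core (N : Struc.{u} (lang n Φ)) [Field (KS N)] [AddCommGroup (MS N)]
    [Module (KS N) (MS N)] [Module (MvPolynomial (Fin n) (KS N)) (MS N)] : Prop where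
  tower : IsScalarTower (KS N) (MvPolynomial (Fin n) (KS N)) (MS N)
  kZero_eq : kZero N = 0
  kOne_eq : kOne N = 1
  kAdd_eq : ∀ x y, kAdd N x y = x + y
  kMul_eq : ∀ x y, kMul N x y = x * y
  mZero_eq : mZero N = 0
  mAdd_eq : ∀ v w, mAdd N v w = v + w
  smul_eq : ∀ x v, smulS N x v = x • v
  t_eq : ∀ j v, tS N j v = (X j : MvPolynomial (Fin n) (KS N)) • v

variable (n Φ) in
/-- A structure together with a module over the polynomial ring that it describes. -/
structure Mdl : Type (u + 1) where
  N : Struc.{u} (lang n Φ)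
  [fld : Field (KS N)]
  [acg : AddCommGroup (MS N)]
  [mod : Module (KS N) (MS N)]
  [pmod : Module (MvPolynomial (Fin n) (KS N)) (MS N)]
  core : Core N

/-- The field. -/
abbrev Mdl.K (A : Mdl.{u} n Φ) : Type u := KS A.N

/-- The module. -/
abbrev Mdl.M (A : Mdl.{u} n Φ) : Type u := MS A.N

instance (A : Mdl.{u} n Φ) : Field A.K := A.fld
instance (A : Mdl.{u} n Φ) : AddCommGroup A.M := A.acg
instance (A : Mdl.{u} n Φ) : Module A.K A.M := A.mod
instance (A : Mdl.{u} n Φ) : Module (MvPolynomial (Fin n) A.K) A.M := A.pmod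
instance (A : Mdl.{u} n Φ) : IsScalarTower A.K (MvPolynomial (Fin n) A.K) A.M := A.core.tower

/-! ### Terms -/

section Tm

variable {Γ : List (lang n Φ).Srt}

/-- The type of terms of a given sort. -/
abbrev Tm (n : ℕ) (Φ : Set PartFormula) (Γ : List (lang n Φ).Srt) (s : (lang n Φ).Srt) : Type :=
  Term (lang n Φ) Γ s

def tmZero : Tm n Φ Γ .K := .app (L := lang n Φ) GFn.kZero fun a => Empty.elim a
def tmOne : Tm n Φ Γ .K := .app (L := lang n Φ) GFn.kOne fun a => Empty.elim a
def tmAdd (a b : Tm n Φ Γ .K) : Tm n Φ Γ .K :=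
  .app (L := lang n Φ) GFn.kAdd (![a, b] : Fin 2 → Tm n Φ Γ .K)
def tmMul (a b : Tm n Φ Γ .K) : Tm n Φ Γ .K :=
  .app (L := lang n Φ) GFn.kMul (![a, b] : Fin 2 → Tm n Φ Γ .K)
def tmMZero : Tm n Φ Γ .M := .app (L := lang n Φ) GFn.mZero fun a => Empty.elim a
def tmMAdd (a b : Tm n Φ Γ .M) : Tm n Φ Γ .M :=
  .app (L := lang n Φ) GFn.mAdd (![a, b] : Fin 2 → Tm n Φ Γ .M)
def tmSmul (a : Tm n Φ Γ .K) (b : Tm n Φ Γ .M) : Tm n Φ Γ .M :=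
  .app (L := lang n Φ) GFn.smul fun x => match x with
    | .inl _ => a
    | .inr _ => b
def tmPi (i : ℕ+) (x : Fin i → Fin i → Tm n Φ Γ .K) : Tm n Φ Γ (.G i) :=
  .app (L := lang n Φ) (GFn.pi i) fun a : Fin i × Fin i => x a.1 a.2
def tmD (i : ℕ+) (v : Fin i → Tm n Φ Γ .M) : Tm n Φ Γ (.G i) :=
  .app (L := lang n Φ) (GFn.D i) v
def tmT (j : Fin n) (v : Tm n Φ Γ .M) : Tm n Φ Γ .M :=
  .app (L := lang n Φ) (GFn.T j) fun _ => v

variable (N : Struc.{u} (lang n Φ)) (c : N.Assign Γ)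

theorem eval_tmZero : (tmZero : Tm n Φ Γ .K).eval N c = kZero N :=
  congrArg (N.fn GFn.kZero) (funext fun a => Empty.elim a)
theorem eval_tmOne : (tmOne : Tm n Φ Γ .K).eval N c = kOne N :=
  congrArg (N.fn GFn.kOne) (funext fun a => Empty.elim a)
theorem eval_tmAdd (a b : Tm n Φ Γ .K) :
    (tmAdd a b).eval N c = kAdd N (a.eval N c) (b.eval N c) :=
  congrArg (N.fn GFn.kAdd) (funext fun (i : Fin 2) => by fin_cases i <;> rfl)
theorem eval_tmMul (a b : Tm n Φ Γ .K) :
    (tmMul a b).eval N c = kMul N (a.eval N c) (b.eval N c) :=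
  congrArg (N.fn GFn.kMul) (funext fun (i : Fin 2) => by fin_cases i <;> rfl)
theorem eval_tmMZero : (tmMZero : Tm n Φ Γ .M).eval N c = mZero N :=
  congrArg (N.fn GFn.mZero) (funext fun a => Empty.elim a)
theorem eval_tmMAdd (a b : Tm n Φ Γ .M) :
    (tmMAdd a b).eval N c = mAdd N (a.eval N c) (b.eval N c) :=
  congrArg (N.fn GFn.mAdd) (funext fun (i : Fin 2) => by fin_cases i <;> rfl)
theorem eval_tmSmul (a : Tm n Φ Γ .K) (b : Tm n Φ Γ .M) :
    (tmSmul a b).eval N c = smulS N (a.eval N c) (b.eval N c) :=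
  congrArg (N.fn GFn.smul) (funext fun (i : Unit ⊕ Unit) => by rcases i with _ | _ <;> rfl)
theorem eval_tmT (j : Fin n) (v : Tm n Φ Γ .M) :
    (tmT j v).eval N c = tS N j (v.eval N c) := rfl

end Tm

end GrassModule

namespace GrassModule

open MSLanguage MvPolynomial

variable {n : ℕ} {Φ : Set PartFormula}

/-! ### Axioms for fields and for modules with commuting operators -/

theorem sent_and_elem {L : MSLanguage} {C D : Struc.{u} L → Prop} (h : Sent C) (h' : Elem D) :
    Elem fun N => C N ∧ D N := h.elem.and h'

/-- The laws of a field. -/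
def FieldLaws (N : Struc.{u} (lang n Φ)) : Prop :=
  (∀ x y z, kAdd N (kAdd N x y) z = kAdd N x (kAdd N y z)) ∧
  (∀ x y, kAdd N x y = kAdd N y x) ∧
  (∀ x, kAdd N (kZero N) x = x) ∧
  (∀ x, ∃ y, kAdd N y x = kZero N) ∧
  (∀ x y z, kMul N (kMul N x y) z = kMul N x (kMul N y z)) ∧
  (∀ x y, kMul N x y = kMul N y x) ∧
  (∀ x, kMul N (kOne N) x = x) ∧
  (∀ x y z, kMul N x (kAdd N y z) = kAdd N (kMul N x y) (kMul N x z)) ∧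
  (¬ kZero N = kOne N) ∧
  (∀ x, (¬ x = kZero N) → ∃ y, kMul N x y = kOne N)

/-- The laws of a vector space. -/
def ModuleLaws (N : Struc.{u} (lang n Φ)) : Prop :=
  (∀ x y z, mAdd N (mAdd N x y) z = mAdd N x (mAdd N y z)) ∧
  (∀ x y, mAdd N x y = mAdd N y x) ∧
  (∀ x, mAdd N (mZero N) x = x) ∧
  (∀ x, ∃ y, mAdd N y x = mZero N) ∧
  (∀ v, smulS N (kOne N) v = v) ∧
  (∀ x y v, smulS N (kMul N x y) v = smulS N x (smulS N y v)) ∧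
  (∀ x v w, smulS N x (mAdd N v w) = mAdd N (smulS N x v) (smulS N x w)) ∧
  (∀ x y v, smulS N (kAdd N x y) v = mAdd N (smulS N x v) (smulS N y v))

/-- The operators are linear and commute. -/
def OperatorLaws (N : Struc.{u} (lang n Φ)) : Prop :=
  (∀ j v w, tS N j (mAdd N v w) = mAdd N (tS N j v) (tS N j w)) ∧
  (∀ j x v, tS N j (smulS N x v) = smulS N x (tS N j v)) ∧
  (∀ i j v, tS N i (tS N j v) = tS N j (tS N i v))

section Sentences

local notation "x₀" => Term.head _
local notation "x₁" => Term.weaken _ (Term.head _)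
local notation "x₂" => Term.weaken _ (Term.weaken _ (Term.head _))

theorem elem_fieldLaws : Elem (FieldLaws : Struc.{u} (lang n Φ) → Prop) := by
  refine sent_and_elem ⟨.all .K (.all .K (.all .K (.eq (tmAdd (tmAdd x₂ x₁) x₀)
      (tmAdd x₂ (tmAdd x₁ x₀))))), fun N => ?_⟩ <|
    sent_and_elem ⟨.all .K (.all .K (.eq (tmAdd x₁ x₀) (tmAdd x₀ x₁))), fun N => ?_⟩ <|
    sent_and_elem ⟨.all .K (.eq (tmAdd tmZero x₀) x₀), fun N => ?_⟩ <|
    sent_and_elem ⟨.all .K (.ex .K (.eq (tmAdd x₀ x₁) tmZero)), fun N => ?_⟩ <|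
    sent_and_elem ⟨.all .K (.all .K (.all .K (.eq (tmMul (tmMul x₂ x₁) x₀)
      (tmMul x₂ (tmMul x₁ x₀))))), fun N => ?_⟩ <|
    sent_and_elem ⟨.all .K (.all .K (.eq (tmMul x₁ x₀) (tmMul x₀ x₁))), fun N => ?_⟩ <|
    sent_and_elem ⟨.all .K (.eq (tmMul tmOne x₀) x₀), fun N => ?_⟩ <|
    sent_and_elem ⟨.all .K (.all .K (.all .K (.eq (tmMul x₂ (tmAdd x₁ x₀))
      (tmAdd (tmMul x₂ x₁) (tmMul x₂ x₀))))), fun N => ?_⟩ <|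
    sent_and_elem ⟨.neg (.eq tmZero tmOne), fun N => ?_⟩ <|
    Sent.elem ⟨.all .K (.imp (.neg (.eq x₀ tmZero)) (.ex .K (.eq (tmMul x₁ x₀) tmOne))),
      fun N => ?_⟩ <;>
    simp only [Formula.Realize, Formula.realize_neg, eval_tmAdd, eval_tmMul,
      eval_tmZero, eval_tmOne]
  -- Existentials are coded as negated universals, so the two axioms containing one are unfolded
  -- separately.
  case refine_4 =>
    refine forall_congr' fun x => (Formula.realize_ex _ _).trans ?_
    simp only [Formula.Realize, eval_tmAdd, eval_tmZero]
    rfl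
  case refine_10 =>
    refine forall_congr' fun x => imp_congr Iff.rfl ((Formula.realize_ex _ _).trans ?_)
    simp only [Formula.Realize, eval_tmMul, eval_tmOne]
    rfl
  all_goals rfl

theorem elem_moduleLaws : Elem (ModuleLaws : Struc.{u} (lang n Φ) → Prop) := by
  refine sent_and_elem ⟨.all .M (.all .M (.all .M (.eq (tmMAdd (tmMAdd x₂ x₁) x₀)
      (tmMAdd x₂ (tmMAdd x₁ x₀))))), fun N => ?_⟩ <|
    sent_and_elem ⟨.all .M (.all .M (.eq (tmMAdd x₁ x₀) (tmMAdd x₀ x₁))), fun N => ?_⟩ <|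
    sent_and_elem ⟨.all .M (.eq (tmMAdd tmMZero x₀) x₀), fun N => ?_⟩ <|
    sent_and_elem ⟨.all .M (.ex .M (.eq (tmMAdd x₀ x₁) tmMZero)), fun N => ?_⟩ <|
    sent_and_elem ⟨.all .M (.eq (tmSmul tmOne x₀) x₀), fun N => ?_⟩ <|
    sent_and_elem ⟨.all .K (.all .K (.all .M (.eq (tmSmul (tmMul x₂ x₁) x₀)
      (tmSmul x₂ (tmSmul x₁ x₀))))), fun N => ?_⟩ <|
    sent_and_elem ⟨.all .K (.all .M (.all .M (.eq (tmSmul x₂ (tmMAdd x₁ x₀))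
      (tmMAdd (tmSmul x₂ x₁) (tmSmul x₂ x₀))))), fun N => ?_⟩ <|
    Sent.elem ⟨.all .K (.all .K (.all .M (.eq (tmSmul (tmAdd x₂ x₁) x₀)
      (tmMAdd (tmSmul x₂ x₀) (tmSmul x₁ x₀))))), fun N => ?_⟩ <;>
    simp only [Formula.Realize, eval_tmAdd, eval_tmMul,
      eval_tmOne, eval_tmMAdd, eval_tmMZero, eval_tmSmul]
  case refine_4 =>
    refine forall_congr' fun x => (Formula.realize_ex _ _).trans ?_
    simp only [Formula.Realize, eval_tmMAdd, eval_tmMZero]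
    rfl
  all_goals rfl

theorem elem_operatorLaws : Elem (OperatorLaws : Struc.{u} (lang n Φ) → Prop) := by
  refine Elem.and (Elem.forall fun j => Sent.elem ⟨.all .M (.all .M (.eq (tmT j (tmMAdd x₁ x₀))
      (tmMAdd (tmT j x₁) (tmT j x₀)))), fun N => ?_⟩) <|
    Elem.and (Elem.forall fun j => Sent.elem ⟨.all .K (.all .M (.eq (tmT j (tmSmul x₁ x₀))
      (tmSmul x₁ (tmT j x₀)))), fun N => ?_⟩) <|
    Elem.forall fun i => Elem.forall fun j => Sent.elem ⟨.all .M (.eq (tmT i (tmT j x₀))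
      (tmT j (tmT i x₀))), fun N => ?_⟩ <;>
    simp only [Formula.Realize, eval_tmMAdd, eval_tmSmul, eval_tmT] <;> rfl

end Sentences

open Classical in
/-- The field given by the laws. -/
noncomputable abbrev fieldOfLaws {N : Struc.{u} (lang n Φ)} (h : FieldLaws N) : Field (KS N) :=
  letI : Zero (KS N) := ⟨kZero N⟩
  letI : One (KS N) := ⟨kOne N⟩
  letI : Add (KS N) := ⟨kAdd N⟩
  letI : Mul (KS N) := ⟨kMul N⟩
  letI : Neg (KS N) := ⟨fun x => (h.2.2.2.1 x).choose⟩
  letI : Inv (KS N) :=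
    ⟨fun x => if hx : x = kZero N then kZero N else (h.2.2.2.2.2.2.2.2.2 x hx).choose⟩
  have mc : ∀ x y : KS N, x * y = y * x := h.2.2.2.2.2.1
  have ld : ∀ x y z : KS N, x * (y + z) = x * y + x * z := h.2.2.2.2.2.2.2.1
  letI : Ring (KS N) := Ring.ofMinimalAxioms h.1 h.2.2.1 (fun x => (h.2.2.2.1 x).choose_spec)
    h.2.2.2.2.1 h.2.2.2.2.2.2.1 (fun x => (mc x 1).trans (h.2.2.2.2.2.2.1 x)) ld
    (fun x y z => by rw [mc, ld, mc z, mc z])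
  { (inferInstance : Ring (KS N)) with
    mul_comm := mc
    exists_pair_ne := ⟨0, 1, h.2.2.2.2.2.2.2.2.1⟩
    mul_inv_cancel := fun x hx => by
      have hx' : ¬ x = kZero N := hx
      have : x⁻¹ = (h.2.2.2.2.2.2.2.2.2 x hx').choose := dif_neg hx'
      rw [this]
      exact (h.2.2.2.2.2.2.2.2.2 x hx').choose_spec
    inv_zero := dif_pos rfl
    nnqsmul := _
    nnqsmul_def := fun _ _ => rfl
    qsmul := _
    qsmul_def := fun _ _ => rfl }

/-- The additive group given by the laws. -/
noncomputable abbrev groupOfLaws {N : Struc.{u} (lang n Φ)} (h : ModuleLaws N) :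
    AddCommGroup (MS N) :=
  letI : Zero (MS N) := ⟨mZero N⟩
  letI : Add (MS N) := ⟨mAdd N⟩
  letI : Neg (MS N) := ⟨fun x => (h.2.2.2.1 x).choose⟩
  letI : AddGroup (MS N) :=
    AddGroup.ofLeftAxioms h.1 h.2.2.1 (fun x => (h.2.2.2.1 x).choose_spec)
  { (inferInstance : AddGroup (MS N)) with add_comm := h.2.1 }

/-- The operations are taken to be the interpreted symbols themselves, so that most of `Core` holds
by definition; only the action of the polynomial ring has to be constructed. -/
theorem exists_mdl_of_laws {N : Struc.{u} (lang n Φ)} (h₁ : FieldLaws N) (h₂ : ModuleLaws N)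
    (h₃ : OperatorLaws N) : ∃ A : Mdl.{u} n Φ, A.N = N := by
  let := fieldOfLaws h₁
  let := groupOfLaws h₂
  let : SMul (KS N) (MS N) := ⟨smulS N⟩
  have sa : ∀ (x : KS N) (v w : MS N), x • (v + w) = x • v + x • w := h₂.2.2.2.2.2.2.1
  have as : ∀ (x y : KS N) (v : MS N), (x + y) • v = x • v + y • v := h₂.2.2.2.2.2.2.2
  let : Module (KS N) (MS N) :=
    { one_smul := h₂.2.2.2.2.1
      mul_smul := h₂.2.2.2.2.2.1
      smul_add := sa
      add_smul := as
      smul_zero := fun x => by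
        have := sa x 0 0
        rwa [add_zero, left_eq_add] at this
      zero_smul := fun v => by
        have := as 0 0 v
        rwa [add_zero, left_eq_add] at this }
  let T : Fin n → Module.End (KS N) (MS N) := fun j =>
    { toFun := tS N j
      map_add' := h₃.1 j
      map_smul' := h₃.2.1 j }
  have hT : ∀ i j, T i * T j = T j * T i := fun i j => LinearMap.ext (h₃.2.2 i j)
  let := polyModule T hT
  exact ⟨{ N := N
           core :=
            { tower := polyModule_tower T hT
              kZero_eq := rfl
              kOne_eq := rfl
              kAdd_eq := fun _ _ => rfl
              kMul_eq := fun _ _ => rfl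
              mZero_eq := rfl
              mAdd_eq := fun _ _ => rfl
              smul_eq := fun _ _ => rfl
              t_eq := fun j v => (polyModule_X_smul T hT j v).symm } }, rfl⟩

theorem Mdl.laws (A : Mdl.{u} n Φ) : FieldLaws A.N ∧ ModuleLaws A.N ∧ OperatorLaws A.N := by
  have c := A.core
  have c1 : ∀ x y : A.K, kAdd A.N x y = x + y := c.kAdd_eq
  have c2 : ∀ x y : A.K, kMul A.N x y = x * y := c.kMul_eq
  have c3 : kZero A.N = (0 : A.K) := c.kZero_eq
  have c4 : kOne A.N = (1 : A.K) := c.kOne_eq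
  have c5 : ∀ x y : A.M, mAdd A.N x y = x + y := c.mAdd_eq
  have c6 : mZero A.N = (0 : A.M) := c.mZero_eq
  have c7 : ∀ (x : A.K) (y : A.M), smulS A.N x y = x • y := c.smul_eq
  have c8 : ∀ (j : Fin n) (y : A.M), tS A.N j y = (X j : MvPolynomial (Fin n) A.K) • y := c.t_eq
  have c9 : ∀ (x : A.K) (y : A.M), x • y = (C x : MvPolynomial (Fin n) A.K) • y :=
    fun x y => (C_smul_eq x y).symm
  refine ⟨?_, ?_, ?_⟩
  · simp only [FieldLaws, c1, c2, c3, c4]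
    exact ⟨add_assoc, add_comm, zero_add, fun x => ⟨-x, neg_add_cancel x⟩, mul_assoc, mul_comm,
      one_mul, mul_add, zero_ne_one, fun x hx => ⟨x⁻¹, mul_inv_cancel₀ hx⟩⟩
  · simp only [ModuleLaws, c1, c2, c4, c5, c6, c7]
    exact ⟨add_assoc, add_comm, zero_add, fun x => ⟨-x, neg_add_cancel x⟩, one_smul _, mul_smul,
      smul_add, add_smul⟩
  · simp only [OperatorLaws, c5, c7, c8]
    refine ⟨fun _ => smul_add _, fun j x v => ?_, fun i j v => by rw [smul_smul, smul_smul, mul_comm]⟩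
    rw [c9, c9, smul_smul, smul_smul, mul_comm]

theorem elem_mdl : Elem fun N : Struc.{u} (lang n Φ) => ∃ A : Mdl.{u} n Φ, A.N = N := by
  refine (elem_fieldLaws.and (elem_moduleLaws.and elem_operatorLaws)).congr fun N => ?_
  constructor
  · exact fun h => exists_mdl_of_laws h.1 h.2.1 h.2.2
  · rintro ⟨A, rfl⟩
    exact A.laws

end GrassModule

namespace GrassModule

open MSLanguage MvPolynomial

variable {n : ℕ} {Φ : Set PartFormula}

/-! ### First-order properties of finite families of scalars and vectors -/

/-- The property is expressed by a formula, after any substitution of terms. -/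
def FO (ι κ : Type) (P : ∀ A : Mdl.{u} n Φ, (ι → A.K) → (κ → A.M) → Prop) : Prop :=
  ∀ (Γ : List (lang n Φ).Srt) (ρ : ι → Tm n Φ Γ .K) (τ : κ → Tm n Φ Γ .M),
    ∃ φ : Formula (lang n Φ) Γ, ∀ (A : Mdl.{u} n Φ) (c : A.N.Assign Γ),
      φ.Realize A.N c ↔ P A (fun i => (ρ i).eval A.N c) (fun i => (τ i).eval A.N c)

/-- The scalar is a difference of two terms. -/
def KT (ι κ : Type) (t : ∀ A : Mdl.{u} n Φ, (ι → A.K) → (κ → A.M) → A.K) : Prop :=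
  ∀ (Γ : List (lang n Φ).Srt) (ρ : ι → Tm n Φ Γ .K) (τ : κ → Tm n Φ Γ .M),
    ∃ t₁ t₂ : Tm n Φ Γ .K, ∀ (A : Mdl.{u} n Φ) (c : A.N.Assign Γ),
      t A (fun i => (ρ i).eval A.N c) (fun i => (τ i).eval A.N c) =
        (t₁.eval A.N c : A.K) - t₂.eval A.N c

/-- The vector is a difference of two terms. -/
def MT (ι κ : Type) (t : ∀ A : Mdl.{u} n Φ, (ι → A.K) → (κ → A.M) → A.M) : Prop :=
  ∀ (Γ : List (lang n Φ).Srt) (ρ : ι → Tm n Φ Γ .K) (τ : κ → Tm n Φ Γ .M),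
    ∃ t₁ t₂ : Tm n Φ Γ .M, ∀ (A : Mdl.{u} n Φ) (c : A.N.Assign Γ),
      t A (fun i => (ρ i).eval A.N c) (fun i => (τ i).eval A.N c) =
        (t₁.eval A.N c : A.M) - t₂.eval A.N c

/-- The polynomial has coefficients given by terms, and bounded support. -/
def PT (ι κ : Type)
    (p : ∀ A : Mdl.{u} n Φ, (ι → A.K) → (κ → A.M) → MvPolynomial (Fin n) A.K) : Prop :=
  (∃ D : Finset (Fin n →₀ ℕ), ∀ A x y, (p A x y).support ⊆ D) ∧
    ∀ b, KT ι κ fun A x y => coeff b (p A x y)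

section Eval

variable {Γ : List (lang n Φ).Srt} (A : Mdl.{u} n Φ) (c : A.N.Assign Γ)

theorem Mdl.eval_zero : (tmZero : Tm n Φ Γ .K).eval A.N c = (0 : A.K) :=
  (eval_tmZero A.N c).trans A.core.kZero_eq
theorem Mdl.eval_one : (tmOne : Tm n Φ Γ .K).eval A.N c = (1 : A.K) :=
  (eval_tmOne A.N c).trans A.core.kOne_eq
theorem Mdl.eval_add (s t : Tm n Φ Γ .K) :
    (tmAdd s t).eval A.N c = (s.eval A.N c + t.eval A.N c : A.K) :=
  (eval_tmAdd A.N c s t).trans (A.core.kAdd_eq _ _)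
theorem Mdl.eval_mul (s t : Tm n Φ Γ .K) :
    (tmMul s t).eval A.N c = (s.eval A.N c * t.eval A.N c : A.K) :=
  (eval_tmMul A.N c s t).trans (A.core.kMul_eq _ _)
theorem Mdl.eval_mzero : (tmMZero : Tm n Φ Γ .M).eval A.N c = (0 : A.M) :=
  (eval_tmMZero A.N c).trans A.core.mZero_eq
theorem Mdl.eval_madd (s t : Tm n Φ Γ .M) :
    (tmMAdd s t).eval A.N c = (s.eval A.N c + t.eval A.N c : A.M) :=
  (eval_tmMAdd A.N c s t).trans (A.core.mAdd_eq _ _)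
theorem Mdl.eval_smul (s : Tm n Φ Γ .K) (t : Tm n Φ Γ .M) :
    (tmSmul s t).eval A.N c = ((s.eval A.N c : A.K) • (t.eval A.N c : A.M) : A.M) :=
  (eval_tmSmul A.N c s t).trans (A.core.smul_eq _ _)
theorem Mdl.eval_T (j : Fin n) (t : Tm n Φ Γ .M) :
    (tmT j t).eval A.N c = ((X j : MvPolynomial (Fin n) A.K) • (t.eval A.N c : A.M) : A.M) :=
  (eval_tmT A.N c j t).trans (A.core.t_eq _ _)

end Eval

variable {ι κ ι' κ' J : Type}

/-! #### Scalars -/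

theorem KT.var (i : ι) : KT ι κ fun (_ : Mdl.{u} n Φ) x _ => x i := fun Γ ρ τ =>
  ⟨ρ i, tmZero, fun A c => by rw [A.eval_zero, sub_zero]⟩

theorem KT.zero : KT ι κ fun (_ : Mdl.{u} n Φ) _ _ => 0 := fun Γ ρ τ =>
  ⟨tmZero, tmZero, fun A c => by rw [A.eval_zero, sub_zero]⟩

theorem KT.one : KT ι κ fun (_ : Mdl.{u} n Φ) _ _ => 1 := fun Γ ρ τ =>
  ⟨tmOne, tmZero, fun A c => by rw [A.eval_zero, A.eval_one, sub_zero]⟩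

variable {s t : ∀ A : Mdl.{u} n Φ, (ι → A.K) → (κ → A.M) → A.K}

theorem KT.add (hs : KT ι κ s) (ht : KT ι κ t) : KT ι κ fun A x y => s A x y + t A x y := by
  intro Γ ρ τ
  obtain ⟨s₁, s₂, hs⟩ := hs Γ ρ τ
  obtain ⟨t₁, t₂, ht⟩ := ht Γ ρ τ
  exact ⟨tmAdd s₁ t₁, tmAdd s₂ t₂, fun A c => by beta_reduce; rw [hs, ht, A.eval_add, A.eval_add]; ring⟩

theorem KT.neg (hs : KT ι κ s) : KT ι κ fun A x y => - s A x y := by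
  intro Γ ρ τ
  obtain ⟨s₁, s₂, hs⟩ := hs Γ ρ τ
  -- The language has no subtraction; writing values as differences of two terms turns negation into
  -- a swap.
  exact ⟨s₂, s₁, fun A c => by beta_reduce; rw [hs]; ring⟩

theorem KT.mul (hs : KT ι κ s) (ht : KT ι κ t) : KT ι κ fun A x y => s A x y * t A x y := by
  intro Γ ρ τ
  obtain ⟨s₁, s₂, hs⟩ := hs Γ ρ τ
  obtain ⟨t₁, t₂, ht⟩ := ht Γ ρ τ
  exact ⟨tmAdd (tmMul s₁ t₁) (tmMul s₂ t₂), tmAdd (tmMul s₁ t₂) (tmMul s₂ t₁), fun A c => by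
    beta_reduce; rw [hs, ht]; simp only [A.eval_add, A.eval_mul]; ring⟩

theorem KT.sum {s : J → ∀ A : Mdl.{u} n Φ, (ι → A.K) → (κ → A.M) → A.K} (S : Finset J)
    (h : ∀ j ∈ S, KT ι κ (s j)) : KT ι κ fun A x y => ∑ j ∈ S, s j A x y := by
  classical
  induction S using Finset.induction_on with
  | empty => simpa using KT.zero
  | insert a S ha ih =>
    simp only [Finset.sum_insert ha]
    exact (h a (Finset.mem_insert_self a S)).add
      (ih fun j hj => h j (Finset.mem_insert_of_mem hj))

theorem KT.pow (hs : KT ι κ s) (k : ℕ) : KT ι κ fun A x y => s A x y ^ k := by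
  induction k with
  | zero => simpa using KT.one
  | succ k ih => simpa only [pow_succ] using ih.mul hs

theorem KT.natCast (k : ℕ) : KT ι κ fun (A : Mdl.{u} n Φ) _ _ => (k : A.K) := by
  induction k with
  | zero => simpa using KT.zero
  | succ k ih => simpa using ih.add KT.one

theorem KT.intCast (k : ℤ) : KT ι κ fun (A : Mdl.{u} n Φ) _ _ => (k : A.K) := by
  cases k with
  | ofNat k => simpa using KT.natCast k
  | negSucc k => simpa only [Int.cast_negSucc] using (KT.natCast (k + 1)).neg

theorem KT.ite (a : Prop) [Decidable a] (hs : KT ι κ s) :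
    KT ι κ fun A x y => if a then s A x y else 0 := by
  by_cases h : a
  · simpa [h] using hs
  · simpa [h] using KT.zero

/-! #### Vectors -/

theorem MT.var (i : κ) : MT ι κ fun (_ : Mdl.{u} n Φ) _ y => y i := fun Γ ρ τ =>
  ⟨τ i, tmMZero, fun A c => by rw [A.eval_mzero, sub_zero]⟩

theorem MT.zero : MT ι κ fun (_ : Mdl.{u} n Φ) _ _ => 0 := fun Γ ρ τ =>
  ⟨tmMZero, tmMZero, fun A c => by rw [A.eval_mzero, sub_zero]⟩

variable {v w : ∀ A : Mdl.{u} n Φ, (ι → A.K) → (κ → A.M) → A.M}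

theorem MT.add (hv : MT ι κ v) (hw : MT ι κ w) : MT ι κ fun A x y => v A x y + w A x y := by
  intro Γ ρ τ
  obtain ⟨s₁, s₂, hs⟩ := hv Γ ρ τ
  obtain ⟨t₁, t₂, ht⟩ := hw Γ ρ τ
  exact ⟨tmMAdd s₁ t₁, tmMAdd s₂ t₂, fun A c => by beta_reduce; rw [hs, ht, A.eval_madd, A.eval_madd]; abel⟩

theorem MT.smul (hs : KT ι κ s) (hv : MT ι κ v) : MT ι κ fun A x y => s A x y • v A x y := by
  intro Γ ρ τ
  obtain ⟨s₁, s₂, hs⟩ := hs Γ ρ τ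
  obtain ⟨t₁, t₂, ht⟩ := hv Γ ρ τ
  exact ⟨tmMAdd (tmSmul s₁ t₁) (tmSmul s₂ t₂), tmMAdd (tmSmul s₁ t₂) (tmSmul s₂ t₁), fun A c => by
    beta_reduce; rw [hs, ht]; simp only [A.eval_madd, A.eval_smul, sub_smul, smul_sub]; abel⟩

theorem MT.sub (hv : MT ι κ v) (hw : MT ι κ w) : MT ι κ fun A x y => v A x y - w A x y := by
  simpa only [neg_smul, one_smul, ← sub_eq_add_neg] using hv.add (MT.smul KT.one.neg hw)

theorem MT.sum {v : J → ∀ A : Mdl.{u} n Φ, (ι → A.K) → (κ → A.M) → A.M} (S : Finset J)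
    (h : ∀ j ∈ S, MT ι κ (v j)) : MT ι κ fun A x y => ∑ j ∈ S, v j A x y := by
  classical
  induction S using Finset.induction_on with
  | empty => simpa using MT.zero
  | insert a S ha ih =>
    simp only [Finset.sum_insert ha]
    exact (h a (Finset.mem_insert_self a S)).add
      (ih fun j hj => h j (Finset.mem_insert_of_mem hj))

theorem MT.X_smul (j : Fin n) (hv : MT ι κ v) :
    MT ι κ fun A x y => (X j : MvPolynomial (Fin n) A.K) • v A x y := by
  intro Γ ρ τ
  obtain ⟨t₁, t₂, ht⟩ := hv Γ ρ τ
  exact ⟨tmT j t₁, tmT j t₂, fun A c => by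
    beta_reduce; rw [ht]; simp only [A.eval_T, smul_sub]⟩

theorem MT.monomial_smul (b : Fin n →₀ ℕ) (hv : MT ι κ v) :
    MT ι κ fun A x y => (monomial b 1 : MvPolynomial (Fin n) A.K) • v A x y := by
  induction b using Finsupp.induction_linear generalizing v with
  | zero =>
    simpa only [monomial_zero', map_one, one_smul] using hv
  | add a b ha hb =>
    have := ha (hb hv)
    simpa only [smul_smul, monomial_mul, mul_one] using this
  | single j k =>
    simp only [← X_pow_eq_monomial]
    induction k with
    | zero => simpa using hv
    | succ k ih => simpa only [pow_succ', mul_smul] using ih.X_smul j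

theorem smul_eq_sum {K M : Type*} [Field K] [AddCommGroup M] [Module K M]
    [Module (MvPolynomial (Fin n) K) M] [IsScalarTower K (MvPolynomial (Fin n) K) M]
    {D : Finset (Fin n →₀ ℕ)} {p : MvPolynomial (Fin n) K} (h : p.support ⊆ D) (v : M) :
    p • v = ∑ b ∈ D, coeff b p • (monomial b 1 : MvPolynomial (Fin n) K) • v := by
  have : p = ∑ b ∈ D, coeff b p • (monomial b 1 : MvPolynomial (Fin n) K) := by
    conv_lhs => rw [p.as_sum]
    refine (Finset.sum_subset h fun b _ hb => ?_).trans (Finset.sum_congr rfl fun b _ => ?_)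
    · rw [notMem_support_iff.1 hb, map_zero]
    · rw [smul_monomial, smul_eq_mul, mul_one]
  conv_lhs => rw [this, Finset.sum_smul]
  exact Finset.sum_congr rfl fun b _ => smul_assoc _ _ _

theorem PT.smul {p : ∀ A : Mdl.{u} n Φ, (ι → A.K) → (κ → A.M) → MvPolynomial (Fin n) A.K}
    (hp : PT ι κ p) (hv : MT ι κ v) : MT ι κ fun A x y => p A x y • v A x y := by
  obtain ⟨⟨D, hD⟩, hc⟩ := hp
  simp only [smul_eq_sum (hD _ _ _)]
  exact MT.sum D fun b _ => MT.smul (hc b) (hv.monomial_smul b)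

/-! #### Polynomials -/

theorem PT.monomial (b : Fin n →₀ ℕ) (hs : KT ι κ s) :
    PT ι κ fun A x y => MvPolynomial.monomial b (s A x y) := by
  classical
  refine ⟨⟨{b}, fun A x y => support_monomial_subset⟩, fun b' => ?_⟩
  simp only [coeff_monomial]
  exact hs.ite _

variable {p q : ∀ A : Mdl.{u} n Φ, (ι → A.K) → (κ → A.M) → MvPolynomial (Fin n) A.K}

theorem PT.add (hp : PT ι κ p) (hq : PT ι κ q) : PT ι κ fun A x y => p A x y + q A x y := by
  classical
  obtain ⟨⟨D, hD⟩, hc⟩ := hp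
  obtain ⟨⟨D', hD'⟩, hc'⟩ := hq
  refine ⟨⟨D ∪ D', fun A x y => support_add.trans (Finset.union_subset_union (hD A x y)
    (hD' A x y))⟩, fun b => ?_⟩
  simp only [coeff_add]
  exact (hc b).add (hc' b)

theorem PT.mul (hp : PT ι κ p) (hq : PT ι κ q) : PT ι κ fun A x y => p A x y * q A x y := by
  classical
  obtain ⟨⟨D, hD⟩, hc⟩ := hp
  obtain ⟨⟨D', hD'⟩, hc'⟩ := hq
  refine ⟨⟨Finset.image₂ (· + ·) D D', fun A x y => (support_mul _ _).trans
    (Finset.image₂_subset (hD A x y) (hD' A x y))⟩, fun b => ?_⟩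
  simp only [coeff_mul]
  exact KT.sum _ fun d _ => (hc d.1).mul (hc' d.2)

theorem PT.sum {p : J → ∀ A : Mdl.{u} n Φ, (ι → A.K) → (κ → A.M) → MvPolynomial (Fin n) A.K}
    (S : Finset J) (h : ∀ j ∈ S, PT ι κ (p j)) : PT ι κ fun A x y => ∑ j ∈ S, p j A x y := by
  classical
  induction S using Finset.induction_on with
  | empty => exact ⟨⟨∅, by simp⟩, fun b => by simpa using KT.zero⟩
  | insert a S ha ih =>
    simp only [Finset.sum_insert ha]
    exact (h a (Finset.mem_insert_self a S)).add
      (ih fun j hj => h j (Finset.mem_insert_of_mem hj))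

theorem PT.map_int (p : MvPolynomial (Fin n) ℤ) :
    PT ι κ fun (A : Mdl.{u} n Φ) _ _ => map (Int.castRingHom A.K) p :=
  ⟨⟨p.support, fun _ _ _ => support_map_subset _ _⟩, fun b => by
    simpa only [coeff_map, eq_intCast] using KT.intCast (coeff b p)⟩

/-! #### Formulas -/

variable {P Q : ∀ A : Mdl.{u} n Φ, (ι → A.K) → (κ → A.M) → Prop}

theorem FO.comap {P : ∀ A : Mdl.{u} n Φ, (ι → A.K) → (κ → A.M) → Prop} (h : FO ι κ P)
    (f : ι → ι') (g : κ → κ') :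
    FO ι' κ' fun A x y => P A (fun i => x (f i)) (fun i => y (g i)) := fun Γ ρ τ =>
  h Γ (fun i => ρ (f i)) (fun i => τ (g i))

theorem FO.false : FO ι κ fun (_ : Mdl.{u} n Φ) _ _ => False := fun _ _ _ =>
  ⟨.falsum, fun _ _ => Iff.rfl⟩

theorem FO.imp (hP : FO ι κ P) (hQ : FO ι κ Q) : FO ι κ fun A x y => P A x y → Q A x y := by
  intro Γ ρ τ
  obtain ⟨φ, hφ⟩ := hP Γ ρ τ
  obtain ⟨ψ, hψ⟩ := hQ Γ ρ τ
  exact ⟨.imp φ ψ, fun A c => imp_congr (hφ A c) (hψ A c)⟩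

theorem FO.not (hP : FO ι κ P) : FO ι κ fun A x y => ¬ P A x y := hP.imp FO.false

theorem FO.congr (hP : FO ι κ P) (h : ∀ A x y, P A x y ↔ Q A x y) : FO ι κ Q := by
  intro Γ ρ τ
  obtain ⟨φ, hφ⟩ := hP Γ ρ τ
  exact ⟨φ, fun A c => (hφ A c).trans (h _ _ _)⟩

theorem FO.and (hP : FO ι κ P) (hQ : FO ι κ Q) : FO ι κ fun A x y => P A x y ∧ Q A x y :=
  (hP.imp hQ.not).not.congr fun A x y => by tauto

theorem FO.iff (hP : FO ι κ P) (hQ : FO ι κ Q) : FO ι κ fun A x y => (P A x y ↔ Q A x y) :=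
  ((hP.imp hQ).and (hQ.imp hP)).congr fun A x y => iff_def.symm

theorem FO.true : FO ι κ fun (_ : Mdl.{u} n Φ) _ _ => True :=
  FO.false.not.congr fun _ _ _ => by simp

theorem FO.forall_finset {P : J → ∀ A : Mdl.{u} n Φ, (ι → A.K) → (κ → A.M) → Prop} (S : Finset J)
    (h : ∀ j ∈ S, FO ι κ (P j)) : FO ι κ fun A x y => ∀ j ∈ S, P j A x y := by
  classical
  induction S using Finset.induction_on with
  | empty => simpa using FO.true
  | insert a S ha ih =>
    simp only [Finset.forall_mem_insert]
    exact (h a (Finset.mem_insert_self a S)).and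
      (ih fun j hj => h j (Finset.mem_insert_of_mem hj))

theorem FO.forall_finite [Finite J] {P : J → ∀ A : Mdl.{u} n Φ, (ι → A.K) → (κ → A.M) → Prop}
    (h : ∀ j, FO ι κ (P j)) : FO ι κ fun A x y => ∀ j, P j A x y := by
  have := Fintype.ofFinite J
  simpa using FO.forall_finset Finset.univ fun j _ => h j

theorem FO.kEq (hs : KT ι κ s) (ht : KT ι κ t) : FO ι κ fun A x y => s A x y = t A x y := by
  intro Γ ρ τ
  obtain ⟨s₁, s₂, hs⟩ := hs Γ ρ τ
  obtain ⟨t₁, t₂, ht⟩ := ht Γ ρ τ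
  refine ⟨.eq (tmAdd s₁ t₂) (tmAdd t₁ s₂), fun A c => ?_⟩
  change (tmAdd s₁ t₂).eval A.N c = (tmAdd t₁ s₂).eval A.N c ↔ _
  beta_reduce
  rw [hs, ht, sub_eq_sub_iff_add_eq_add, A.eval_add, A.eval_add]

theorem FO.mEq (hv : MT ι κ v) (hw : MT ι κ w) : FO ι κ fun A x y => v A x y = w A x y := by
  intro Γ ρ τ
  obtain ⟨s₁, s₂, hs⟩ := hv Γ ρ τ
  obtain ⟨t₁, t₂, ht⟩ := hw Γ ρ τ
  refine ⟨.eq (tmMAdd s₁ t₂) (tmMAdd t₁ s₂), fun A c => ?_⟩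
  change (tmMAdd s₁ t₂).eval A.N c = (tmMAdd t₁ s₂).eval A.N c ↔ _
  beta_reduce
  rw [hs, ht, sub_eq_sub_iff_add_eq_add, A.eval_madd, A.eval_madd]

/-- The uniform bound on supports reduces equality of polynomials to finitely many equations between
coefficients. -/
theorem FO.pEq (hp : PT ι κ p) (hq : PT ι κ q) : FO ι κ fun A x y => p A x y = q A x y := by
  classical
  obtain ⟨⟨D, hD⟩, hc⟩ := hp
  obtain ⟨⟨D', hD'⟩, hc'⟩ := hq
  refine (FO.forall_finset (D ∪ D') fun b _ => FO.kEq (hc b) (hc' b)).congr fun A x y => ?_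
  rw [MvPolynomial.ext_iff]
  refine ⟨fun h b => ?_, fun h b _ => h b⟩
  by_cases hb : b ∈ D ∪ D'
  · exact h b hb
  · rw [Finset.mem_union, not_or] at hb
    rw [notMem_support_iff.1 fun h => hb.1 (hD A x y h),
      notMem_support_iff.1 fun h => hb.2 (hD' A x y h)]

/-- Here the closure of `FO` under substitution is used: the hypothesis is applied in the context
with one more variable, to the weakened terms and that variable. -/
theorem FO.forall_scalar {P : ∀ A : Mdl.{u} n Φ, (ι → A.K) → (κ → A.M) → A.K → Prop}
    (h : FO (ι ⊕ Unit) κ fun A x y => P A (fun i => x (.inl i)) y (x (.inr ()))) :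
    FO ι κ fun A x y => ∀ z, P A x y z := by
  intro Γ ρ τ
  obtain ⟨φ, hφ⟩ := h (.K :: Γ) (Sum.elim (fun i => (ρ i).weaken _) fun _ => Term.head _)
    (fun i => (τ i).weaken _)
  exact ⟨.all _ φ, fun A c => forall_congr' fun z => (hφ A _).trans (iff_of_eq (_root_.congr (_root_.congr
    (congrArg (P A) (_root_.funext fun i => Term.eval_weaken A.N z c (ρ i)))
      (_root_.funext fun i => Term.eval_weaken A.N z c (τ i))) rfl))⟩

theorem FO.forall_vector {P : ∀ A : Mdl.{u} n Φ, (ι → A.K) → (κ → A.M) → A.M → Prop}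
    (h : FO ι (κ ⊕ Unit) fun A x y => P A x (fun i => y (.inl i)) (y (.inr ()))) :
    FO ι κ fun A x y => ∀ z, P A x y z := by
  intro Γ ρ τ
  obtain ⟨φ, hφ⟩ := h (.M :: Γ) (fun i => (ρ i).weaken _)
    (Sum.elim (fun i => (τ i).weaken _) fun _ => Term.head _)
  exact ⟨.all _ φ, fun A c => forall_congr' fun z => (hφ A _).trans (iff_of_eq (_root_.congr (_root_.congr
    (congrArg (P A) (_root_.funext fun i => Term.eval_weaken A.N z c (ρ i)))
      (_root_.funext fun i => Term.eval_weaken A.N z c (τ i))) rfl))⟩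

/-- A block of quantifiers is peeled off one variable at a time, by induction on the finite index
type up to bijection. -/
theorem FO.forall_scalars [Finite J]
    {P : ∀ A : Mdl.{u} n Φ, (ι → A.K) → (κ → A.M) → (J → A.K) → Prop}
    (h : FO (ι ⊕ J) κ fun A x y => P A (fun i => x (.inl i)) y (fun j => x (.inr j))) :
    FO ι κ fun A x y => ∀ z : J → A.K, P A x y z := by
  induction J using Finite.induction_empty_option generalizing ι with
  | of_equiv e ih =>
    refine (ih (P := fun A x y z => P A x y (fun j => z (e.symm j)))
      (h.comap (Sum.map id e.symm) id)).congr fun A x y => ?_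
    exact ⟨fun H z => by simpa using H (fun j => z (e j)), fun H z => H _⟩
  | h_empty =>
    refine (h.comap (Sum.elim id PEmpty.elim) id).congr fun A x y => ?_
    exact ⟨fun H z => (Subsingleton.elim _ z : (fun j : PEmpty =>
      x (Sum.elim id PEmpty.elim (.inr j))) = z) ▸ H, fun H => H _⟩
  | @h_option J _ ih =>
    refine FO.congr (P := fun A x y => ∀ z₀ : A.K, ∀ z : J → A.K, P A x y
      (fun j => Option.elim j z₀ z)) (FO.forall_scalar (ih ?_)) fun A x y => ?_
    · refine (h.comap (Sum.elim (fun i => .inl (.inl i))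
        (fun j => Option.elim j (.inl (.inr ())) .inr)) id).congr fun A x y => ?_
      have : (fun j : Option J => x (Option.elim j (Sum.inl (Sum.inr ())) Sum.inr)) =
          fun j => Option.elim j (x (Sum.inl (Sum.inr ()))) fun j => x (Sum.inr j) :=
        funext fun j => by cases j <;> rfl
      simp only [Sum.elim_inl, Sum.elim_inr, this, id]
    · refine ⟨fun H z => ?_, fun H z₀ z => H _⟩
      convert H (z none) (fun j => z (some j)) using 1
      funext j
      cases j <;> rfl

theorem FO.forall_vectors [Finite J]
    {P : ∀ A : Mdl.{u} n Φ, (ι → A.K) → (κ → A.M) → (J → A.M) → Prop}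
    (h : FO ι (κ ⊕ J) fun A x y => P A x (fun i => y (.inl i)) (fun j => y (.inr j))) :
    FO ι κ fun A x y => ∀ z : J → A.M, P A x y z := by
  induction J using Finite.induction_empty_option generalizing κ with
  | of_equiv e ih =>
    refine (ih (P := fun A x y z => P A x y (fun j => z (e.symm j)))
      (h.comap id (Sum.map id e.symm))).congr fun A x y => ?_
    exact ⟨fun H z => by simpa using H (fun j => z (e j)), fun H z => H _⟩
  | h_empty =>
    refine (h.comap id (Sum.elim id PEmpty.elim)).congr fun A x y => ?_
    exact ⟨fun H z => (Subsingleton.elim _ z : (fun j : PEmpty =>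
      y (Sum.elim id PEmpty.elim (.inr j))) = z) ▸ H, fun H => H _⟩
  | @h_option J _ ih =>
    refine FO.congr (P := fun A x y => ∀ z₀ : A.M, ∀ z : J → A.M, P A x y
      (fun j => Option.elim j z₀ z)) (FO.forall_vector (ih ?_)) fun A x y => ?_
    · refine (h.comap id (Sum.elim (fun i => .inl (.inl i))
        (fun j => Option.elim j (.inl (.inr ())) .inr))).congr fun A x y => ?_
      have : (fun j : Option J => y (Option.elim j (Sum.inl (Sum.inr ())) Sum.inr)) =
          fun j => Option.elim j (y (Sum.inl (Sum.inr ()))) fun j => y (Sum.inr j) :=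
        funext fun j => by cases j <;> rfl
      simp only [Sum.elim_inl, Sum.elim_inr, this, id]
    · refine ⟨fun H z => ?_, fun H z₀ z => H _⟩
      convert H (z none) (fun j => z (some j)) using 1
      funext j
      cases j <;> rfl

theorem FO.exists_scalars [Finite J]
    {P : ∀ A : Mdl.{u} n Φ, (ι → A.K) → (κ → A.M) → (J → A.K) → Prop}
    (h : FO (ι ⊕ J) κ fun A x y => P A (fun i => x (.inl i)) y (fun j => x (.inr j))) :
    FO ι κ fun A x y => ∃ z : J → A.K, P A x y z :=
  (FO.forall_scalars (P := fun A x y z => ¬ P A x y z) h.not).not.congr fun A x y => by simp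

theorem FO.exists_scalar
    {P : ∀ A : Mdl.{u} n Φ, (ι → A.K) → (κ → A.M) → A.K → Prop}
    (h : FO (ι ⊕ Unit) κ fun A x y => P A (fun i => x (.inl i)) y (x (.inr ()))) :
    FO ι κ fun A x y => ∃ z, P A x y z :=
  (FO.forall_scalar (P := fun A x y z => ¬ P A x y z) h.not).not.congr fun A x y => by simp

theorem FO.exists_vector
    {P : ∀ A : Mdl.{u} n Φ, (ι → A.K) → (κ → A.M) → A.M → Prop}
    (h : FO ι (κ ⊕ Unit) fun A x y => P A x (fun i => y (.inl i)) (y (.inr ()))) :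
    FO ι κ fun A x y => ∃ z, P A x y z :=
  (FO.forall_vector (P := fun A x y z => ¬ P A x y z) h.not).not.congr fun A x y => by simp

/-- The property of the model is expressed by a sentence. -/
def MSent (P : Mdl.{u} n Φ → Prop) : Prop :=
  ∃ φ : Formula (lang n Φ) [], ∀ A : Mdl.{u} n Φ, φ.Realize A.N (fun i => i.elim0) ↔ P A

theorem FO.mSent {P : Mdl.{u} n Φ → Prop} (h : FO Empty Empty fun A _ _ => P A) : MSent P := by
  obtain ⟨φ, hφ⟩ := h [] Empty.elim Empty.elim
  exact ⟨φ, fun A => hφ A _⟩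

/-- The class of models is elementary. -/
def MElem (P : Mdl.{u} n Φ → Prop) : Prop :=
  ∃ T : Theory (lang n Φ), ∀ A : Mdl.{u} n Φ, A.N.Models T ↔ P A

theorem MSent.mElem {P : Mdl.{u} n Φ → Prop} (h : MSent P) : MElem P := by
  obtain ⟨φ, hφ⟩ := h
  refine ⟨{φ}, fun A => ⟨fun h => (hφ A).1 (h φ rfl), fun h ψ hψ => ?_⟩⟩
  obtain rfl : ψ = φ := hψ
  exact (hφ A).2 h

theorem MElem.forall {J : Sort*} {P : J → Mdl.{u} n Φ → Prop} (h : ∀ j, MElem (P j)) :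
    MElem fun A => ∀ j, P j A := by
  choose T hT using h
  refine ⟨⋃ j, T j, fun A => ?_⟩
  simp only [← hT, Struc.Models, Set.mem_iUnion]
  exact ⟨fun H j φ hφ => H φ ⟨j, hφ⟩, fun H φ ⟨j, hj⟩ => H j φ hj⟩

theorem MElem.and {P Q : Mdl.{u} n Φ → Prop} (h : MElem P) (h' : MElem Q) :
    MElem fun A => P A ∧ Q A := by
  obtain ⟨T, hT⟩ := h
  obtain ⟨T', hT'⟩ := h'
  refine ⟨T ∪ T', fun A => Iff.trans ?_ (and_congr (hT A) (hT' A))⟩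
  exact ⟨fun H => ⟨fun φ h => H φ (.inl h), fun φ h => H φ (.inr h)⟩,
    fun H φ h => h.elim (H.1 φ) (H.2 φ)⟩

theorem MElem.congr {P Q : Mdl.{u} n Φ → Prop} (h : MElem P) (h' : ∀ A, P A ↔ Q A) :
    MElem Q := by
  obtain ⟨T, hT⟩ := h
  exact ⟨T, fun A => (hT A).trans (h' A)⟩

theorem MElem.elem {P : Mdl.{u} n Φ → Prop} (h : MElem P) :
    Elem fun N : Struc.{u} (lang n Φ) => ∃ A : Mdl.{u} n Φ, A.N = N ∧ P A := by
  obtain ⟨T, hT⟩ := h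
  obtain ⟨T₀, hT₀⟩ := elem_mdl.{u} (n := n) (Φ := Φ)
  refine ⟨T₀ ∪ T, fun N => ⟨fun H => ?_, ?_⟩⟩
  · obtain ⟨A, rfl⟩ := (hT₀ N).1 fun φ h => H φ (.inl h)
    exact ⟨A, rfl, (hT A).1 fun φ h => H φ (.inr h)⟩
  · rintro ⟨A, rfl, hA⟩ φ (h | h)
    · exact (hT₀ A.N).2 ⟨A, rfl⟩ φ h
    · exact (hT A).2 hA φ h

end GrassModule

namespace GrassModule

open MSLanguage MvPolynomial

variable {n : ℕ} {Φ : Set PartFormula} {ι κ : Type}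

/-! ### Formulas of the language of rings -/

theorem KT.ringTerm {V : Type} (t : FirstOrder.Language.ring.Term V) (e : V → ι) :
    KT ι κ fun (A : Mdl.{u} n Φ) x _ =>
      letI := FirstOrder.Ring.compatibleRingOfRing A.K
      t.realize fun v => x (e v) := by
  induction t with
  | var v => exact KT.var (e v)
  | func f ts ih =>
    cases f with
    | add => exact (ih 0).add (ih 1)
    | mul => exact (ih 0).mul (ih 1)
    | neg => exact (ih 0).neg
    | zero => exact KT.zero
    | one => exact KT.one

theorem FO.ringFormula {V : Type} {φ : FirstOrder.Language.ring.Formula V}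
    (hφ : FirstOrder.Language.BoundedFormula.IsQF φ) (e : V → ι) :
    FO ι κ fun (A : Mdl.{u} n Φ) x _ =>
      letI := FirstOrder.Ring.compatibleRingOfRing A.K
      φ.Realize fun v => x (e v) := by
  unfold FirstOrder.Language.Formula.Realize
  induction hφ with
  | falsum => exact FO.false
  | of_isAtomic h =>
    cases h with
    | equal t₁ t₂ =>
      have h : ∀ t : FirstOrder.Language.ring.Term (V ⊕ Fin 0), KT ι κ
          fun (A : Mdl.{u} n Φ) x _ =>
            letI := FirstOrder.Ring.compatibleRingOfRing A.K
            t.realize (Sum.elim (fun v => x (e v)) default) := by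
        intro t
        have := KT.ringTerm (n := n) (Φ := Φ) (κ := κ) t (fun v : V ⊕ Fin 0 => Sum.elim e Fin.elim0 v)
        convert this using 6 with A x y i
        rcases i with i | i
        · rfl
        · exact i.elim0
      exact FO.kEq (h t₁) (h t₂)
    | rel R ts => exact R.elim
  | imp h₁ h₂ ih₁ ih₂ => exact ih₁.imp ih₂

theorem FO.holds (P : PartFormula) (e : (j : Fin P.m) → Fin (P.k j) → Fin (P.k j) → ι)
    (f : Fin P.l → ι) : FO ι κ fun (A : Mdl.{u} n Φ) x _ =>
      P.Holds A.K (fun j a b => x (e j a b)) (fun i => x (f i)) := by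
  refine (FO.ringFormula P.isQF (Sum.elim (fun q => e q.1 q.2.1 q.2.2) f)).congr fun A x y => ?_
  unfold PartFormula.Holds
  refine iff_of_eq (congrArg _ (_root_.funext fun v => ?_))
  rcases v with v | v <;> rfl

/-! ### Row spaces -/

/-- The rows of X are combinations of those of Y exactly when X = BY for some square matrix B, which
is an existential condition on scalars. -/
theorem rowSpan_le_iff {F : Type*} [Field F] {k : ℕ} {X Y : Fin k → Fin k → F} :
    rowSpan X ≤ rowSpan Y ↔ ∃ B : Fin k × Fin k → F, ∀ a b, X a b = ∑ c, B (a, c) * Y c b := by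
  rw [rowSpan, Submodule.span_le]
  constructor
  · intro h
    have : ∀ a, ∃ B : Fin k → F, ∑ c, B c • Y c = X a := fun a =>
      Submodule.mem_span_range_iff_exists_fun F |>.1 (h ⟨a, rfl⟩)
    choose B hB using this
    refine ⟨fun p => B p.1 p.2, fun a b => ?_⟩
    rw [← hB]
    simp
  · rintro ⟨B, hB⟩ _ ⟨a, rfl⟩
    refine (Submodule.mem_span_range_iff_exists_fun F).2 ⟨fun c => B (a, c), ?_⟩
    ext b
    simp [hB]

theorem FO.rowSpan_le {k : ℕ} (e f : Fin k → Fin k → ι) : FO ι κ fun (_ : Mdl.{u} n Φ) x _ =>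
    rowSpan (fun a b => x (e a b)) ≤ rowSpan (fun a b => x (f a b)) := by
  refine FO.congr (P := fun A x y => ∃ B : Fin k × Fin k → A.K, ∀ a b,
    x (e a b) = ∑ c, B (a, c) * x (f c b)) ?_ fun A x y => rowSpan_le_iff.symm
  exact FO.exists_scalars <| FO.forall_finite fun a => FO.forall_finite fun b =>
    FO.kEq (KT.var _) (KT.sum _ fun c _ => (KT.var _).mul (KT.var _))

theorem FO.rowSpan_eq {k : ℕ} (e f : Fin k → Fin k → ι) : FO ι κ fun (_ : Mdl.{u} n Φ) x _ =>
    rowSpan (fun a b => x (e a b)) = rowSpan (fun a b => x (f a b)) :=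
  ((FO.rowSpan_le e f).and (FO.rowSpan_le f e)).congr fun _ _ _ => le_antisymm_iff.symm

/-- Both inclusions are spelled out with quantifiers over tuples of scalars only, as `FO` requires.
-/
theorem rowSpan_eq_relations_iff {F M : Type*} [Field F] [AddCommGroup M] [Module F M] {k : ℕ}
    {X : Fin k → Fin k → F} {v : Fin k → M} : rowSpan X = relations F v ↔
      (∀ a, ∑ b, X a b • v b = 0) ∧
      ∀ c : Fin k → F, ∑ b, c b • v b = 0 → ∃ B : Fin k → F, ∀ b, c b = ∑ a, B a * X a b := by
  rw [le_antisymm_iff, rowSpan, Submodule.span_le]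
  refine and_congr ?_ ?_
  · rw [Set.range_subset_iff]
    rfl
  · refine forall_congr' fun c => imp_congr Iff.rfl ?_
    rw [Submodule.mem_span_range_iff_exists_fun]
    refine exists_congr fun B => ?_
    rw [funext_iff]
    refine forall_congr' fun b => ?_
    simp [eq_comm]

theorem FO.rowSpan_eq_relations {k : ℕ} (e : Fin k → Fin k → ι) (f : Fin k → κ) :
    FO ι κ fun (A : Mdl.{u} n Φ) x y =>
      rowSpan (fun a b => x (e a b)) = relations A.K fun a => y (f a) := by
  refine FO.congr (P := fun A x y => (∀ a, ∑ b, x (e a b) • y (f b) = 0) ∧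
      ∀ c : Fin k → A.K, ∑ b, c b • y (f b) = 0 →
        ∃ B : Fin k → A.K, ∀ b, c b = ∑ a, B a * x (e a b)) ?_
      fun A x y => rowSpan_eq_relations_iff.symm
  refine FO.and (FO.forall_finite fun a => FO.mEq (MT.sum _ fun b _ =>
    MT.smul (KT.var _) (MT.var _)) MT.zero) <| FO.forall_scalars <| FO.imp (FO.mEq
    (MT.sum _ fun b _ => MT.smul (KT.var _) (MT.var _)) MT.zero) <| FO.exists_scalars <|
    FO.forall_finite fun b => FO.kEq (KT.var _) (KT.sum _ fun a _ => (KT.var _).mul (KT.var _))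

/-! ### The Grassmannian symbols -/

theorem FO.pi_eq (i : ℕ+) (e f : Fin i → Fin i → ι) : FO ι κ fun (A : Mdl.{u} n Φ) x _ =>
    piS A.N i (fun a b => x (e a b)) = piS A.N i (fun a b => x (f a b)) := fun _ ρ _ =>
  ⟨.eq (tmPi i fun a b => ρ (e a b)) (tmPi i fun a b => ρ (f a b)), fun _ _ => Iff.rfl⟩

theorem FO.pi_eq_D (i : ℕ+) (e : Fin i → Fin i → ι) (f : Fin i → κ) :
    FO ι κ fun (A : Mdl.{u} n Φ) x y =>
      piS A.N i (fun a b => x (e a b)) = dS A.N i (fun a => y (f a)) := fun _ ρ τ =>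
  ⟨.eq (tmPi i fun a b => ρ (e a b)) (tmD i fun a => τ (f a)), fun _ _ => Iff.rfl⟩

theorem FO.pred (P : Φ) (e : (j : Fin P.1.m) → Fin (P.1.k j) → Fin (P.1.k j) → ι)
    (f : Fin P.1.l → ι) : FO ι κ fun (A : Mdl.{u} n Φ) x _ =>
      pS A.N P (fun j => piS A.N (P.1.k j) fun a b => x (e j a b)) (fun i => x (f i)) :=
  fun Γ ρ τ => ⟨.rel (L := lang n Φ) P fun a => match a with
    | .inl j => tmPi (P.1.k j) fun a b => ρ (e j a b)
    | .inr a => ρ (f a), fun A c => by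
    refine iff_of_eq (congrArg (A.N.rel P) (_root_.funext fun a => ?_))
    rcases a with a | a <;> rfl⟩

/-- The axioms on the Grassmannians and the ideal. -/
structure Mdl.IsGrass (I : Ideal (MvPolynomial (Fin n) ℤ)) (A : Mdl.{u} n Φ) : Prop where
  kill : ∀ p ∈ I, ∀ v : A.M, map (Int.castRingHom A.K) p • v = 0
  pi_surjective : ∀ i, Function.Surjective (piS A.N i)
  pi_eq_iff : ∀ (i : ℕ+) (X Y : Fin i → Fin i → A.K),
    piS A.N i X = piS A.N i Y ↔ rowSpan X = rowSpan Y
  pred_iff : ∀ (P : Φ) p (y : Fin P.1.l → A.K), pS A.N P p y ↔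
    ∃ X : (j : Fin P.1.m) → Fin (P.1.k j) → Fin (P.1.k j) → A.K,
      P.1.Holds A.K X y ∧ ∀ j, piS A.N (P.1.k j) (X j) = p j
  d_eq : ∀ (i : ℕ+) (v : Fin i → A.M) (X : Fin i → Fin i → A.K),
    piS A.N i X = dS A.N i v → rowSpan X = relations A.K v

/-- `FO` has no variables of Grassmannian sort, so this formula is assembled by hand. The entries in
S are quantified, one in each induction step, and the others are prescribed by ρ. -/
theorem exists_formula_pi_eq (i : ℕ+) (S : Finset (Fin i × Fin i)) :
    ∀ (Γ : List (lang n Φ).Srt) (g : Tm n Φ Γ (.G i)) (ρ : Fin i × Fin i → Tm n Φ Γ .K),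
      ∃ φ : Formula (lang n Φ) Γ, ∀ (A : Mdl.{u} n Φ) (c : A.N.Assign Γ), φ.Realize A.N c ↔
        ∃ X : Fin i × Fin i → A.K, (∀ q, q ∉ S → X q = (ρ q).eval A.N c) ∧
          piS A.N i (fun a b => X (a, b)) = g.eval A.N c := by
  classical
  induction S using Finset.induction_on with
  | empty =>
    refine fun Γ g ρ => ⟨.eq (tmPi i fun a b => ρ (a, b)) g, fun A c => ⟨fun h =>
      ⟨fun q => (ρ q).eval A.N c, fun _ _ => rfl, h⟩, fun ⟨X, h, h'⟩ => ?_⟩⟩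
    obtain rfl : X = fun q => (ρ q).eval A.N c :=
      _root_.funext fun q => h q (Finset.notMem_empty q)
    exact h'
  | insert q₀ S hq ih =>
    intro Γ g ρ
    obtain ⟨φ, hφ⟩ := ih (.K :: Γ) (g.weaken _)
      (fun q => if q = q₀ then Term.head _ else (ρ q).weaken _)
    refine ⟨.ex _ φ, fun A c => (Formula.realize_ex _ _).trans ⟨?_, ?_⟩⟩
    · rintro ⟨x, hx⟩
      obtain ⟨X, h, h'⟩ := (hφ A _).1 hx
      refine ⟨X, fun q hq => ?_, h'.trans (Term.eval_weaken A.N x c g)⟩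
      rw [Finset.mem_insert, not_or] at hq
      have := h q hq.2
      rw [if_neg hq.1] at this
      exact this.trans (Term.eval_weaken A.N x c (ρ q))
    · rintro ⟨X, h, h'⟩
      refine ⟨X q₀, (hφ A _).2 ⟨X, fun q hq' => ?_, h'.trans (Term.eval_weaken A.N _ c g).symm⟩⟩
      split_ifs with hqq
      · subst hqq
        rfl
      · exact (h q (by simp [hqq, hq'])).trans (Term.eval_weaken A.N _ c (ρ q)).symm

theorem mSent_pi_surjective (i : ℕ+) :
    MSent fun A : Mdl.{u} n Φ => Function.Surjective (piS A.N i) := by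
  obtain ⟨φ, hφ⟩ := exists_formula_pi_eq i Finset.univ [.G i] (Term.head _) fun _ => tmZero
  refine ⟨.all _ φ, fun A => forall_congr' fun p => (hφ A _).trans ?_⟩
  exact ⟨fun ⟨X, _, hX⟩ => ⟨_, hX⟩, fun ⟨X, hX⟩ =>
    ⟨fun q => X q.1 q.2, fun q hq => (hq (Finset.mem_univ q)).elim, hX⟩⟩

theorem uncurry_exists {K : Type*} {m : ℕ} {k : Fin m → ℕ}
    {P : ((j : Fin m) → Fin (k j) → Fin (k j) → K) → Prop} :
    (∃ X, P X) ↔ ∃ X : (Σ j, Fin (k j) × Fin (k j)) → K, P fun j a b => X ⟨j, a, b⟩ :=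
  ⟨fun ⟨X, h⟩ => ⟨fun q => X q.1 q.2.1 q.2.2, h⟩, fun ⟨_, h⟩ => ⟨_, h⟩⟩

theorem mElem_isGrass (I : Ideal (MvPolynomial (Fin n) ℤ)) :
    MElem fun A : Mdl.{u} n Φ => A.IsGrass I := by
  have h₁ : MElem fun A : Mdl.{u} n Φ =>
      ∀ p : I, ∀ v : A.M, map (Int.castRingHom A.K) (p : MvPolynomial (Fin n) ℤ) • v = 0 :=
    MElem.forall fun p => FO.mSent (FO.forall_vector (FO.mEq ((PT.map_int _).smul (MT.var _))
      MT.zero)) |>.mElem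
  have h₂ : MElem fun A : Mdl.{u} n Φ => ∀ i, Function.Surjective (piS A.N i) :=
    MElem.forall fun i => (mSent_pi_surjective i).mElem
  have h₃ : MElem fun A : Mdl.{u} n Φ => ∀ i : ℕ+, ∀ X Y : Fin i × Fin i → A.K,
      (piS A.N i fun a b => X (a, b)) = (piS A.N i fun a b => Y (a, b)) ↔
      rowSpan (fun a b => X (a, b)) = rowSpan fun a b => Y (a, b) :=
    MElem.forall fun i => FO.mSent (FO.forall_scalars <| FO.forall_scalars <|
      (FO.pi_eq _ _ _).iff (FO.rowSpan_eq _ _)) |>.mElem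
  -- Subspaces are parametrized by matrices Y, which avoids quantifying over Grassmannian sorts;
  -- surjectivity of π restores the general form.
  have h₄ : MElem fun A : Mdl.{u} n Φ => ∀ P : Φ,
      ∀ Y : (Σ j, Fin (P.1.k j) × Fin (P.1.k j)) → A.K, ∀ y : Fin P.1.l → A.K,
      pS A.N P (fun j => piS A.N (P.1.k j) fun a b => Y ⟨j, a, b⟩) y ↔
      ∃ X : (Σ j, Fin (P.1.k j) × Fin (P.1.k j)) → A.K,
        P.1.Holds A.K (fun j a b => X ⟨j, a, b⟩) y ∧
        ∀ j, (piS A.N (P.1.k j) fun a b => X ⟨j, a, b⟩) = piS A.N (P.1.k j) fun a b => Y ⟨j, a, b⟩ :=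
    MElem.forall fun P => FO.mSent (FO.forall_scalars <| FO.forall_scalars <|
      (FO.pred _ _ _).iff <| FO.exists_scalars <| (FO.holds _ _ _).and <| FO.forall_finite fun j =>
        FO.pi_eq _ _ _) |>.mElem
  have h₅ : MElem fun A : Mdl.{u} n Φ => ∀ i : ℕ+, ∀ v : Fin i → A.M, ∀ X : Fin i × Fin i → A.K,
      (piS A.N i fun a b => X (a, b)) = dS A.N i v →
        rowSpan (fun a b => X (a, b)) = relations A.K v :=
    MElem.forall fun i => FO.mSent (FO.forall_vectors <| FO.forall_scalars <|
      (FO.pi_eq_D _ _ _).imp (FO.rowSpan_eq_relations _ _)) |>.mElem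
  refine (h₁.and (h₂.and (h₃.and (h₄.and h₅)))).congr fun A => ⟨fun h => ?_, fun h => ?_⟩
  · obtain ⟨h₁, h₂, h₃, h₄, h₅⟩ := h
    refine ⟨fun p hp => h₁ ⟨p, hp⟩, h₂, fun i X Y => ?_, fun P p y => ?_, fun i v X => ?_⟩
    · exact h₃ i (fun q => X q.1 q.2) (fun q => Y q.1 q.2)
    · choose Y hY using fun j => h₂ (P.1.k j) (p j)
      obtain rfl : (fun j => piS A.N (P.1.k j) (Y j)) = p := _root_.funext hY
      rw [uncurry_exists]
      exact h₄ P (fun q => Y q.1 q.2.1 q.2.2) y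
    · exact h₅ i v fun q => X q.1 q.2
  · refine ⟨fun p => h.kill _ p.2, h.pi_surjective, fun i X Y => h.pi_eq_iff i _ _,
      fun P Y y => ?_, fun i v X => h.d_eq i v _⟩
    rw [h.pred_iff, uncurry_exists]

/-! ### Algebraically closed fields -/

/-- Only monic polynomials of positive degree d + 1 matter, and these are given by d + 1
coefficients; each d yields one sentence. -/
theorem isAlgClosed_iff_coeffs {K : Type*} [Field K] :
    IsAlgClosed K ↔ ∀ d : ℕ, ∀ c : Fin (d + 1) → K, ∃ x : K,
      x ^ (d + 1) + ∑ i : Fin (d + 1), c i * x ^ (i : ℕ) = 0 := by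
  constructor
  · intro h d c
    have hd : (∑ i : Fin (d + 1), Polynomial.C (c i) * Polynomial.X ^ (i : ℕ)).degree <
        ((d + 1 : ℕ) : WithBot ℕ) := by
      refine lt_of_le_of_lt (Polynomial.degree_sum_le _ _) ?_
      refine (Finset.sup_lt_iff (WithBot.bot_lt_coe _)).2 fun i _ => ?_
      refine lt_of_le_of_lt (Polynomial.degree_C_mul_X_pow_le _ _) ?_
      exact_mod_cast i.2
    obtain ⟨x, hx⟩ := IsAlgClosed.exists_root (Polynomial.X ^ (d + 1) +
        ∑ i : Fin (d + 1), Polynomial.C (c i) * Polynomial.X ^ (i : ℕ)) (by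
      rw [Polynomial.degree_add_eq_left_of_degree_lt (by rwa [Polynomial.degree_X_pow]),
        Polynomial.degree_X_pow]
      exact_mod_cast d.succ_ne_zero)
    refine ⟨x, ?_⟩
    simpa [Polynomial.IsRoot, Polynomial.eval_finsetSum] using hx
  · intro h
    refine IsAlgClosed.of_exists_root _ fun p hp hirr => ?_
    obtain ⟨d, hd⟩ := Nat.exists_eq_succ_of_ne_zero hirr.natDegree_pos.ne'
    obtain ⟨x, hx⟩ := h d fun i => p.coeff i
    refine ⟨x, ?_⟩
    rw [hp.as_sum, hd, Finset.sum_range]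
    simpa [Polynomial.eval_finsetSum] using hx

theorem mElem_isAlgClosed : MElem fun A : Mdl.{u} n Φ => IsAlgClosed A.K := by
  refine MElem.congr ?_ fun A => isAlgClosed_iff_coeffs.symm
  exact MElem.forall fun d => FO.mSent (FO.forall_scalars <| FO.exists_scalar <| FO.kEq
    (((KT.var _).pow _).add <| KT.sum _ fun i _ => (KT.var _).mul ((KT.var _).pow _))
    KT.zero) |>.mElem

end GrassModule

/-! ### Solvability as a first-order scheme, via Gröbner bases. -/

namespace GrassModule

open MSLanguage MvPolynomial

/-! ### Solvability over the polynomial ring -/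

section Solvability

variable {n : ℕ} {K M : Type*} [Field K] [AddCommGroup M] [Module K M]
  [Module (MvPolynomial (Fin n) K) M]

/-- Solvability, for systems given by functional submodules of `K[T] × M`. -/
def FSolvable (I : Ideal (MvPolynomial (Fin n) ℤ)) (K M : Type*) [Field K] [AddCommGroup M]
    [Module K M] [Module (MvPolynomial (Fin n) K) M] : Prop :=
  ∀ F : Submodule (MvPolynomial (Fin n) K) (MvPolynomial (Fin n) K × M),
    (∀ y, (0, y) ∈ F → y = 0) → (∀ p ∈ I, (map (Int.castRingHom K) p, 0) ∈ F) →
    ∀ (k : ℕ) (g : Fin k → MvPolynomial (Fin n) K) (U : Fin k → Submodule K M),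
      (∀ j, FiniteDimensional K (U j)) → (∀ j y, (g j, y) ∉ F) →
      ∃ x : M, (∀ f y, (f, y) ∈ F → f • x = y) ∧ ∀ j, g j • x ∉ U j

theorem prod_sum_mem {R M : Type*} [CommRing R] [AddCommGroup M] [Module R M]
    {F : Submodule R (R × M)} {m : ℕ} {f : Fin m → R} {v : Fin m → M}
    (h : ∀ i, (f i, v i) ∈ F) (t : Fin m → R) : (∑ i, t i * f i, ∑ i, t i • v i) ∈ F := by
  have : (∑ i, t i * f i, ∑ i, t i • v i) = ∑ i, t i • (f i, v i) := by
    simp [Prod.ext_iff, Prod.fst_sum, Prod.snd_sum]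
  rw [this]
  exact Submodule.sum_mem _ fun i _ => F.smul_mem _ (h i)

theorem functional_unique {R M : Type*} [CommRing R] [AddCommGroup M] [Module R M]
    {F : Submodule R (R × M)} (hF : ∀ y, (0, y) ∈ F → y = 0) {f : R} {y z : M}
    (hy : (f, y) ∈ F) (hz : (f, z) ∈ F) : y = z := by
  have := F.sub_mem hy hz
  rw [Prod.mk_sub_mk, sub_self] at this
  exact sub_eq_zero.1 (hF _ this)

theorem map_ideal_mem {I : Ideal (MvPolynomial (Fin n) ℤ)}
    {F : Submodule (MvPolynomial (Fin n) K) (MvPolynomial (Fin n) K × M)}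
    (hI : ∀ p ∈ I, (map (Int.castRingHom K) p, (0 : M)) ∈ F) {q : MvPolynomial (Fin n) K}
    (hq : q ∈ I.map (map (Int.castRingHom K))) : (q, (0 : M)) ∈ F := by
  have : I.map (map (Int.castRingHom K)) ≤ F.comap (LinearMap.inl _ _ _) := by
    rw [Ideal.map_le_iff_le_comap]
    exact fun p hp => hI p hp
  exact this hq

/-- A compatible finite system generates, together with I × 0, a functional submodule. Conversely, a
functional submodule is determined by values on finitely many generators of the ideal of its first
coordinates. -/
theorem solvable_iff_fSolvable {I : Ideal (MvPolynomial (Fin n) ℤ)} [Module (Alg I K) M]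
    (hact : ∀ (p : MvPolynomial (Fin n) K) (x : M),
      (Ideal.Quotient.mk (I.map (map (Int.castRingHom K))) p : Alg I K) • x = p • x) :
    Solvable K (Alg I K) M ↔ FSolvable I K M := by
  set mk := Ideal.Quotient.mk (I.map (map (Int.castRingHom K))) with hmk
  have mk_surj : Function.Surjective mk := Ideal.Quotient.mk_surjective
  constructor
  · intro H F hF hI k g U hU hg
    -- Hilbert's basis theorem is applied to the ideal of first coordinates; functionality
    -- determines the second coordinates, with no finiteness assumption on M.
    obtain ⟨m, f, hf⟩ := Submodule.fg_iff_exists_fin_generating_family.1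
      (IsNoetherian.noetherian (F.map (LinearMap.fst _ _ _)))
    have hfF : ∀ i, ∃ v, (f i, v) ∈ F := by
      intro i
      have : f i ∈ F.map (LinearMap.fst _ _ _) := by
        rw [← hf]
        exact Submodule.subset_span ⟨i, rfl⟩
      obtain ⟨⟨f', v⟩, h, h'⟩ := this
      obtain rfl : f' = f i := h'
      exact ⟨v, h⟩
    choose v hv using hfF
    have hgen : ∀ q y, (q, y) ∈ F → ∃ c : Fin m → MvPolynomial (Fin n) K,
        ∑ i, c i * f i = q ∧ ∑ i, c i • v i = y := by
      intro q y hq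
      have : q ∈ Submodule.span (MvPolynomial (Fin n) K) (Set.range f) := by
        rw [hf]
        exact ⟨_, hq, rfl⟩
      obtain ⟨c, hc⟩ := (Submodule.mem_span_range_iff_exists_fun _).1 this
      refine ⟨c, hc, functional_unique hF ?_ hq⟩
      have := prod_sum_mem hv c
      rwa [show ∑ i, c i * f i = q from hc] at this
    refine Exists.elim (H m k (fun i => mk (f i)) v (fun j => mk (g j)) U hU ?_ ?_) ?_
    rotate_left 2
    · rintro x ⟨hx, hx'⟩
      refine ⟨x, fun q y hq => ?_, fun j => ?_⟩
      · obtain ⟨c, rfl, rfl⟩ := hgen q y hq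
        rw [Finset.sum_smul]
        refine Finset.sum_congr rfl fun i _ => ?_
        rw [mul_smul, ← hact (f i), hx]
      · rw [← hact]
        exact hx' j
    · intro t ht
      choose t' ht' using fun i => mk_surj (t i)
      have h1 : ∑ i, t' i * f i ∈ I.map (map (Int.castRingHom K)) := by
        rw [← Ideal.Quotient.eq_zero_iff_mem, map_sum, ← ht]
        refine Finset.sum_congr rfl fun i _ => ?_
        rw [map_mul, ht']
      have h2 := functional_unique hF (prod_sum_mem hv t') (map_ideal_mem hI h1)
      rw [← h2]
      refine Finset.sum_congr rfl fun i _ => ?_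
      rw [← ht', hact]
    · intro j hj
      obtain ⟨t, ht⟩ := (Submodule.mem_span_range_iff_exists_fun _).1 hj
      choose t' ht' using fun i => mk_surj (t i)
      have h1 : g j - ∑ i, t' i * f i ∈ I.map (map (Int.castRingHom K)) := by
        rw [← Ideal.Quotient.eq_zero_iff_mem, map_sub, map_sum, ← hmk, ← ht, sub_eq_zero]
        exact Finset.sum_congr rfl fun i _ => by rw [map_mul, ht', smul_eq_mul]
      have h2 := F.add_mem (map_ideal_mem hI h1) (prod_sum_mem hv t')
      rw [Prod.mk_add_mk, sub_add_cancel] at h2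
      exact hg j _ h2
  · intro H m k f v g U hU hc hg
    choose f' hf' using fun i => mk_surj (f i)
    choose g' hg' using fun i => mk_surj (g i)
    -- The first coordinate is constrained only modulo I, so F contains I × 0 without further
    -- closure.
    let F : Submodule (MvPolynomial (Fin n) K) (MvPolynomial (Fin n) K × M) :=
      { carrier := {w | ∃ t : Fin m → MvPolynomial (Fin n) K,
          mk w.1 = ∑ i, mk (t i) * f i ∧ w.2 = ∑ i, t i • v i}
        zero_mem' := ⟨0, by simp⟩
        add_mem' := by
          rintro _ _ ⟨t, h1, h2⟩ ⟨t', h1', h2'⟩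
          refine ⟨t + t', ?_, ?_⟩
          · simp [h1, h1', add_mul, Finset.sum_add_distrib]
          · simp [h2, h2', add_smul, Finset.sum_add_distrib]
        smul_mem' := by
          rintro c _ ⟨t, h1, h2⟩
          refine ⟨c • t, ?_, ?_⟩
          · simp [h1, mul_assoc, Finset.mul_sum]
          · simp [h2, mul_smul, Finset.smul_sum] }
    refine Exists.elim (H F ?_ ?_ k g' U hU ?_) ?_
    rotate_left 3
    · rintro x ⟨hx, hx'⟩
      refine ⟨x, fun i => ?_, fun j => ?_⟩
      · rw [← hf', hact]
        refine hx _ _ ⟨Pi.single i 1, ?_, ?_⟩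
        · simp [Pi.single_apply, apply_ite mk, hf', ite_mul]
        · simp [Pi.single_apply, ite_smul]
      · rw [← hg', hact]
        exact hx' j
    · rintro y ⟨t, h1, h2⟩
      have := hc (fun i => mk (t i)) (by rw [← h1]; exact map_zero mk)
      simp only [hact] at this
      rw [← this]
      exact h2
    · intro p hp
      refine ⟨0, ?_, by simp⟩
      simp only [Pi.zero_apply, map_zero, zero_mul, Finset.sum_const_zero]
      exact Ideal.Quotient.eq_zero_iff_mem.2 (Ideal.mem_map_of_mem _ hp)
    · rintro j y ⟨t, h1, -⟩
      refine hg j ?_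
      rw [← hg', show mk (g' j) = _ from h1]
      exact Submodule.sum_mem _ fun i _ => Submodule.smul_mem _ _ (Submodule.subset_span ⟨i, rfl⟩)

end Solvability

/-! ### Gröbner systems -/

section Groebner

variable {n : ℕ} {K M : Type*} [Field K] [AddCommGroup M] [Module K M]
  [Module (MvPolynomial (Fin n) K) M]

/-- The monic polynomial with given leading exponent and lower part. -/
noncomputable def lead {m : ℕ} (a : Fin m → Fin n →₀ ℕ) (f : Fin m → MvPolynomial (Fin n) K)
    (i : Fin m) : MvPolynomial (Fin n) K :=
  monomial (a i) 1 + f i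

/-- A Gröbner basis of an ideal containing all `p l`, given by the leading exponents `a i` and the
lower parts `f i`, with certificates `h`, `q`, and a compatible family of vectors. -/
structure GBSystem (o : MonomialOrder (Fin n)) {s m : ℕ} (p : Fin s → MvPolynomial (Fin n) K)
    (a : Fin m → Fin n →₀ ℕ) (f : Fin m → MvPolynomial (Fin n) K)
    (h : Fin m → Fin m → Fin m → MvPolynomial (Fin n) K)
    (q : Fin s → Fin m → MvPolynomial (Fin n) K) (v : Fin m → M) : Prop where
  lower : ∀ i b, ¬ o.toSyn b < o.toSyn (a i) → coeff b (f i) = 0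
  lower_cert : ∀ i j k b, ¬ o.toSyn (b + a k) < o.toSyn (a i ⊔ a j) → coeff b (h i j k) = 0
  pair : ∀ i j, monomial (a i ⊔ a j - a i) 1 * lead a f i =
    monomial (a i ⊔ a j - a j) 1 * lead a f j + ∑ k, h i j k * lead a f k
  pair_smul : ∀ i j, (monomial (a i ⊔ a j - a i) 1 : MvPolynomial (Fin n) K) • v i =
    (monomial (a i ⊔ a j - a j) 1 : MvPolynomial (Fin n) K) • v j + ∑ k, h i j k • v k
  mem : ∀ l, p l = ∑ k, q l k * lead a f k
  mem_smul : ∀ l, ∑ k, q l k • v k = 0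

variable {o : MonomialOrder (Fin n)} {s m : ℕ} {p : Fin s → MvPolynomial (Fin n) K}
  {a : Fin m → Fin n →₀ ℕ} {f : Fin m → MvPolynomial (Fin n) K}
  {h : Fin m → Fin m → Fin m → MvPolynomial (Fin n) K}
  {q : Fin s → Fin m → MvPolynomial (Fin n) K} {v : Fin m → M}

/-- The multiples by monomials of the generators. -/
noncomputable def gbMul (a : Fin m → Fin n →₀ ℕ) (f : Fin m → MvPolynomial (Fin n) K)
    (v : Fin m → M) (b : Fin n →₀ ℕ) (i : Fin m) : MvPolynomial (Fin n) K × M :=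
  (monomial b 1 : MvPolynomial (Fin n) K) • (lead a f i, v i)

variable [IsScalarTower K (MvPolynomial (Fin n) K) M]

theorem poly_smul_eq_sum {W : Type*} [AddCommGroup W] [Module K W]
    [Module (MvPolynomial (Fin n) K) W] [IsScalarTower K (MvPolynomial (Fin n) K) W]
    (t : MvPolynomial (Fin n) K) (w : W) :
    t • w = ∑ b ∈ t.support, coeff b t • (monomial b 1 : MvPolynomial (Fin n) K) • w :=
  smul_eq_sum subset_rfl w

/-- Two multiples with the same leading exponent differ by a monomial multiple of an S-pair, and the
certificate h rewrites it through multiples with smaller leading exponents. The computation takes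
place in K[T] × M, so the vectors obey the same relation. -/
theorem GBSystem.gbMul_sub_mem (H : GBSystem o p a f h q v) {b b' : Fin n →₀ ℕ} {i j : Fin m}
    (hb : b + a i = b' + a j) : gbMul a f v b i - gbMul a f v b' j ∈
      Submodule.span K {w | ∃ b'' k, o.toSyn (b'' + a k) < o.toSyn (b + a i) ∧
        w = gbMul a f v b'' k} := by
  -- The common leading exponent is divisible by the least common multiple; d is the quotient.
  have hle : a i ⊔ a j ≤ b + a i := sup_le le_add_self (hb ▸ le_add_self)
  obtain ⟨d, hd⟩ := exists_add_of_le hle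
  have h1 : b = d + (a i ⊔ a j - a i) := by
    have : (a i ⊔ a j - a i) + a i = a i ⊔ a j := tsub_add_cancel_of_le le_sup_left
    apply add_right_cancel (b := a i)
    rw [hd, add_assoc, this, add_comm]
  have h2 : b' = d + (a i ⊔ a j - a j) := by
    have : (a i ⊔ a j - a j) + a j = a i ⊔ a j := tsub_add_cancel_of_le le_sup_right
    apply add_right_cancel (b := a j)
    rw [← hb, hd, add_assoc, this, add_comm]
  have h3 : ∀ e k, gbMul a f v (d + e) k =
      (monomial d 1 : MvPolynomial (Fin n) K) • gbMul a f v e k := by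
    intro e k
    rw [gbMul, gbMul, smul_smul, monomial_mul, one_mul]
  have h4 : gbMul a f v (a i ⊔ a j - a i) i - gbMul a f v (a i ⊔ a j - a j) j =
      ∑ k, h i j k • (lead a f k, v k) := by
    rw [sub_eq_iff_eq_add']
    refine Prod.ext ?_ ?_
    · simpa [gbMul, Prod.fst_sum] using H.pair i j
    · simpa [gbMul, Prod.snd_sum] using H.pair_smul i j
  rw [h1, h2, h3, h3, ← smul_sub, h4, Finset.smul_sum]
  refine Submodule.sum_mem _ fun k _ => ?_
  rw [poly_smul_eq_sum (h i j k), Finset.smul_sum]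
  refine Submodule.sum_mem _ fun b'' hb'' => ?_
  rw [smul_comm]
  refine Submodule.smul_mem _ _ (Submodule.subset_span ⟨d + b'', k, ?_, ?_⟩)
  · have h5 : o.toSyn (b'' + a k) < o.toSyn (a i ⊔ a j) := by
      by_contra hc
      exact mem_support_iff.1 hb'' (H.lower_cert i j k b'' hc)
    rw [← h1, hd, add_assoc, map_add, add_comm, map_add o.toSyn (a i ⊔ a j)]
    exact add_lt_add_left h5 _
  · rw [h3, gbMul]

theorem GBSystem.coeff_gbMul (H : GBSystem o p a f h q v) (b : Fin n →₀ ℕ) (i : Fin m)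
    {c : Fin n →₀ ℕ} (hc : ¬ o.toSyn c < o.toSyn (b + a i)) :
    coeff c (gbMul a f v b i).1 = if b + a i = c then 1 else 0 := by
  have : (gbMul a f v b i).1 = monomial (b + a i) 1 + monomial b 1 * f i := by
    simp [gbMul, lead, mul_add, monomial_mul]
  rw [this, coeff_add, coeff_monomial]
  convert add_zero _
  rw [coeff_monomial_mul', one_mul]
  split_ifs with hle
  · refine H.lower i _ fun hlt => hc ?_
    obtain ⟨d, rfl⟩ := exists_add_of_le hle
    rw [add_tsub_cancel_left] at hlt
    rw [map_add, map_add]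
    exact add_lt_add_right hlt _
  · rfl

/-- The submodule generated by the system. -/
noncomputable def gbSpan (a : Fin m → Fin n →₀ ℕ) (f : Fin m → MvPolynomial (Fin n) K) (v : Fin m → M) :
    Submodule (MvPolynomial (Fin n) K) (MvPolynomial (Fin n) K × M) :=
  Submodule.span _ (Set.range fun i => (lead a f i, v i))

/-- Buchberger's criterion. For each exponent above some a_i fix one multiple with that leading
exponent. By well-founded induction along the monomial order these multiples span the submodule over
K. As their leading exponents are distinct, the largest one in a nontrivial combination cannot
cancel. Functionality and the exclusion of nonzero reduced polynomials both follow. -/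
theorem GBSystem.eq_zero_or_exists_coeff (H : GBSystem o p a f h q v)
    {w : MvPolynomial (Fin n) K × M} (hw : w ∈ gbSpan a f v) :
    w = 0 ∨ ∃ i c, a i ≤ c ∧ coeff c w.1 ≠ 0 := by
  classical
  let E := {c : Fin n →₀ ℕ // ∃ i, a i ≤ c}
  choose ix hix using fun c : E => c.2
  let z : E → MvPolynomial (Fin n) K × M := fun c => gbMul a f v (c.1 - a (ix c)) (ix c)
  have hz : ∀ c : E, c.1 - a (ix c) + a (ix c) = c.1 := fun c => tsub_add_cancel_of_le (hix c)
  have key : ∀ (c : o.syn) (b : Fin n →₀ ℕ) (i : Fin m), o.toSyn (b + a i) = c →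
      gbMul a f v b i ∈ Submodule.span K (Set.range z) := by
    intro c
    induction c using WellFoundedLT.induction with
    | ind c ih =>
      intro b i hc
      let c' : E := ⟨b + a i, i, le_add_self⟩
      have h1 := H.gbMul_sub_mem (i := i) (j := ix c') (hz c').symm
      have h2 : Submodule.span K {w | ∃ b'' k, o.toSyn (b'' + a k) < o.toSyn (b + a i) ∧
          w = gbMul a f v b'' k} ≤ Submodule.span K (Set.range z) := by
        rw [Submodule.span_le]
        rintro _ ⟨b'', k, hlt, rfl⟩
        exact ih _ (hc ▸ hlt) b'' k rfl
      have h3 := Submodule.add_mem _ (h2 h1) (Submodule.subset_span ⟨c', rfl⟩)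
      rwa [sub_add_cancel] at h3
  have hw' : w ∈ Submodule.span K (Set.range z) := by
    obtain ⟨t, rfl⟩ := (Submodule.mem_span_range_iff_exists_fun _).1 hw
    refine Submodule.sum_mem _ fun i _ => ?_
    rw [poly_smul_eq_sum]
    exact Submodule.sum_mem _ fun b _ => Submodule.smul_mem _ _ (key _ b i rfl)
  obtain ⟨l, rfl⟩ := (Finsupp.mem_span_range_iff_exists_finsupp).1 hw'
  by_cases hl : l = 0
  · left
    simp [hl]
  right
  -- At the largest exponent that occurs, all other multiples have coefficient zero.
  obtain ⟨c, hc, hmax⟩ := l.support.exists_max_image (fun c => o.toSyn c.1)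
    (Finsupp.support_nonempty_iff.2 hl)
  refine ⟨ix c, c.1, hix c, ?_⟩
  have : coeff c.1 (l.sum fun i r => r • z i).1 = l c := by
    rw [Finsupp.sum, Prod.fst_sum, coeff_sum, Finset.sum_eq_single c]
    · rw [Prod.smul_fst, coeff_smul, H.coeff_gbMul _ _ (by rw [hz]; exact lt_irrefl _),
        if_pos (hz c), smul_eq_mul, mul_one]
    · intro c' hc' hne
      rw [Prod.smul_fst, coeff_smul, H.coeff_gbMul _ _ (by rw [hz]; exact (hmax c' hc').not_gt),
        if_neg, smul_zero]
      rw [hz]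
      exact fun h => hne (Subtype.ext h)
    · exact fun h => (h hc).elim
  rw [this]
  exact Finsupp.mem_support_iff.1 hc

theorem GBSystem.functional (H : GBSystem o p a f h q v) {y : M}
    (hy : (0, y) ∈ gbSpan a f v) : y = 0 := by
  obtain h0 | ⟨i, c, -, hc⟩ := H.eq_zero_or_exists_coeff hy
  · exact congrArg Prod.snd h0
  · simp at hc

theorem GBSystem.mem_gbSpan (H : GBSystem o p a f h q v) (l : Fin s) :
    (p l, (0 : M)) ∈ gbSpan a f v := by
  rw [H.mem l, ← H.mem_smul l]
  exact prod_sum_mem (F := gbSpan a f v) (fun i => Submodule.subset_span (Set.mem_range_self i)) _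

theorem GBSystem.notMem_of_reduced (H : GBSystem o p a f h q v) {g : MvPolynomial (Fin n) K}
    (hg : ∀ i c, a i ≤ c → coeff c g = 0) (hg0 : g ≠ 0) (y : M) : (g, y) ∉ gbSpan a f v := by
  intro hy
  obtain h0 | ⟨i, c, hc, hc'⟩ := H.eq_zero_or_exists_coeff hy
  · exact hg0 (congrArg Prod.fst h0)
  · exact hc' (hg i c hc)

end Groebner

end GrassModule

namespace GrassModule

open MSLanguage MvPolynomial

/-! ### Existence of Gröbner bases -/

section Groebner

variable {n : ℕ} {K : Type*} [Field K]

/-- The minimal exponents among the degrees of nonzero elements of J form an antichain, which is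
finite by Dickson's lemma. Monic elements of J of these degrees serve as the basis, and the division
algorithm provides quotients and remainders. -/
theorem exists_groebner_basis (o : MonomialOrder (Fin n)) (J : Ideal (MvPolynomial (Fin n) K)) :
    ∃ (m : ℕ) (a : Fin m → Fin n →₀ ℕ) (f : Fin m → MvPolynomial (Fin n) K),
      (∀ i b, ¬ o.toSyn b < o.toSyn (a i) → coeff b (f i) = 0) ∧
      (∀ i, lead a f i ∈ J) ∧
      ∀ g : MvPolynomial (Fin n) K, ∃ (c : Fin m → MvPolynomial (Fin n) K)
        (r : MvPolynomial (Fin n) K), g = ∑ i, c i * lead a f i + r ∧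
        (∀ i b, coeff b (c i) ≠ 0 → o.toSyn (b + a i) ≤ o.toSyn (o.degree g)) ∧
        (∀ i b, a i ≤ b → coeff b r = 0) ∧ (g ∈ J → r = 0) := by
  classical
  let E : (Fin n →₀ ℕ) → Prop := fun d => ∃ f ∈ J, f ≠ 0 ∧ o.degree f = d
  have hfin : {d | Minimal E d}.Finite :=
    WellQuasiOrderedLE.finite_of_isAntichain (setOfPred_minimal_antichain E)
  have := hfin.fintype
  obtain ⟨m, ⟨e⟩⟩ : ∃ m, Nonempty (Fin m ≃ {d | Minimal E d}) :=
    ⟨_, ⟨(Fintype.equivFin _).symm⟩⟩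
  have hmon : ∀ i, ∃ f ∈ J, o.degree f = (e i).1 ∧ o.leadingCoeff f = 1 := by
    intro i
    obtain ⟨f, hf, hf0, hd⟩ := (e i).2.prop
    have hl : o.leadingCoeff f ≠ 0 := o.leadingCoeff_ne_zero_iff.2 hf0
    refine ⟨C (o.leadingCoeff f)⁻¹ * f, J.mul_mem_left _ hf, ?_, ?_⟩
    · rw [o.degree_mul (by simpa using hl) hf0, o.degree_C, zero_add, hd]
    · rw [o.leadingCoeff_mul, o.leadingCoeff_C, inv_mul_cancel₀ hl]
  choose f₀ hJ hdeg hlc using hmon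
  refine ⟨m, fun i => (e i).1, fun i => f₀ i - monomial (e i).1 1, ?_, ?_, ?_⟩
  · intro i b hb
    rw [coeff_sub, coeff_monomial, ← hdeg]
    split_ifs with h
    · rw [← h, sub_eq_zero]
      exact hlc i
    · rw [sub_zero]
      refine o.coeff_eq_zero_of_lt (lt_of_le_of_ne ?_ ?_)
      · rw [hdeg]
        exact not_lt.1 hb
      · exact fun h' => h (o.toSyn.injective h')
  · intro i
    rw [lead, add_sub_cancel]
    exact hJ i
  · intro g
    obtain ⟨c, r, hg, hd, hr⟩ := o.div (b := f₀) (fun i => by rw [hlc]; exact isUnit_one) g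
    have hlead : ∀ i, lead (fun i => (e i).1) (fun i => f₀ i - monomial (e i).1 1) i = f₀ i :=
      fun i => by rw [lead, add_sub_cancel]
    simp only [hlead]
    rw [Finsupp.linearCombination_apply, Finsupp.sum_fintype _ _ (by simp)] at hg
    simp only [smul_eq_mul] at hg
    refine ⟨c, r, hg, fun i b hb => ?_, fun i b hb => ?_, fun hgJ => ?_⟩
    · have hc : c i ≠ 0 := by
        rintro h
        simp [h] at hb
      have hf : f₀ i ≠ 0 := o.leadingCoeff_ne_zero_iff.1 (by rw [hlc]; exact one_ne_zero)
      refine le_trans ?_ (hd i)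
      rw [o.degree_mul hf hc, hdeg, add_comm, map_add, map_add]
      exact add_le_add_right (o.le_degree (mem_support_iff.2 hb)) _
    · by_contra h
      exact hr b (mem_support_iff.2 h) i ((hdeg i).symm ▸ hb)
    · by_contra h
      have hrJ : r ∈ J := by
        have : r = g - ∑ i, c i * f₀ i := by rw [hg, add_sub_cancel_left]
        rw [this]
        exact J.sub_mem hgJ (J.sum_mem fun i _ => J.mul_mem_left _ (hJ i))
      -- A nonzero remainder in J would have its degree above a minimal one, against its being
      -- reduced.
      obtain ⟨d, hdle, hdmin⟩ := exists_minimal_le_of_wellFoundedLT E _ ⟨r, hrJ, h, rfl⟩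
      refine hr _ (o.degree_mem_support h) (e.symm ⟨d, hdmin⟩) ?_
      rw [hdeg, e.apply_symm_apply]
      exact hdle

theorem coeff_monomial_mul_eq_zero {o : MonomialOrder (Fin n)} {a : Fin n →₀ ℕ}
    {f : MvPolynomial (Fin n) K} (hf : ∀ b, ¬ o.toSyn b < o.toSyn a → coeff b f = 0)
    {d c : Fin n →₀ ℕ} (hc : ¬ o.toSyn c < o.toSyn (d + a)) : coeff c (monomial d 1 * f) = 0 := by
  rw [coeff_monomial_mul', one_mul]
  split_ifs with hle
  · refine hf _ fun hlt => hc ?_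
    obtain ⟨d, rfl⟩ := exists_add_of_le hle
    rw [add_tsub_cancel_left] at hlt
    rw [map_add, map_add]
    exact add_lt_add_right hlt _
  · rfl

/-- The two leading monomials coincide at the least common multiple and cancel. -/
theorem coeff_spair_eq_zero {o : MonomialOrder (Fin n)} {m : ℕ} {a : Fin m → Fin n →₀ ℕ}
    {f : Fin m → MvPolynomial (Fin n) K}
    (hf : ∀ i b, ¬ o.toSyn b < o.toSyn (a i) → coeff b (f i) = 0) (i j : Fin m)
    {c : Fin n →₀ ℕ} (hc : ¬ o.toSyn c < o.toSyn (a i ⊔ a j)) :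
    coeff c (monomial (a i ⊔ a j - a i) 1 * lead a f i -
      monomial (a i ⊔ a j - a j) 1 * lead a f j) = 0 := by
  have h1 : (a i ⊔ a j - a i) + a i = a i ⊔ a j := tsub_add_cancel_of_le le_sup_left
  have h2 : (a i ⊔ a j - a j) + a j = a i ⊔ a j := tsub_add_cancel_of_le le_sup_right
  rw [lead, lead, mul_add, mul_add, monomial_mul, monomial_mul, h1, h2, add_sub_add_left_eq_sub,
    coeff_sub, coeff_monomial_mul_eq_zero (hf i) (by rwa [h1]),
    coeff_monomial_mul_eq_zero (hf j) (by rwa [h2]), sub_zero]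

end Groebner

section Solvable

theorem prod_smul_mem {R M : Type*} [CommRing R] [AddCommGroup M] [Module R M]
    {F : Submodule R (R × M)} {f : R} {y : M} (h : (f, y) ∈ F) (c : R) : (c * f, c • y) ∈ F :=
  F.smul_mem c h

variable {n : ℕ} {K M : Type*} [Field K] [AddCommGroup M] [Module K M]
  [Module (MvPolynomial (Fin n) K) M]

/-- Solvability of the systems given by Gröbner bases of given shape. -/
def GBSolvable (o : MonomialOrder (Fin n)) {s : ℕ} (p : Fin s → MvPolynomial (Fin n) ℤ)
    (K M : Type*) [Field K] [AddCommGroup M] [Module K M] [Module (MvPolynomial (Fin n) K) M]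
    (m k : ℕ) (r : Fin k → ℕ) (a : Fin m → Fin n →₀ ℕ) : Prop :=
  ∀ (f : Fin m → MvPolynomial (Fin n) K) (h : Fin m → Fin m → Fin m → MvPolynomial (Fin n) K)
    (q : Fin s → Fin m → MvPolynomial (Fin n) K) (g : Fin k → MvPolynomial (Fin n) K)
    (v : Fin m → M) (w : (Σ j, Fin (r j)) → M),
    GBSystem o (fun l => map (Int.castRingHom K) (p l)) a f h q v →
    (∀ j i c, a i ≤ c → coeff c (g j) = 0) → (∀ j, g j ≠ 0) →
    ∃ x : M, (∀ i, lead a f i • x = v i) ∧ ∀ j (c : Fin (r j) → K), g j • x ≠ ∑ t, c t • w ⟨j, t⟩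

variable [IsScalarTower K (MvPolynomial (Fin n) K) M]

/-- The certificates make `gbSpan` functional, and a nonzero reduced polynomial lies outside its
ideal of first coordinates; so `FSolvable` applies to it. -/
theorem FSolvable.gbSolvable {o : MonomialOrder (Fin n)} {s : ℕ}
    {p : Fin s → MvPolynomial (Fin n) ℤ} (H : FSolvable (Ideal.span (Set.range p)) K M)
    (m k : ℕ) (r : Fin k → ℕ) (a : Fin m → Fin n →₀ ℕ) : GBSolvable o p K M m k r a := by
  intro f h q g v w hS hg hg0
  obtain ⟨x, hx, hx'⟩ := H (gbSpan a f v) (fun y hy => hS.functional hy) (fun p' hp' => by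
    have : Ideal.span (Set.range p) ≤ Ideal.comap (map (Int.castRingHom K))
        ((gbSpan a f v).comap (LinearMap.inl _ _ _)) := by
      rw [Ideal.span_le]
      rintro _ ⟨l, rfl⟩
      exact hS.mem_gbSpan l
    exact this hp') k g (fun j => Submodule.span K (Set.range fun t => w ⟨j, t⟩))
    (fun j => FiniteDimensional.span_of_finite _ (Set.finite_range _))
    (fun j y => hS.notMem_of_reduced (hg j) (hg0 j) y)
  refine ⟨x, fun i => hx _ _ (Submodule.subset_span ⟨i, rfl⟩), fun j c hc => hx' j ?_⟩
  exact (Submodule.mem_span_range_iff_exists_fun K).2 ⟨c, hc.symm⟩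

-- A Gröbner basis of the ideal of first coordinates comes with certificates obtained by division,
-- and functionality transfers the polynomial identities to the vectors. Each g_j is traded for its
-- remainder r_j, at the cost of enlarging U_j by one vector.
set_option maxHeartbeats 1000000 in
theorem fSolvable_of_gbSolvable {o : MonomialOrder (Fin n)} {s : ℕ}
    {p : Fin s → MvPolynomial (Fin n) ℤ} (H : ∀ m k r a, GBSolvable o p K M m k r a) :
    FSolvable (Ideal.span (Set.range p)) K M := by
  classical
  intro F hF hI k g U hU hg
  obtain ⟨m, a, f, hlow, hJ, hdiv⟩ := exists_groebner_basis o (F.map (LinearMap.fst _ _ _))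
  have hv : ∀ i, ∃ v, (lead a f i, v) ∈ F := by
    intro i
    obtain ⟨⟨f', v⟩, h, h'⟩ := hJ i
    exact ⟨v, h' ▸ h⟩
  choose v hv using hv
  have hpair : ∀ i j, ∃ h : Fin m → MvPolynomial (Fin n) K,
      (∀ k b, ¬ o.toSyn (b + a k) < o.toSyn (a i ⊔ a j) → coeff b (h k) = 0) ∧
      monomial (a i ⊔ a j - a i) 1 * lead a f i =
        monomial (a i ⊔ a j - a j) 1 * lead a f j + ∑ k, h k * lead a f k := by
    intro i j
    -- The zero polynomial has a nonzero coefficient nowhere, so its degree gives no strict bound;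
    -- it receives the zero certificate.
    by_cases h0 : monomial (a i ⊔ a j - a i) 1 * lead a f i -
      monomial (a i ⊔ a j - a j) 1 * lead a f j = 0
    · exact ⟨0, by simp, by simpa using sub_eq_zero.1 h0⟩
    · obtain ⟨c, r, h1, h2, -, h4⟩ := hdiv (monomial (a i ⊔ a j - a i) 1 * lead a f i -
        monomial (a i ⊔ a j - a j) 1 * lead a f j)
      rw [h4 (Submodule.sub_mem _ (Submodule.smul_mem _ _ (hJ i))
        (Submodule.smul_mem _ _ (hJ j))), add_zero] at h1
      refine ⟨c, fun k b hb => ?_, by rw [← h1]; ring⟩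
      by_contra hne
      refine hb (lt_of_le_of_lt (h2 k b hne) ?_)
      by_contra hlt
      exact o.coeff_degree_ne_zero_iff.2 h0 (coeff_spair_eq_zero hlow i j hlt)
  choose h hh1 hh2 using hpair
  have hq : ∀ l, ∃ q : Fin m → MvPolynomial (Fin n) K,
      map (Int.castRingHom K) (p l) = ∑ k, q k * lead a f k := by
    intro l
    obtain ⟨c, r, h1, -, -, h4⟩ := hdiv (map (Int.castRingHom K) (p l))
    refine ⟨c, ?_⟩
    rwa [h4 ⟨_, hI _ (Ideal.subset_span ⟨l, rfl⟩), rfl⟩, add_zero] at h1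
  choose q hq using hq
  choose c r hc _ hr _ using fun j => hdiv (g j)
  -- On solutions, g_j x and r_j x differ by the fixed vector ∑ c_i v_i, so adding it to U_j is
  -- enough.
  have hbas : ∀ j, ∃ (d : ℕ) (w : Fin d → M), Submodule.span K (Set.range w) =
      U j ⊔ Submodule.span K {∑ i, c j i • v i} := by
    intro j
    have := hU j
    exact Submodule.fg_iff_exists_fin_generating_family.1
      ((Module.Finite.iff_fg.1 this).sup (Submodule.fg_span_singleton _))
  choose d w hw using hbas
  have hS : GBSystem o (fun l => map (Int.castRingHom K) (p l)) a f h q v :=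
    { lower := hlow
      lower_cert := hh1
      pair := hh2
      pair_smul := fun i j => functional_unique hF (f := monomial (a i ⊔ a j - a i) 1 * lead a f i)
        (prod_smul_mem (hv i) _) (by
          rw [hh2]
          exact F.add_mem (prod_smul_mem (hv j) _) (prod_sum_mem hv _))
      mem := hq
      mem_smul := fun l => functional_unique hF (prod_sum_mem hv (q l)) (by
        rw [← hq]
        exact hI _ (Ideal.subset_span ⟨l, rfl⟩)) }
  obtain ⟨x, hx, hx'⟩ := H m k d a f h q r v (fun z => w z.1 z.2) hS hr (fun j h0 => by
    refine hg j (∑ i, c j i • v i) ?_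
    rw [hc j, h0, add_zero]
    exact prod_sum_mem hv _)
  have hsum : ∀ e : Fin m → MvPolynomial (Fin n) K,
      (∑ i, e i * lead a f i) • x = ∑ i, e i • v i := by
    intro e
    rw [Finset.sum_smul]
    exact Finset.sum_congr rfl fun i _ => by rw [mul_smul, hx]
  refine ⟨x, fun f' y hy => ?_, fun j hj => ?_⟩
  · obtain ⟨e, r', h1, -, -, h4⟩ := hdiv f'
    rw [h4 ⟨_, hy, rfl⟩, add_zero] at h1
    rw [h1, hsum]
    exact functional_unique hF (prod_sum_mem hv e) (h1 ▸ hy)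
  · have h1 : r j • x ∈ Submodule.span K (Set.range (w j)) := by
      have : r j • x = g j • x - ∑ i, c j i • v i := by
        conv_rhs => rw [hc j, add_smul, hsum]
        abel
      rw [this, hw]
      exact Submodule.sub_mem _ (Submodule.mem_sup_left hj)
        (Submodule.mem_sup_right (Submodule.mem_span_singleton_self _))
    obtain ⟨e, he⟩ := (Submodule.mem_span_range_iff_exists_fun K).1 h1
    exact hx' j e he.symm

end Solvable

end GrassModule

namespace GrassModule

open MSLanguage MvPolynomial

variable {n : ℕ} {Φ : Set PartFormula} {ι κ : Type}

/-! ### The solvability conditions are first-order -/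

/-- The polynomial with given coefficients at the exponents in `D`. -/
noncomputable def polyOf {K : Type*} [CommSemiring K] {D : Finset (Fin n →₀ ℕ)} (x : D → K) :
    MvPolynomial (Fin n) K :=
  ∑ b, monomial b.1 (x b)

theorem polyOf_coeff {K : Type*} [CommSemiring K] {D : Finset (Fin n →₀ ℕ)}
    {p : MvPolynomial (Fin n) K} (h : p.support ⊆ D) : polyOf (D := D) (fun b => coeff b.1 p) = p := by
  rw [polyOf, Finset.sum_coe_sort D fun b => monomial b (coeff b p)]
  conv_rhs => rw [p.as_sum]
  exact (Finset.sum_subset h fun b _ hb => by rw [notMem_support_iff.1 hb, map_zero]).symm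

theorem PT.polyOf {D : Finset (Fin n →₀ ℕ)} (e : D → ι) :
    PT ι κ fun (A : Mdl.{u} n Φ) x _ => GrassModule.polyOf (fun b : D => x (e b)) :=
  PT.sum _ fun b _ => PT.monomial _ (KT.var _)

variable {p q : ∀ A : Mdl.{u} n Φ, (ι → A.K) → (κ → A.M) → MvPolynomial (Fin n) A.K}

theorem FO.forall_coeff_eq_zero (hp : PT ι κ p) (C : (Fin n →₀ ℕ) → Prop) :
    FO ι κ fun A x y => ∀ b, C b → coeff b (p A x y) = 0 := by
  classical
  obtain ⟨⟨D, hD⟩, hc⟩ := hp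
  refine (FO.forall_finset (D.filter C) fun b _ => FO.kEq (hc b) KT.zero).congr fun A x y => ?_
  refine ⟨fun h b hb => ?_, fun h b hb => h b (Finset.mem_filter.1 hb).2⟩
  by_cases hbD : b ∈ D
  · exact h b (Finset.mem_filter.2 ⟨hbD, hb⟩)
  · exact notMem_support_iff.1 fun h => hbD (hD A x y h)

theorem gbSystem_iff {K M : Type*} [Field K] [AddCommGroup M]
    [Module (MvPolynomial (Fin n) K) M] {o : MonomialOrder (Fin n)} {s m : ℕ}
    {p : Fin s → MvPolynomial (Fin n) K} {a : Fin m → Fin n →₀ ℕ}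
    {f : Fin m → MvPolynomial (Fin n) K} {h : Fin m → Fin m → Fin m → MvPolynomial (Fin n) K}
    {q : Fin s → Fin m → MvPolynomial (Fin n) K} {v : Fin m → M} :
    GBSystem o p a f h q v ↔
      (∀ i b, ¬ o.toSyn b < o.toSyn (a i) → coeff b (f i) = 0) ∧
      (∀ i j k b, ¬ o.toSyn (b + a k) < o.toSyn (a i ⊔ a j) → coeff b (h i j k) = 0) ∧
      (∀ i j, monomial (a i ⊔ a j - a i) 1 * lead a f i =
        monomial (a i ⊔ a j - a j) 1 * lead a f j + ∑ k, h i j k * lead a f k) ∧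
      (∀ i j, (monomial (a i ⊔ a j - a i) 1 : MvPolynomial (Fin n) K) • v i - ∑ k, h i j k • v k =
        (monomial (a i ⊔ a j - a j) 1 : MvPolynomial (Fin n) K) • v j) ∧
      (∀ l, p l = ∑ k, q l k * lead a f k) ∧ (∀ l, ∑ k, q l k • v k = 0) := by
  simp only [sub_eq_iff_eq_add]
  exact ⟨fun h => ⟨h.1, h.2, h.3, h.4, h.5, h.6⟩, fun h => ⟨h.1, h.2.1, h.2.2.1, h.2.2.2.1,
    h.2.2.2.2.1, h.2.2.2.2.2⟩⟩

theorem PT.lead {m : ℕ} (a : Fin m → Fin n →₀ ℕ)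
    {f : Fin m → ∀ A : Mdl.{u} n Φ, (ι → A.K) → (κ → A.M) → MvPolynomial (Fin n) A.K}
    (hf : ∀ i, PT ι κ (f i)) (i : Fin m) :
    PT ι κ fun A x y => GrassModule.lead a (fun i => f i A x y) i :=
  (PT.monomial _ KT.one).add (hf i)

theorem FO.gbSystem (o : MonomialOrder (Fin n)) {s m : ℕ} (p : Fin s → MvPolynomial (Fin n) ℤ)
    (a : Fin m → Fin n →₀ ℕ)
    {f : Fin m → ∀ A : Mdl.{u} n Φ, (ι → A.K) → (κ → A.M) → MvPolynomial (Fin n) A.K}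
    {h : Fin m → Fin m → Fin m → ∀ A : Mdl.{u} n Φ, (ι → A.K) → (κ → A.M) →
      MvPolynomial (Fin n) A.K}
    {q : Fin s → Fin m → ∀ A : Mdl.{u} n Φ, (ι → A.K) → (κ → A.M) → MvPolynomial (Fin n) A.K}
    {v : Fin m → ∀ A : Mdl.{u} n Φ, (ι → A.K) → (κ → A.M) → A.M}
    (hf : ∀ i, PT ι κ (f i)) (hh : ∀ i j k, PT ι κ (h i j k)) (hq : ∀ i j, PT ι κ (q i j))
    (hv : ∀ i, MT ι κ (v i)) :
    FO ι κ fun A x y => GBSystem o (fun l => map (Int.castRingHom A.K) (p l)) a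
      (fun i => f i A x y) (fun i j k => h i j k A x y) (fun i j => q i j A x y)
      (fun i => v i A x y) := by
  refine FO.congr ?_ fun A x y => gbSystem_iff.symm
  refine FO.and (FO.forall_finite fun i => FO.forall_coeff_eq_zero (hf i) _) <|
    FO.and (FO.forall_finite fun i => FO.forall_finite fun j => FO.forall_finite fun k =>
      FO.forall_coeff_eq_zero (hh i j k) _) <|
    FO.and (FO.forall_finite fun i => FO.forall_finite fun j => FO.pEq ?_ ?_) <|
    FO.and (FO.forall_finite fun i => FO.forall_finite fun j => FO.mEq ?_ ?_) <|
    FO.and (FO.forall_finite fun l => FO.pEq ?_ ?_) (FO.forall_finite fun l => FO.mEq ?_ MT.zero)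
  · exact (PT.monomial _ KT.one).mul (PT.lead a hf i)
  · exact ((PT.monomial _ KT.one).mul (PT.lead a hf j)).add
      (PT.sum _ fun k _ => (hh i j k).mul (PT.lead a hf k))
  · exact (MT.monomial_smul _ (hv i)).sub (MT.sum _ fun k _ => (hh i j k).smul (hv k))
  · exact MT.monomial_smul _ (hv j)
  · exact PT.map_int _
  · exact PT.sum _ fun k _ => (hq l k).mul (PT.lead a hf k)
  · exact MT.sum _ fun k _ => (hq l k).smul (hv k)

/-- Solvability of Gröbner systems in which all polynomials have exponents in `D`. -/
def GBSolvableOn (o : MonomialOrder (Fin n)) {s : ℕ} (p : Fin s → MvPolynomial (Fin n) ℤ)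
    (K M : Type*) [Field K] [AddCommGroup M] [Module K M] [Module (MvPolynomial (Fin n) K) M]
    (m k : ℕ) (r : Fin k → ℕ) (a : Fin m → Fin n →₀ ℕ) (D : Finset (Fin n →₀ ℕ)) : Prop :=
  ∀ (f : Fin m × D → K) (h : Fin m × Fin m × Fin m × D → K)
    (q : Fin s × Fin m × D → K) (g : Fin k × D → K) (v : Fin m → M)
    (w : (Σ j, Fin (r j)) → M),
    (GBSystem o (fun l => map (Int.castRingHom K) (p l)) a (fun i => polyOf fun b => f (i, b))
      (fun i j k => polyOf fun b => h (i, j, k, b)) (fun i j => polyOf fun b => q (i, j, b)) v ∧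
      (∀ j i c, a i ≤ c → coeff c (polyOf fun b => g (j, b)) = 0) ∧
      (∀ j, ¬ (polyOf fun b => g (j, b)) = 0)) →
    ∃ x : M, (∀ i, lead a (fun i => polyOf fun b => f (i, b)) i • x = v i) ∧
      ∀ j, ∀ c : Fin (r j) → K, ¬ (polyOf fun b => g (j, b)) • x = ∑ t, c t • w ⟨j, t⟩

/-- A system involves finitely many polynomials, so one finite D holds all exponents. D then indexes
sentences instead of being quantified inside one. -/
theorem gbSolvable_iff {o : MonomialOrder (Fin n)} {s : ℕ} {p : Fin s → MvPolynomial (Fin n) ℤ}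
    {K M : Type*} [Field K] [AddCommGroup M] [Module K M] [Module (MvPolynomial (Fin n) K) M]
    {m k : ℕ} {r : Fin k → ℕ} {a : Fin m → Fin n →₀ ℕ} :
    (∀ D, GBSolvableOn o p K M m k r a D) ↔ GBSolvable o p K M m k r a := by
  classical
  refine ⟨fun H f h q g v w hS hg hg0 => ?_, fun H D f h q g v w hS =>
    H _ _ _ _ v w hS.1 hS.2.1 hS.2.2⟩
  obtain ⟨D, hf, hh, hq, hg'⟩ : ∃ D : Finset (Fin n →₀ ℕ), (∀ i, (f i).support ⊆ D) ∧
      (∀ i j k, (h i j k).support ⊆ D) ∧ (∀ i j, (q i j).support ⊆ D) ∧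
      ∀ i, (g i).support ⊆ D := by
    refine ⟨(Finset.univ.biUnion fun i => (f i).support) ∪
      (Finset.univ.biUnion fun t : Fin m × Fin m × Fin m => (h t.1 t.2.1 t.2.2).support) ∪
      (Finset.univ.biUnion fun t : Fin s × Fin m => (q t.1 t.2).support) ∪
      (Finset.univ.biUnion fun i => (g i).support), fun i b hb => ?_, fun i j k b hb => ?_,
      fun i j b hb => ?_, fun i b hb => ?_⟩
    · simp only [Finset.mem_union, Finset.mem_biUnion, Finset.mem_univ, true_and]
      exact .inl (.inl (.inl ⟨i, hb⟩))
    · simp only [Finset.mem_union, Finset.mem_biUnion, Finset.mem_univ, true_and]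
      exact .inl (.inl (.inr ⟨(i, j, k), hb⟩))
    · simp only [Finset.mem_union, Finset.mem_biUnion, Finset.mem_univ, true_and]
      exact .inl (.inr ⟨(i, j), hb⟩)
    · simp only [Finset.mem_union, Finset.mem_biUnion, Finset.mem_univ, true_and]
      exact .inr ⟨i, hb⟩
  have := H D (fun t => coeff t.2.1 (f t.1)) (fun t => coeff t.2.2.2.1 (h t.1 t.2.1 t.2.2.1))
    (fun t => coeff t.2.2.1 (q t.1 t.2.1)) (fun t => coeff t.2.1 (g t.1)) v w
  simp only [polyOf_coeff (hf _), polyOf_coeff (hh _ _ _), polyOf_coeff (hq _ _),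
    polyOf_coeff (hg' _)] at this
  exact this ⟨hS, hg, hg0⟩

theorem mElem_gbSolvableOn (o : MonomialOrder (Fin n)) {s : ℕ} (p : Fin s → MvPolynomial (Fin n) ℤ)
    (m k : ℕ) (r : Fin k → ℕ) (a : Fin m → Fin n →₀ ℕ) (D : Finset (Fin n →₀ ℕ)) :
    MElem fun A : Mdl.{u} n Φ => GBSolvableOn o p A.K A.M m k r a D := by
  refine (FO.mSent ?_).mElem
  refine FO.forall_scalars <| FO.forall_scalars <| FO.forall_scalars <| FO.forall_scalars <|
    FO.forall_vectors <| FO.forall_vectors <| FO.imp (FO.and ?_ <| FO.and ?_ ?_) <|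
    FO.exists_vector <| FO.and ?_ ?_
  · exact FO.gbSystem o p a (fun i => PT.polyOf _) (fun i j k => PT.polyOf _)
      (fun i j => PT.polyOf _) (fun i => MT.var _)
  · exact FO.forall_finite fun j => FO.forall_finite fun i =>
      FO.forall_coeff_eq_zero (PT.polyOf _) _
  · exact FO.forall_finite fun j => FO.not (FO.pEq (PT.polyOf _)
      ⟨⟨∅, by simp⟩, fun b => by simpa using KT.zero⟩)
  · exact FO.forall_finite fun i => FO.mEq ((PT.lead a (fun i => PT.polyOf _) i).smul (MT.var _))
      (MT.var _)
  · exact FO.forall_finite fun j => FO.forall_scalars <| FO.not <| FO.mEq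
      ((PT.polyOf _).smul (MT.var _)) (MT.sum _ fun t _ => MT.smul (KT.var _) (MT.var _))

theorem mElem_fSolvable (I : Ideal (MvPolynomial (Fin n) ℤ)) :
    MElem fun A : Mdl.{u} n Φ => FSolvable I A.K A.M := by
  obtain ⟨s, p, rfl⟩ := Submodule.fg_iff_exists_fin_generating_family.1
    (IsNoetherian.noetherian I)
  -- The choice of monomial order is immaterial; the lexicographic one is used.
  refine (MElem.forall fun m => MElem.forall fun k => MElem.forall fun r => MElem.forall fun a =>
    MElem.forall fun D => mElem_gbSolvableOn .lex p m k r a D).congr fun A => ?_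
  simp only [gbSolvable_iff]
  exact ⟨fun H => fSolvable_of_gbSolvable H, fun H m k r a => H.gbSolvable m k r a⟩

/-! ### The three classes of models -/

/-- The structure with its module over the quotient algebra regarded as a module over the
polynomial ring. -/
noncomputable def mdlOfAxioms {I : Ideal (MvPolynomial (Fin n) ℤ)} (N : Struc.{u} (lang n Φ))
    [Field (KS N)] [AddCommGroup (MS N)] [Module (KS N) (MS N)] [Module (Alg I (KS N)) (MS N)]
    (h : Axioms I N) : Mdl.{u} n Φ :=
  letI : Module (MvPolynomial (Fin n) (KS N)) (MS N) := Module.compHom (MS N)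
    (Ideal.Quotient.mk (I.map (map (Int.castRingHom (KS N)))))
  { N := N
    core :=
      { tower := ⟨fun c p v => by
          have := h.tower
          change Ideal.Quotient.mk (I.map (map (Int.castRingHom (KS N)))) (c • p) • v =
            c • Ideal.Quotient.mk (I.map (map (Int.castRingHom (KS N)))) p • v
          rw [← smul_assoc]
          rfl⟩
        kZero_eq := h.kZero_eq
        kOne_eq := h.kOne_eq
        kAdd_eq := h.kAdd_eq
        kMul_eq := h.kMul_eq
        mZero_eq := h.mZero_eq
        mAdd_eq := h.mAdd_eq
        smul_eq := h.smul_eq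
        t_eq := h.t_eq } }

theorem mdlOfAxioms_isGrass {I : Ideal (MvPolynomial (Fin n) ℤ)} (N : Struc.{u} (lang n Φ))
    [Field (KS N)] [AddCommGroup (MS N)] [Module (KS N) (MS N)] [Module (Alg I (KS N)) (MS N)]
    (h : Axioms I N) : (mdlOfAxioms N h).IsGrass I where
  kill p hp v := by
    have key : ∀ v : MS N, (Ideal.Quotient.mk (I.map (map (Int.castRingHom (KS N))))
        (map (Int.castRingHom (KS N)) p) : Alg I (KS N)) • v = 0 := fun v =>
      (congrArg (fun a : Alg I (KS N) => a • v) (Ideal.Quotient.eq_zero_iff_mem.2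
        (Ideal.mem_map_of_mem _ hp))).trans (zero_smul (Alg I (KS N)) v)
    exact key v
  pi_surjective := h.pi_surjective
  pi_eq_iff := h.pi_eq_iff
  pred_iff := h.pred_iff
  d_eq := h.d_eq

/-- The module over the quotient algebra. -/
noncomputable abbrev algModule {I : Ideal (MvPolynomial (Fin n) ℤ)} {K M : Type u} [Field K]
    [AddCommGroup M] [Module (MvPolynomial (Fin n) K) M]
    (h : ∀ p ∈ I, ∀ v : M, map (Int.castRingHom K) p • v = 0) : Module (Alg I K) M :=
  Module.IsTorsionBySet.module (I := I.map (map (Int.castRingHom K))) (by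
    have : I.map (map (Int.castRingHom K)) ≤ Module.annihilator (MvPolynomial (Fin n) K) M := by
      rw [Ideal.map_le_iff_le_comap]
      exact fun p hp => Module.mem_annihilator.2 (h p hp)
    exact fun v p => Module.mem_annihilator.1 (this p.2) v)

theorem algModule_mk_smul {I : Ideal (MvPolynomial (Fin n) ℤ)} {K M : Type u} [Field K]
    [AddCommGroup M] [Module (MvPolynomial (Fin n) K) M]
    (h : ∀ p ∈ I, ∀ v : M, map (Int.castRingHom K) p • v = 0) (p : MvPolynomial (Fin n) K) (v : M) :
    letI := algModule h
    (Ideal.Quotient.mk (I.map (map (Int.castRingHom K))) p : Alg I K) • v = p • v := rfl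

theorem Mdl.IsGrass.axioms {I : Ideal (MvPolynomial (Fin n) ℤ)} {A : Mdl.{u} n Φ}
    (h : A.IsGrass I) : letI := algModule h.kill; Axioms I A.N := by
  let := algModule h.kill
  exact
    { tower := ⟨fun c p v => by
        obtain ⟨p, rfl⟩ := Ideal.Quotient.mk_surjective p
        exact smul_assoc c p v⟩
      kZero_eq := A.core.kZero_eq
      kOne_eq := A.core.kOne_eq
      kAdd_eq := A.core.kAdd_eq
      kMul_eq := A.core.kMul_eq
      mZero_eq := A.core.mZero_eq
      mAdd_eq := A.core.mAdd_eq
      smul_eq := A.core.smul_eq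
      pi_surjective := h.pi_surjective
      pi_eq_iff := h.pi_eq_iff
      pred_iff := h.pred_iff
      d_eq := h.d_eq
      t_eq := A.core.t_eq }

theorem isBase_iff {I : Ideal (MvPolynomial (Fin n) ℤ)} {N : Struc.{u} (lang n Φ)} :
    IsBase I N ↔ ∃ A : Mdl.{u} n Φ, A.N = N ∧ A.IsGrass I := by
  constructor
  · rintro ⟨_, _, _, _, h⟩
    exact ⟨_, rfl, mdlOfAxioms_isGrass N h⟩
  · rintro ⟨A, rfl, h⟩
    exact ⟨A.fld, A.acg, A.mod, algModule h.kill, h.axioms⟩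

theorem isBaseACF_iff {I : Ideal (MvPolynomial (Fin n) ℤ)} {N : Struc.{u} (lang n Φ)} :
    IsBaseACF I N ↔ ∃ A : Mdl.{u} n Φ, A.N = N ∧ A.IsGrass I ∧ IsAlgClosed A.K := by
  constructor
  · rintro ⟨_, _, _, _, h, h'⟩
    exact ⟨_, rfl, mdlOfAxioms_isGrass N h, h'⟩
  · rintro ⟨A, rfl, h, h'⟩
    exact ⟨A.fld, A.acg, A.mod, algModule h.kill, h.axioms, h'⟩

/-- The model satisfies all the conditions of the model companion. -/
structure Mdl.IsBig (I : Ideal (MvPolynomial (Fin n) ℤ)) (A : Mdl.{u} n Φ) : Prop where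
  grass : A.IsGrass I
  closed : IsAlgClosed A.K
  solvable : FSolvable I A.K A.M

theorem isBig_iff {I : Ideal (MvPolynomial (Fin n) ℤ)} {N : Struc.{u} (lang n Φ)} :
    IsBig I N ↔ ∃ A : Mdl.{u} n Φ, A.N = N ∧ A.IsBig I := by
  constructor
  · rintro ⟨_, _, _, _, h, h', hs⟩
    refine ⟨mdlOfAxioms N h, rfl, mdlOfAxioms_isGrass N h, h', ?_⟩
    let : Module (MvPolynomial (Fin n) (KS N)) (MS N) := Module.compHom (MS N)
      (Ideal.Quotient.mk (I.map (map (Int.castRingHom (KS N)))))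
    exact (solvable_iff_fSolvable (K := KS N) (M := MS N) fun _ _ => rfl).1 hs
  · rintro ⟨A, rfl, h⟩
    let := algModule h.grass.kill
    exact ⟨A.fld, A.acg, A.mod, algModule h.grass.kill, h.grass.axioms, h.closed,
      (solvable_iff_fSolvable (algModule_mk_smul h.grass.kill)).2 h.solvable⟩

theorem elem_isBase (I : Ideal (MvPolynomial (Fin n) ℤ)) :
    Elem (IsBase.{u} (n := n) (Φ := Φ) I) :=
  (mElem_isGrass I).elem.congr fun _ => isBase_iff.symm

theorem elem_isBaseACF (I : Ideal (MvPolynomial (Fin n) ℤ)) :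
    Elem (IsBaseACF.{u} (n := n) (Φ := Φ) I) :=
  ((mElem_isGrass I).and mElem_isAlgClosed).elem.congr fun _ => isBaseACF_iff.symm

theorem elem_isBig (I : Ideal (MvPolynomial (Fin n) ℤ)) :
    Elem (IsBig.{u} (n := n) (Φ := Φ) I) := by
  refine ((mElem_isGrass I).and (mElem_isAlgClosed.and (mElem_fSolvable I))).elem.congr fun N => ?_
  rw [isBig_iff]
  exact exists_congr fun A => and_congr_right fun _ =>
    ⟨fun h => ⟨h.1, h.2.1, h.2.2⟩, fun h => ⟨h.1, h.2, h.3⟩⟩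

end GrassModule

/-! ### Embeddings of models and transfer of the predicates. -/

namespace GrassModule

open MSLanguage MvPolynomial

/-! ### Semilinear maps preserving linear independence -/

/-- A semilinear map sending independent families over the source field to independent families
over the target field. -/
structure LinExt {K K' M M' : Type*} [Field K] [Field K'] [AddCommGroup M] [AddCommGroup M']
    [Module K M] [Module K' M'] (σ : K →+* K') (e : M →+ M') : Prop where
  smul : ∀ c v, e (c • v) = σ c • e v
  indep : ∀ (k : ℕ) (v : Fin k → M), LinearIndependent K v → LinearIndependent K' fun i => e (v i)

section LinExt

variable {K K' K'' M M' M'' : Type*} [Field K] [Field K'] [Field K''] [AddCommGroup M]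
  [AddCommGroup M'] [AddCommGroup M''] [Module K M] [Module K' M'] [Module K'' M'']
  {σ : K →+* K'} {e : M →+ M'} {σ' : K' →+* K''} {e' : M' →+ M''}

theorem LinExt.comp (h' : LinExt σ' e') (h : LinExt σ e) : LinExt (σ'.comp σ) (e'.comp e) where
  smul c v := by simp [h.smul, h'.smul]
  indep k v hv := h'.indep k _ (h.indep k v hv)

theorem LinExt.map_sum (h : LinExt σ e) {ι : Type*} (s : Finset ι) (c : ι → K) (v : ι → M) :
    e (∑ i ∈ s, c i • v i) = ∑ i ∈ s, σ (c i) • e (v i) := by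
  rw [_root_.map_sum]
  exact Finset.sum_congr rfl fun i _ => h.smul _ _

theorem LinExt.linearIndependent (h : LinExt σ e) {ι : Type*} {v : ι → M}
    (hv : LinearIndependent K v) : LinearIndependent K' fun i => e (v i) := by
  rw [linearIndependent_iff_finset_linearIndependent] at hv ⊢
  intro s
  have := h.indep _ _ ((hv s).comp _ s.equivFin.symm.injective)
  have := this.comp _ s.equivFin.injective
  simpa [Function.comp_def] using this

theorem LinExt.injective (h : LinExt σ e) : Function.Injective e := by
  rw [injective_iff_map_eq_zero]
  intro v hv
  by_contra hne
  have := h.linearIndependent (v := fun _ : Unit => v) (LinearIndependent.of_subsingleton () hne)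
  exact this.ne_zero () hv

/-- The map factors through its linearization on K' ⊗ M. Independence of the images of a basis makes
the linearization injective, and 1 ⊗ v stays independent by flatness. -/
theorem linExt_of_basis {ι : Type*} (b : Module.Basis ι K M)
    (hs : ∀ c v, e (c • v) = σ c • e v) (hb : LinearIndependent K' fun i => e (b i)) :
    LinExt σ e where
  smul := hs
  indep k v hv := by
    let := σ.toAlgebra
    let : Module K M' := Module.compHom M' σ
    have : IsScalarTower K K' M' := ⟨fun c d v => by
      change (σ c * d) • v = σ c • d • v
      rw [mul_smul]⟩
    let e₁ : M →ₗ[K] M' := { e with map_smul' := hs }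
    let E : TensorProduct K K' M →ₗ[K'] M' := LinearMap.liftBaseChange K' e₁
    have hE : ∀ w, E (TensorProduct.tmul K 1 w) = e w := fun w => by
      simp [E, e₁, LinearMap.liftBaseChange_tmul]
    have hinj : LinearMap.ker E = ⊥ := by
      rw [LinearMap.ker_eq_bot']
      intro x hx
      let B := b.baseChange K'
      have h1 : E x = Finsupp.linearCombination K' (fun i => e (b i)) (B.repr x) := by
        conv_lhs => rw [← B.linearCombination_repr x]
        rw [Finsupp.apply_linearCombination]
        congr 2
        funext i
        simp [B, hE]
      rw [hx] at h1
      have h2 := (linearIndependent_iff.1 hb) _ h1.symm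
      simpa using h2
    have h1 := (Module.Flat.linearIndependent_one_tmul (S := K') hv).map' E hinj
    simpa [Function.comp_def, hE] using h1

/-- A spanning family with independent images is itself independent, since σ is injective; hence it
is a basis. -/
theorem linExt_of_span {ι : Type*} (g : ι → M) (hg : Submodule.span K (Set.range g) = ⊤)
    (hs : ∀ c v, e (c • v) = σ c • e v) (hb : LinearIndependent K' fun i => e (g i)) :
    LinExt σ e := by
  have hgi : LinearIndependent K g := by
    rw [linearIndependent_iff'] at hb ⊢
    intro s c hc i hi
    have := hb s (fun i => σ (c i)) (by
      simp only [← hs, ← map_sum, hc, map_zero]) i hi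
    exact (map_eq_zero σ).1 this
  exact linExt_of_basis (Module.Basis.mk hgi hg.ge) hs (by simpa using hb)

theorem LinExt.finrank_span (h : LinExt σ e) {ι : Type*} [Finite ι] (v : ι → M) :
    Module.finrank K' (Submodule.span K' (Set.range fun i => e (v i))) =
      Module.finrank K (Submodule.span K (Set.range v)) := by
  obtain ⟨κ, a, ha, hspan, hli⟩ := exists_linearIndependent' K v
  have := Finite.of_injective a ha
  have := Fintype.ofFinite κ
  have hspan' : Submodule.span K' (Set.range fun i => e (v i)) =
      Submodule.span K' (Set.range fun i => e (v (a i))) := by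
    refine le_antisymm (Submodule.span_le.2 ?_) (Submodule.span_mono ?_)
    · rintro _ ⟨i, rfl⟩
      have : v i ∈ Submodule.span K (Set.range (v ∘ a)) := hspan ▸ Submodule.subset_span ⟨i, rfl⟩
      obtain ⟨c, hc⟩ := (Submodule.mem_span_range_iff_exists_fun K).1 this
      rw [SetLike.mem_coe]
      beta_reduce
      rw [← hc, h.map_sum]
      exact Submodule.sum_mem _ fun j _ => Submodule.smul_mem _ _ (Submodule.subset_span ⟨j, rfl⟩)
    · rintro _ ⟨i, rfl⟩
      exact ⟨a i, rfl⟩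
  rw [hspan', ← hspan, finrank_span_eq_card hli, finrank_span_eq_card (b := fun i => e (v (a i))) (h.linearIndependent hli)]

theorem linExt_pi (σ : K →+* K') (ι : Type*) [Finite ι] :
    LinExt (M := ι → K) (M' := ι → K') σ (σ.toAddMonoidHom.compLeft ι) := by
  classical
  refine linExt_of_basis (Pi.basisFun K ι) (fun c v => by ext; simp) ?_
  have : (fun i => σ.toAddMonoidHom.compLeft ι (Pi.basisFun K ι i)) = Pi.basisFun K' ι := by
    ext i j
    simp [Pi.single_apply, apply_ite σ]
  rw [this]
  exact (Pi.basisFun K' ι).linearIndependent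

theorem linExt_map (σ : K →+* K') (ι : Type*) :
    LinExt (M := MvPolynomial ι K) (M' := MvPolynomial ι K') σ
      (map (σ := ι) σ).toAddMonoidHom := by
  refine linExt_of_basis (basisMonomials ι K) (fun c v => ?_) ?_
  · simp [smul_eq_C_mul]
  · have : (fun i => (map (σ := ι) σ).toAddMonoidHom (basisMonomials ι K i)) =
        basisMonomials ι K' := by
      ext i j
      simp
    rw [this]
    exact (basisMonomials ι K').linearIndependent

/-- Inclusion means that adjoining v does not increase the rank of w, and ranks of finite families
are preserved. -/
theorem LinExt.span_le_span_iff (h : LinExt σ e) {ι κ : Type*} [Finite ι] [Finite κ] {v : ι → M}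
    {w : κ → M} : Submodule.span K' (Set.range fun i => e (v i)) ≤
      Submodule.span K' (Set.range fun i => e (w i)) ↔
      Submodule.span K (Set.range v) ≤ Submodule.span K (Set.range w) := by
  constructor
  · intro hle
    have h1 := h.finrank_span (Sum.elim v w)
    have h2 := h.finrank_span w
    have h3 : (fun i => e (Sum.elim v w i)) = Sum.elim (fun i => e (v i)) fun i => e (w i) := by
      ext i
      rcases i with i | i <;> rfl
    rw [h3, Set.Sum.elim_range, Set.Sum.elim_range, Submodule.span_union, Submodule.span_union,
      sup_eq_right.2 hle, h2] at h1
    have : FiniteDimensional K (Submodule.span K (Set.range v)) :=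
      FiniteDimensional.span_of_finite _ (Set.finite_range _)
    have : FiniteDimensional K (Submodule.span K (Set.range w)) :=
      FiniteDimensional.span_of_finite _ (Set.finite_range _)
    rw [Submodule.eq_of_le_of_finrank_eq le_sup_right h1]
    exact le_sup_left
  · intro hle
    rw [Submodule.span_le]
    have := Fintype.ofFinite κ
    rintro _ ⟨i, rfl⟩
    obtain ⟨c, hc⟩ := (Submodule.mem_span_range_iff_exists_fun K).1
      (hle (Submodule.subset_span ⟨i, rfl⟩))
    rw [SetLike.mem_coe]
    beta_reduce
    rw [← hc, h.map_sum]
    exact Submodule.sum_mem _ fun j _ => Submodule.smul_mem _ _ (Submodule.subset_span ⟨j, rfl⟩)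

theorem rowSpan_map_le_iff (σ : K →+* K') {k : ℕ} {X Y : Fin k → Fin k → K} :
    rowSpan (fun a b => σ (X a b)) ≤ rowSpan (fun a b => σ (Y a b)) ↔ rowSpan X ≤ rowSpan Y :=
  (linExt_pi σ (Fin k)).span_le_span_iff

theorem rowSpan_map_eq_iff (σ : K →+* K') {k : ℕ} {X Y : Fin k → Fin k → K} :
    rowSpan (fun a b => σ (X a b)) = rowSpan (fun a b => σ (Y a b)) ↔ rowSpan X = rowSpan Y := by
  rw [le_antisymm_iff, le_antisymm_iff, rowSpan_map_le_iff, rowSpan_map_le_iff]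

theorem finrank_relations_add {k : ℕ} (v : Fin k → M) :
    Module.finrank K (Submodule.span K (Set.range v)) + Module.finrank K (relations K v) = k := by
  have := LinearMap.finrank_range_add_finrank_ker (Fintype.linearCombination K v)
  rwa [Fintype.range_linearCombination, Module.finrank_fin_fun] at this

/-- One inclusion holds by semilinearity. Ranks being preserved, rank-nullity over both fields shows
that the dimensions agree. This gives compatibility with the symbols D_i. -/
theorem LinExt.rowSpan_eq_relations (h : LinExt σ e) {k : ℕ} {X : Fin k → Fin k → K}
    {v : Fin k → M} (hX : rowSpan X = relations K v) :
    rowSpan (fun a b => σ (X a b)) = relations K' fun i => e (v i) := by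
  refine Submodule.eq_of_le_of_finrank_eq ?_ ?_
  · rw [rowSpan, Submodule.span_le]
    rintro _ ⟨a, rfl⟩
    have h1 : X a ∈ relations K v := hX ▸ Submodule.subset_span ⟨a, rfl⟩
    have h2 : ∑ b, X a b • v b = 0 := h1
    have h3 : ∑ b, σ (X a b) • e (v b) = 0 := by rw [← h.map_sum, h2, map_zero]
    exact h3
  · have h1 := (linExt_pi σ (Fin k)).finrank_span X
    have h2 := h.finrank_span v
    have h3 := finrank_relations_add (K := K) v
    have h4 := finrank_relations_add (K := K') fun i => e (v i)
    have h5 : Module.finrank K' (rowSpan fun a b => σ (X a b)) = Module.finrank K (rowSpan X) := h1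
    rw [hX] at h5
    omega

end LinExt

end GrassModule

namespace GrassModule

open MSLanguage MvPolynomial

/-! ### Quantifier-free formulas and ring homomorphisms -/

theorem exists_realize_term_subring {F F' : Type*} [Field F] [Field F'] {R : Subring F}
    (ψ : R →+* F') {V : Type} (x : V → R) (t : FirstOrder.Language.ring.Term V) :
    letI := FirstOrder.Ring.compatibleRingOfRing F
    letI := FirstOrder.Ring.compatibleRingOfRing F'
    ∃ r : R, t.realize (fun v => (x v : F)) = r ∧ t.realize (fun v => ψ (x v)) = ψ r := by
  let i₁ := FirstOrder.Ring.compatibleRingOfRing F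
  let i₂ := FirstOrder.Ring.compatibleRingOfRing F'
  induction t with
  | var v => exact ⟨x v, rfl, rfl⟩
  | func f ts ih =>
    choose r h h' using ih
    cases f with
    | add =>
      refine ⟨r 0 + r 1, ?_, ?_⟩
      · exact (FirstOrder.Ring.realize_add (ts 0) (ts 1) _).trans (by rw [h, h]; rfl)
      · exact (FirstOrder.Ring.realize_add (ts 0) (ts 1) _).trans (by rw [h', h', map_add])
    | mul =>
      refine ⟨r 0 * r 1, ?_, ?_⟩
      · exact (FirstOrder.Ring.realize_mul (ts 0) (ts 1) _).trans (by rw [h, h]; rfl)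
      · exact (FirstOrder.Ring.realize_mul (ts 0) (ts 1) _).trans (by rw [h', h', map_mul])
    | neg =>
      refine ⟨-r 0, ?_, ?_⟩
      · exact (FirstOrder.Ring.realize_neg (ts 0) _).trans (by rw [h]; rfl)
      · exact (FirstOrder.Ring.realize_neg (ts 0) _).trans (by rw [h', map_neg])
    | zero =>
      refine ⟨0, ?_, ?_⟩
      · exact FirstOrder.Ring.realize_zero fun v => (x v : F)
      · exact (FirstOrder.Ring.realize_zero fun v => ψ (x v)).trans (map_zero ψ).symm
    | one =>
      refine ⟨1, ?_, ?_⟩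
      · exact FirstOrder.Ring.realize_one fun v => (x v : F)
      · exact (FirstOrder.Ring.realize_one fun v => ψ (x v)).trans (map_one ψ).symm

/-- The truth of a quantifier-free formula is preserved by all homomorphisms defined on subrings
containing a certain finite set. -/
theorem exists_finite_realize_iff {F : Type*} [Field F] {V : Type}
    {φ : FirstOrder.Language.ring.Formula V} (hφ : FirstOrder.Language.BoundedFormula.IsQF φ)
    (x : V → F) : ∃ S : Set F, S.Finite ∧ ∀ (R : Subring F), S ⊆ R → ∀ x' : V → R,
      (∀ v, (x' v : F) = x v) → ∀ (F' : Type u) [Field F'] (ψ : R →+* F'),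
        letI := FirstOrder.Ring.compatibleRingOfRing F
        letI := FirstOrder.Ring.compatibleRingOfRing F'
        (φ.Realize x ↔ φ.Realize fun v => ψ (x' v)) := by
  unfold FirstOrder.Language.Formula.Realize
  induction hφ with
  | falsum => exact ⟨∅, Set.finite_empty, fun _ _ _ _ _ _ _ => Iff.rfl⟩
  | of_isAtomic h =>
    cases h with
    | equal t₁ t₂ =>
      let i₁ := FirstOrder.Ring.compatibleRingOfRing F
      -- Having this inverse in the subring prevents ψ from killing a nonzero difference. If the
      -- difference is zero, the inverse is 0 and imposes nothing.
      refine ⟨{(t₁.realize (Sum.elim x default) - t₂.realize (Sum.elim x default))⁻¹},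
        Set.finite_singleton _, fun R hR x' hx' F' _ ψ => ?_⟩
      obtain rfl : (fun v => (x' v : F)) = x := _root_.funext hx'
      let i₂ := FirstOrder.Ring.compatibleRingOfRing F'
      change t₁.realize _ = t₂.realize _ ↔ t₁.realize _ = t₂.realize _
      have e₁ : (Sum.elim (fun v => (x' v : F)) (default : Fin 0 → F)) =
          fun v => ((Sum.elim x' (default : Fin 0 → R) v : R) : F) := by
        ext v
        rcases v with v | v
        · rfl
        · exact v.elim0
      have e₂ : (Sum.elim (fun v => ψ (x' v)) (default : Fin 0 → F')) =
          fun v => ψ (Sum.elim x' (default : Fin 0 → R) v) := by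
        ext v
        rcases v with v | v
        · rfl
        · exact v.elim0
      obtain ⟨r₁, h₁, h₁'⟩ := exists_realize_term_subring ψ (Sum.elim x' default) t₁
      obtain ⟨r₂, h₂, h₂'⟩ := exists_realize_term_subring ψ (Sum.elim x' default) t₂
      rw [Set.singleton_subset_iff, e₁, h₁, h₂] at hR
      rw [e₁, e₂, h₁, h₂, h₁', h₂']
      refine ⟨fun h => by rw [Subtype.ext h], fun h => ?_⟩
      by_contra hne
      have h3 : (r₁ - r₂) * (⟨_, hR⟩ : R) = 1 := by
        ext
        exact mul_inv_cancel₀ (sub_ne_zero.2 hne)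
      have := congrArg ψ h3
      rw [map_mul, map_sub, h, sub_self, zero_mul, map_one] at this
      exact zero_ne_one this
    | rel R ts => exact R.elim
  | imp h₁ h₂ ih₁ ih₂ =>
    obtain ⟨S₁, hS₁, H₁⟩ := ih₁
    obtain ⟨S₂, hS₂, H₂⟩ := ih₂
    refine ⟨S₁ ∪ S₂, hS₁.union hS₂, fun R hR x' hx' F' _ ψ => ?_⟩
    exact imp_congr (H₁ R (Set.subset_union_left.trans hR) x' hx' F' ψ)
      (H₂ R (Set.subset_union_right.trans hR) x' hx' F' ψ)

theorem PartFormula.exists_finite_holds_iff (P : PartFormula) {F : Type*} [Field F]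
    (X : (j : Fin P.m) → Fin (P.k j) → Fin (P.k j) → F) (y : Fin P.l → F) :
    ∃ S : Set F, S.Finite ∧ ∀ (R : Subring F), S ⊆ R →
      ∀ (X' : (j : Fin P.m) → Fin (P.k j) → Fin (P.k j) → R) (y' : Fin P.l → R),
      (∀ j a b, (X' j a b : F) = X j a b) → (∀ i, (y' i : F) = y i) →
      ∀ (F' : Type u) [Field F'] (ψ : R →+* F'),
        (P.Holds F X y ↔ P.Holds F' (fun j a b => ψ (X' j a b)) fun i => ψ (y' i)) := by
  obtain ⟨S, hS, H⟩ := exists_finite_realize_iff.{u} P.isQF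
    (Sum.elim (fun q => X q.1 q.2.1 q.2.2) y)
  refine ⟨S, hS, fun R hR X' y' hX hy F' _ ψ => ?_⟩
  have := H R hR (Sum.elim (fun q => X' q.1 q.2.1 q.2.2) y') (by
    rintro (v | v)
    · exact hX _ _ _
    · exact hy _) F' ψ
  unfold PartFormula.Holds
  refine this.trans (iff_of_eq (congrArg _ ?_))
  ext v
  rcases v with v | v <;> rfl

theorem PartFormula.holds_map (P : PartFormula) {F : Type*} {F' : Type u} [Field F] [Field F']
    (σ : F →+* F') (X : (j : Fin P.m) → Fin (P.k j) → Fin (P.k j) → F) (y : Fin P.l → F) :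
    P.Holds F' (fun j a b => σ (X j a b)) (fun i => σ (y i)) ↔ P.Holds F X y := by
  obtain ⟨S, -, H⟩ := P.exists_finite_holds_iff X y
  exact (H ⊤ (fun _ _ => trivial) (fun j a b => ⟨X j a b, trivial⟩) (fun i => ⟨y i, trivial⟩)
    (fun _ _ _ => rfl) (fun _ => rfl) F' (σ.comp (Subring.subtype ⊤))).symm

/-! ### Predicates on the Grassmannians under field extensions -/

/-- The predicate given by the formula on the Grassmannians over the smaller field is induced from
that over the larger field. -/
def PartFormula.Transfers (P : PartFormula) {K K' : Type*} [Field K] [Field K'] (σ : K →+* K') :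
    Prop :=
  ∀ (Z : (j : Fin P.m) → Fin (P.k j) → Fin (P.k j) → K) (y : Fin P.l → K),
    (∃ X, P.Holds K X y ∧ ∀ j, rowSpan (X j) = rowSpan (Z j)) ↔
      ∃ X, P.Holds K' X (fun i => σ (y i)) ∧
        ∀ j, rowSpan (X j) = rowSpan fun a b => σ (Z j a b)

/-- Homogeneity is assumed only for fields in the lowest universe. The finitely many entries
generate a countable subfield, which has a copy there, and quantifier-free truth is unaffected by
field extensions. -/
theorem PartFormula.Homogeneous.holds_iff {P : PartFormula} (h : P.Homogeneous) {F : Type u}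
    [Field F] {X X' : (j : Fin P.m) → Fin (P.k j) → Fin (P.k j) → F} {y : Fin P.l → F}
    (hX : ∀ j, rowSpan (X j) = rowSpan (X' j)) : P.Holds F X y ↔ P.Holds F X' y := by
  let S : Set F := Set.range (Sum.elim (Sum.elim
    (fun q : (Σ j, Fin (P.k j) × Fin (P.k j)) => X q.1 q.2.1 q.2.2)
    (fun q : (Σ j, Fin (P.k j) × Fin (P.k j)) => X' q.1 q.2.1 q.2.2)) y)
  let L := Subfield.closure S
  have hS : S ⊆ L := Subfield.subset_closure
  have : Countable L := by
    rw [← Cardinal.mk_le_aleph0_iff]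
    refine (Subfield.cardinalMk_closure_le_max S).trans (max_le ?_ le_rfl)
    exact (Cardinal.mk_le_aleph0_iff).2 (Set.finite_range _).countable.to_subtype
  have : Small.{0} L := Countable.toSmall L
  let σ : Shrink.{0} L →+* F := L.subtype.comp (Shrink.ringEquiv L).toRingHom
  have hσ : ∀ z ∈ S, ∃ w, σ w = z := fun z hz =>
    ⟨(Shrink.ringEquiv L).symm ⟨z, hS hz⟩, by simp [σ]⟩
  choose X₀ hX₀ using fun j a b => hσ (X j a b) ⟨.inl (.inl ⟨j, a, b⟩), rfl⟩
  choose X₁ hX₁ using fun j a b => hσ (X' j a b) ⟨.inl (.inr ⟨j, a, b⟩), rfl⟩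
  choose y₀ hy₀ using fun i => hσ (y i) ⟨.inr i, rfl⟩
  have e₀ : X = fun j a b => σ (X₀ j a b) := by simp only [hX₀]
  have e₁ : X' = fun j a b => σ (X₁ j a b) := by simp only [hX₁]
  have e₂ : y = fun i => σ (y₀ i) := by simp only [hy₀]
  rw [e₀, e₁, e₂, P.holds_map, P.holds_map]
  refine h _ _ _ _ fun j => (rowSpan_map_eq_iff σ).1 ?_
  simp only [hX₀, hX₁]
  exact hX j

/-- For the descent, the given matrices Z are themselves witnesses: over K' they have the same row
spaces as X. -/
theorem PartFormula.Homogeneous.transfers {P : PartFormula} (h : P.Homogeneous) {K K' : Type u}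
    [Field K] [Field K'] (σ : K →+* K') : P.Transfers σ := by
  intro Z y
  constructor
  · rintro ⟨X, hX, hX'⟩
    exact ⟨_, (P.holds_map σ X y).2 hX, fun j => (rowSpan_map_eq_iff σ).2 (hX' j)⟩
  · rintro ⟨X, hX, hX'⟩
    exact ⟨Z, (P.holds_map σ Z y).1 ((h.holds_iff hX').1 hX), fun _ => rfl⟩

/-- Zariski's lemma: the quotient by a maximal ideal is a finite extension of K, and it embeds into
the algebraically closed L. -/
theorem exists_algHom_of_finiteType {K R L : Type*} [Field K] [CommRing R] [Nontrivial R] [Field L]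
    [Algebra K R] [Algebra K L] [IsAlgClosed L] (h : Algebra.FiniteType K R) :
    Nonempty (R →ₐ[K] L) := by
  obtain ⟨m, hm⟩ := Ideal.exists_maximal R
  let := Ideal.Quotient.field m
  have : Algebra.FiniteType K (R ⧸ m) :=
    Algebra.FiniteType.of_surjective (Ideal.Quotient.mkₐ K m) (Ideal.Quotient.mkₐ_surjective K m)
  have : Module.Finite K (R ⧸ m) := finite_of_finite_type_of_isJacobsonRing K (R ⧸ m)
  have := Algebra.IsAlgebraic.of_finite K (R ⧸ m)
  exact ⟨(IsAlgClosed.lift (R := K) (S := R ⧸ m) (M := L)).comp (Ideal.Quotient.mkₐ K m)⟩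

/-- A witness over K' is specialized to K. The finitely generated K-algebra contains its entries,
the matrices proving both inclusions of row spaces, and the elements that protect the truth of the
formula; any K-algebra homomorphism to K keeps all of this. -/
theorem PartFormula.transfers_of_isAlgClosed (P : PartFormula) {K K' : Type u}
    [Field K] [Field K'] [IsAlgClosed K] (σ : K →+* K') : P.Transfers σ := by
  intro Z y
  constructor
  · rintro ⟨X, hX, hX'⟩
    exact ⟨_, (P.holds_map σ X y).2 hX, fun j => (rowSpan_map_eq_iff σ).2 (hX' j)⟩
  · rintro ⟨X, hX, hX'⟩
    let := σ.toAlgebra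
    obtain ⟨S, hS, H⟩ := P.exists_finite_holds_iff.{u} X fun i => σ (y i)
    choose B hB using fun j => rowSpan_le_iff.1 (hX' j).le
    choose B' hB' using fun j => rowSpan_le_iff.1 (hX' j).ge
    let T : Set K' := S ∪ Set.range (fun q : (Σ j, Fin (P.k j) × Fin (P.k j)) => X q.1 q.2.1 q.2.2)
      ∪ Set.range (fun q : (Σ j, Fin (P.k j) × Fin (P.k j)) => B q.1 q.2)
      ∪ Set.range (fun q : (Σ j, Fin (P.k j) × Fin (P.k j)) => B' q.1 q.2)
    have hT : T.Finite := ((hS.union (Set.finite_range _)).union (Set.finite_range _)).union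
      (Set.finite_range _)
    let R := Algebra.adjoin K T
    have hTR : T ⊆ R := Algebra.subset_adjoin
    obtain ⟨ψ⟩ := exists_algHom_of_finiteType (K := K) (R := R) (L := K)
      (R.fg_iff_finiteType.1 ⟨hT.toFinset, by simp [R]⟩)
    have hψ : ∀ c, ψ (algebraMap K R c) = c := fun c => ψ.commutes c
    let X₀ : (j : Fin P.m) → Fin (P.k j) → Fin (P.k j) → R := fun j a b =>
      ⟨X j a b, hTR (.inl (.inl (.inr ⟨⟨j, a, b⟩, rfl⟩)))⟩
    let B₀ : (j : Fin P.m) → Fin (P.k j) × Fin (P.k j) → R := fun j q =>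
      ⟨B j q, hTR (.inl (.inr ⟨⟨j, q⟩, rfl⟩))⟩
    let B₁ : (j : Fin P.m) → Fin (P.k j) × Fin (P.k j) → R := fun j q =>
      ⟨B' j q, hTR (.inr ⟨⟨j, q⟩, rfl⟩)⟩
    refine ⟨fun j a b => ψ (X₀ j a b), ?_, fun j => le_antisymm ?_ ?_⟩
    · have := (H R.toSubring (fun z hz => hTR (.inl (.inl (.inl hz)))) X₀
        (fun i => algebraMap K R (y i)) (fun _ _ _ => rfl) (fun _ => rfl) K ψ.toRingHom).1 hX
      have hy : (fun i => ψ.toRingHom (algebraMap K R (y i))) = y := _root_.funext fun i => hψ _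
      rw [hy] at this
      exact this
    · refine rowSpan_le_iff.2 ⟨fun q => ψ (B₀ j q), fun a b => ?_⟩
      have : X₀ j a b = ∑ c, B₀ j (a, c) * algebraMap K R (Z j c b) := by
        ext
        simp only [AddSubmonoidClass.coe_finsetSum, MulMemClass.coe_mul]
        exact hB j a b
      beta_reduce
      rw [this, map_sum]
      simp only [map_mul, hψ]
    · refine rowSpan_le_iff.2 ⟨fun q => ψ (B₁ j q), fun a b => ?_⟩
      have : algebraMap K R (Z j a b) = ∑ c, B₁ j (a, c) * X₀ j c b := by
        ext
        simp only [AddSubmonoidClass.coe_finsetSum, MulMemClass.coe_mul]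
        exact hB' j a b
      beta_reduce
      rw [← hψ (Z j a b), this, map_sum]
      simp only [map_mul]

end GrassModule

namespace MSLanguage

variable {L : MSLanguage}

/-- Composition of embeddings. -/
def Embedding.comp {N N' N'' : Struc.{u} L} (g : Embedding N' N'') (f : Embedding N N') :
    Embedding N N'' where
  toFun s x := g.toFun s (f.toFun s x)
  inj s := (g.inj s).comp (f.inj s)
  map_fn h x := by rw [f.map_fn, g.map_fn]
  map_rel r x := (f.map_rel r x).trans (g.map_rel r _)

end MSLanguage

namespace GrassModule

open MSLanguage MvPolynomial

variable {n : ℕ} {Φ : Set PartFormula}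

/-! ### Symbols and embeddings -/

section Symbols

variable (N : Struc.{u} (lang n Φ))

theorem fn_kZero (x) : N.fn GFn.kZero x = kZero N :=
  congrArg (N.fn GFn.kZero) (_root_.funext fun a => Empty.elim a)
theorem fn_kOne (x) : N.fn GFn.kOne x = kOne N :=
  congrArg (N.fn GFn.kOne) (_root_.funext fun a => Empty.elim a)
theorem fn_kAdd (x : Fin 2 → KS N) : N.fn GFn.kAdd x = kAdd N (x 0) (x 1) :=
  congrArg (N.fn GFn.kAdd) (_root_.funext fun (i : Fin 2) => by fin_cases i <;> rfl)
theorem fn_kMul (x : Fin 2 → KS N) : N.fn GFn.kMul x = kMul N (x 0) (x 1) :=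
  congrArg (N.fn GFn.kMul) (_root_.funext fun (i : Fin 2) => by fin_cases i <;> rfl)
theorem fn_mZero (x) : N.fn GFn.mZero x = mZero N :=
  congrArg (N.fn GFn.mZero) (_root_.funext fun a => Empty.elim a)
theorem fn_mAdd (x : Fin 2 → MS N) : N.fn GFn.mAdd x = mAdd N (x 0) (x 1) :=
  congrArg (N.fn GFn.mAdd) (_root_.funext fun (i : Fin 2) => by fin_cases i <;> rfl)
theorem fn_smul (x : (a : Unit ⊕ Unit) → N.carrier (Sum.elim (fun _ => GSort.K)
    (fun _ => GSort.M) a)) : N.fn GFn.smul x = smulS N (x (.inl ())) (x (.inr ())) :=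
  congrArg (N.fn GFn.smul) (_root_.funext fun (i : Unit ⊕ Unit) => by rcases i with _ | _ <;> rfl)
theorem fn_T (j : Fin n) (x : Unit → MS N) : N.fn (GFn.T j) x = tS N j (x ()) := rfl
theorem rel_eq (P : Φ) (x : (a : Fin P.1.m ⊕ Fin P.1.l) → N.carrier (Sum.elim
    (fun j => GSort.G (P.1.k j)) (fun _ => GSort.K) a)) :
    N.rel P x ↔ pS N P (fun j => x (.inl j)) (fun i => x (.inr i)) := by
  refine iff_of_eq (congrArg (N.rel P) (_root_.funext fun a => ?_))
  rcases a with a | a <;> rfl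

end Symbols

section Embedding

variable {N N' : Struc.{u} (lang n Φ)} (f : Embedding N N')

/-- The action of an embedding on the field. -/
abbrev embK (x : KS N) : KS N' := f.toFun GSort.K x

/-- The action of an embedding on the module. -/
abbrev embM (x : MS N) : MS N' := f.toFun GSort.M x

/-- The action of an embedding on the Grassmannians. -/
abbrev embG (i : ℕ+) (x : GS N i) : GS N' i := f.toFun (GSort.G i) x

theorem emb_kZero : embK f (kZero N) = kZero N' := (f.map_fn GFn.kZero _).trans (fn_kZero _ _)
theorem emb_kOne : embK f (kOne N) = kOne N' := (f.map_fn GFn.kOne _).trans (fn_kOne _ _)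
theorem emb_kAdd (x y) : embK f (kAdd N x y) = kAdd N' (embK f x) (embK f y) :=
  (f.map_fn GFn.kAdd _).trans (fn_kAdd _ _)
theorem emb_kMul (x y) : embK f (kMul N x y) = kMul N' (embK f x) (embK f y) :=
  (f.map_fn GFn.kMul _).trans (fn_kMul _ _)
theorem emb_mZero : embM f (mZero N) = mZero N' := (f.map_fn GFn.mZero _).trans (fn_mZero _ _)
theorem emb_mAdd (x y) : embM f (mAdd N x y) = mAdd N' (embM f x) (embM f y) :=
  (f.map_fn GFn.mAdd _).trans (fn_mAdd _ _)
theorem emb_smul (x y) : embM f (smulS N x y) = smulS N' (embK f x) (embM f y) :=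
  (f.map_fn GFn.smul _).trans (fn_smul _ _)
theorem emb_pi (i : ℕ+) (X) : embG f i (piS N i X) = piS N' i fun a b => embK f (X a b) :=
  f.map_fn (GFn.pi i) _
theorem emb_D (i : ℕ+) (v) : embG f i (dS N i v) = dS N' i fun a => embM f (v a) :=
  f.map_fn (GFn.D i) _
theorem emb_T (j : Fin n) (v) : embM f (tS N j v) = tS N' j (embM f v) :=
  f.map_fn (GFn.T j) _

end Embedding

section Models

variable {A B : Mdl.{u} n Φ} (f : Embedding A.N B.N)

/-- The field homomorphism given by an embedding. -/
def embRingHom : A.K →+* B.K where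
  toFun := embK f
  map_zero' := by
    have := emb_kZero f
    rwa [A.core.kZero_eq, B.core.kZero_eq] at this
  map_one' := by
    have := emb_kOne f
    rwa [A.core.kOne_eq, B.core.kOne_eq] at this
  map_add' x y := by
    have := emb_kAdd f x y
    rwa [A.core.kAdd_eq, B.core.kAdd_eq] at this
  map_mul' x y := by
    have := emb_kMul f x y
    rwa [A.core.kMul_eq, B.core.kMul_eq] at this

/-- The homomorphism of modules given by an embedding. -/
def embAddHom : A.M →+ B.M where
  toFun := embM f
  map_zero' := by
    have := emb_mZero f
    rwa [A.core.mZero_eq, B.core.mZero_eq] at this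
  map_add' x y := by
    have := emb_mAdd f x y
    rwa [A.core.mAdd_eq, B.core.mAdd_eq] at this

theorem embAddHom_X_smul (j : Fin n) (v : A.M) :
    embAddHom f ((X j : MvPolynomial (Fin n) A.K) • v) =
      (X j : MvPolynomial (Fin n) B.K) • embAddHom f v := by
  have := emb_T f j v
  rwa [A.core.t_eq, B.core.t_eq] at this

theorem relations_eq_bot_iff {K M : Type*} [Field K] [AddCommGroup M] [Module K M] {i : ℕ}
    {v : Fin i → M} : relations K v = ⊥ ↔ LinearIndependent K v :=
  LinearMap.ker_eq_bot.trans linearIndependent_iff_injective_fintypeLinearCombination.symm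

theorem rowSpan_zero (K : Type*) [Field K] (i : ℕ) :
    rowSpan (fun _ _ => 0 : Fin i → Fin i → K) = ⊥ := by
  rw [rowSpan, Submodule.span_eq_bot]
  rintro _ ⟨a, rfl⟩
  rfl

/-- Independence says that D_i(v) is the zero subspace, an equality in a Grassmannian sort that the
embedding preserves. -/
theorem linearIndependent_embM {I : Ideal (MvPolynomial (Fin n) ℤ)} (hA : A.IsGrass I)
    (hB : B.IsGrass I) (i : ℕ+) (v : Fin i → A.M) (hv : LinearIndependent A.K v) :
    LinearIndependent B.K fun a => embAddHom f (v a) := by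
  obtain ⟨X, hX⟩ := hA.pi_surjective i (dS A.N i v)
  have h1 := hA.d_eq i v X hX
  have h4 : piS A.N i X = piS A.N i fun _ _ => (0 : A.K) := by
    rw [hA.pi_eq_iff, h1, relations_eq_bot_iff.2 hv, rowSpan_zero]
  have h5 : piS B.N i (fun _ _ => (0 : B.K)) = dS B.N i fun a => embAddHom f (v a) := by
    refine Eq.trans ?_ (emb_D f i v)
    rw [← hX, h4, emb_pi]
    congr 1
    funext a b
    exact (map_zero (embRingHom f)).symm
  have h6 := hB.d_eq i _ _ h5
  rwa [rowSpan_zero, eq_comm, relations_eq_bot_iff] at h6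

theorem embAddHom_linExt {I : Ideal (MvPolynomial (Fin n) ℤ)} (hA : A.IsGrass I)
    (hB : B.IsGrass I) : LinExt (embRingHom f) (embAddHom f) where
  smul c v := by
    have := emb_smul f c v
    rwa [A.core.smul_eq, B.core.smul_eq] at this
  indep k v hv := by
    -- The Grassmannian sorts start at 1, so the empty family is treated apart.
    rcases Nat.eq_zero_or_pos k with rfl | hk
    · exact linearIndependent_empty_type
    · exact linearIndependent_embM f hA hB ⟨k, hk⟩ v hv

/-- The maps on the sorts induced by maps of the field and of the module. -/
noncomputable def inducedFun {A B : Mdl.{u} n Φ} {I : Ideal (MvPolynomial (Fin n) ℤ)}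
    (hA : A.IsGrass I) (σ : A.K → B.K) (e : A.M → B.M) :
    (s : GSort) → A.N.carrier s → B.N.carrier s
  | .K => σ
  | .M => e
  | .G i => fun p => piS B.N i fun a b => σ ((hA.pi_surjective i p).choose a b)

/-- The matrix chosen to represent the subspace is irrelevant, since equality of row spaces is
unaffected by the field extension. -/
theorem inducedFun_pi {I : Ideal (MvPolynomial (Fin n) ℤ)}
    (hA : A.IsGrass I) (hB : B.IsGrass I) (σ : A.K →+* B.K) (e : A.M → B.M) (i : ℕ+)
    (X : Fin i → Fin i → A.K) :
    inducedFun hA σ e (GSort.G i) (piS A.N i X) = piS B.N i fun a b => σ (X a b) := by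
  refine (hB.pi_eq_iff i _ _).2 ((rowSpan_map_eq_iff σ).2 ((hA.pi_eq_iff i _ _).1 ?_))
  exact (hA.pi_surjective i (piS A.N i X)).choose_spec

theorem pS_iff_inducedFun {I : Ideal (MvPolynomial (Fin n) ℤ)}
    (hA : A.IsGrass I) (hB : B.IsGrass I) {σ : A.K →+* B.K} {e : A.M → B.M}
    (hΦ : ∀ P ∈ Φ, P.Transfers σ) (P : Φ) (p : (j : Fin P.1.m) → GS A.N (P.1.k j))
    (y : Fin P.1.l → A.K) : pS A.N P p y ↔
      pS B.N P (fun j => inducedFun hA σ e (GSort.G (P.1.k j)) (p j)) fun i => σ (y i) := by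
  rw [hA.pred_iff, hB.pred_iff]
  choose Z hZ using fun j => hA.pi_surjective (P.1.k j) (p j)
  have hZ' : ∀ j, inducedFun hA σ e (GSort.G (P.1.k j)) (p j) =
      piS B.N (P.1.k j) fun a b => σ (Z j a b) := fun j => by
    rw [← inducedFun_pi hA hB σ e, hZ]
  have := hΦ P.1 P.2 Z y
  simp only [← hA.pi_eq_iff, ← hB.pi_eq_iff, hZ] at this
  simp only [hZ']
  exact this

/-- Converse of `embAddHom_linExt`. The Grassmannian part is forced by σ; `LinExt` yields the
symbols D_i, and `Transfers` yields the predicates. -/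
theorem exists_embedding {I : Ideal (MvPolynomial (Fin n) ℤ)}
    (hA : A.IsGrass I) (hB : B.IsGrass I) {σ : A.K →+* B.K} {e : A.M →+ B.M} (h : LinExt σ e)
    (hX : ∀ j v, e ((X j : MvPolynomial (Fin n) A.K) • v) =
      (X j : MvPolynomial (Fin n) B.K) • e v)
    (hΦ : ∀ P ∈ Φ, P.Transfers σ) :
    ∃ f : Embedding A.N B.N, (∀ x, embK f x = σ x) ∧ ∀ v, embM f v = e v := by
  refine ⟨{ toFun := inducedFun hA σ e, inj := ?_, map_fn := ?_, map_rel := ?_ },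
    fun _ => rfl, fun _ => rfl⟩
  · rintro (_ | _ | i)
    · exact σ.injective
    · exact h.injective
    · intro p q hpq
      obtain ⟨X, rfl⟩ := hA.pi_surjective i p
      obtain ⟨Y, rfl⟩ := hA.pi_surjective i q
      rw [inducedFun_pi hA hB, inducedFun_pi hA hB, hB.pi_eq_iff, rowSpan_map_eq_iff] at hpq
      exact (hA.pi_eq_iff i _ _).2 hpq
  · intro g x
    cases g with
    | kZero =>
      refine Eq.trans (congrArg σ ((fn_kZero _ x).trans A.core.kZero_eq)) ?_
      exact (map_zero σ).trans (B.core.kZero_eq.symm.trans (fn_kZero _ _).symm)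
    | kOne =>
      refine Eq.trans (congrArg σ ((fn_kOne _ x).trans A.core.kOne_eq)) ?_
      exact (map_one σ).trans (B.core.kOne_eq.symm.trans (fn_kOne _ _).symm)
    | kAdd =>
      refine Eq.trans (congrArg σ ((fn_kAdd _ x).trans (A.core.kAdd_eq _ _))) ?_
      exact (map_add σ _ _).trans ((B.core.kAdd_eq _ _).symm.trans
        (fn_kAdd _ fun a : Fin 2 => σ (x a)).symm)
    | kMul =>
      refine Eq.trans (congrArg σ ((fn_kMul _ x).trans (A.core.kMul_eq _ _))) ?_
      exact (map_mul σ _ _).trans ((B.core.kMul_eq _ _).symm.trans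
        (fn_kMul _ fun a : Fin 2 => σ (x a)).symm)
    | mZero =>
      refine Eq.trans (congrArg e ((fn_mZero _ x).trans A.core.mZero_eq)) ?_
      exact (map_zero e).trans (B.core.mZero_eq.symm.trans (fn_mZero _ _).symm)
    | mAdd =>
      refine Eq.trans (congrArg e ((fn_mAdd _ x).trans (A.core.mAdd_eq _ _))) ?_
      exact (map_add e _ _).trans ((B.core.mAdd_eq _ _).symm.trans
        (fn_mAdd _ fun a : Fin 2 => e (x a)).symm)
    | smul =>
      refine Eq.trans (congrArg e ((fn_smul _ x).trans (A.core.smul_eq _ _))) ?_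
      exact (h.smul _ _).trans ((B.core.smul_eq _ _).symm.trans (fn_smul B.N fun a =>
        inducedFun hA σ e (Sum.elim (fun _ => GSort.K) (fun _ => GSort.M) a) (x a)).symm)
    | pi i => exact inducedFun_pi hA hB σ e i fun a b => x (a, b)
    | D i =>
      obtain ⟨X, hX⟩ := hA.pi_surjective i (dS A.N i x)
      refine Eq.trans (congrArg (inducedFun hA σ e (GSort.G i)) hX.symm) ?_
      rw [inducedFun_pi hA hB]
      have h1 := h.rowSpan_eq_relations (hA.d_eq i x X hX)
      obtain ⟨Y, hY⟩ := hB.pi_surjective i (dS B.N i fun a => e (x a))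
      exact ((hB.pi_eq_iff i _ _).2 (h1.trans (hB.d_eq i _ Y hY).symm)).trans hY
    | T j =>
      refine Eq.trans (congrArg e ((fn_T A.N j x).trans (A.core.t_eq j _))) ?_
      exact (hX j _).trans (B.core.t_eq j _).symm
  · intro P x
    exact (rel_eq A.N P x).trans (Iff.trans (pS_iff_inducedFun hA hB hΦ P _ _)
      (rel_eq B.N P fun a => inducedFun hA σ e
        (Sum.elim (fun j => GSort.G (P.1.k j)) (fun _ => GSort.K) a) (x a)).symm)

end Models

/-! ### The standard structure -/

section Std

theorem exists_rowSpan_eq {K : Type*} [Field K] {i : ℕ} (V : Submodule K (Fin i → K)) :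
    ∃ X : Fin i → Fin i → K, rowSpan X = V := by
  have hd : Module.finrank K V ≤ i := by
    simpa using Submodule.finrank_le V
  let b := Module.finBasis K V
  -- A basis of V has at most i vectors; the matrix is filled up with zero rows.
  refine ⟨fun a => if h : a.1 < Module.finrank K V then b ⟨a, h⟩ else 0, le_antisymm ?_ ?_⟩
  · rw [rowSpan, Submodule.span_le]
    rintro _ ⟨a, rfl⟩
    dsimp only
    split_ifs with h
    · exact (b _).2
    · exact V.zero_mem
  · intro v hv
    have : (⟨v, hv⟩ : V) ∈ Submodule.span K (Set.range b) := b.span_eq ▸ Submodule.mem_top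
    have h2 := Submodule.mem_map_of_mem (f := V.subtype) this
    rw [Submodule.map_span] at h2
    refine Submodule.span_mono ?_ h2
    rintro _ ⟨_, ⟨c, rfl⟩, rfl⟩
    exact ⟨⟨c, c.2.trans_le hd⟩, by simp⟩

variable (n Φ) (K M : Type u) [fK : Field K] [aM : AddCommGroup M]
  [mM : Module K M] [pM : Module (MvPolynomial (Fin n) K) M]

/-- The sorts of the standard structure. -/
def stdCarrier : GSort → Type u
  | .K => K
  | .M => M
  | .G i => Submodule K (Fin i → K)

/-- The structure given by a module. -/
noncomputable def stdStruc : Struc.{u} (lang n Φ) where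
  carrier := stdCarrier K M
  fn f := match f with
    | .kZero => fun _ => (0 : K)
    | .kOne => fun _ => (1 : K)
    | .kAdd => fun x : Fin 2 → K => (x 0 + x 1 : K)
    | .kMul => fun x : Fin 2 → K => (x 0 * x 1 : K)
    | .mZero => fun _ => (0 : M)
    | .mAdd => fun x : Fin 2 → M => (x 0 + x 1 : M)
    | .smul => fun x => ((show K from x (.inl ())) • (show M from x (.inr ())) : M)
    | .pi i => fun x : Fin i × Fin i → K => rowSpan fun a b => x (a, b)
    | .D i => fun x : Fin i → M => relations K x
    | .T j => fun x : Unit → M => ((X j : MvPolynomial (Fin n) K) • x () : M)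
  rel P x := ∃ X : (j : Fin P.1.m) → Fin (P.1.k j) → Fin (P.1.k j) → K,
    P.1.Holds K X (fun i => x (.inr i)) ∧ ∀ j, rowSpan (X j) = x (.inl j)

variable [h : IsScalarTower K (MvPolynomial (Fin n) K) M]

/-- The model given by a module. -/
noncomputable def stdMdl : Mdl.{u} n Φ where
  N := stdStruc n Φ K M
  fld := fK
  acg := aM
  mod := mM
  pmod := pM
  core := @Core.mk n Φ (stdStruc n Φ K M) fK aM mM pM h rfl rfl (fun _ _ => rfl) (fun _ _ => rfl)
    rfl (fun _ _ => rfl) (fun _ _ => rfl) (fun _ _ => rfl)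

theorem stdMdl_isGrass {I : Ideal (MvPolynomial (Fin n) ℤ)}
    (hI : ∀ p ∈ I, ∀ v : M, map (Int.castRingHom K) p • v = 0) :
    (stdMdl n Φ K M).IsGrass I where
  kill := hI
  pi_surjective i V := exists_rowSpan_eq V
  pi_eq_iff i X Y := Iff.rfl
  pred_iff P p y := Iff.rfl
  d_eq i v X h := h

end Std

end GrassModule

/-! ### Amalgamation inside ultrapowers. -/

namespace GrassModule

open MSLanguage MvPolynomial

variable {n : ℕ} {Φ : Set PartFormula}

/-! ### Ultrapowers of models -/

/-- An elementary extension consisting of germs along an ultrafilter. -/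
structure GermExt (A A' : Mdl.{u} n Φ) {ι : Type u} (U : Ultrafilter ι) where
  j : Embedding A.N A'.N
  elem : Elementary A.N A'.N j.toFun
  kg : (ι → A.K) →+* A'.K
  mg : (ι → A.M) →+ A'.M
  kg_surjective : Function.Surjective kg
  kg_eq_iff : ∀ c d, kg c = kg d ↔ ∀ᶠ i in (U : Filter ι), c i = d i
  mg_eq_iff : ∀ v w, mg v = mg w ↔ ∀ᶠ i in (U : Filter ι), v i = w i
  mg_smul : ∀ c v, mg (fun i => c i • v i) = kg c • mg v
  mg_X_smul : ∀ (k : Fin n) v, mg (fun i => (X k : MvPolynomial (Fin n) A.K) • v i) =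
    (X k : MvPolynomial (Fin n) A'.K) • mg v
  kg_const : ∀ x, embRingHom j x = kg fun _ => x
  mg_const : ∀ v, embAddHom j v = mg fun _ => v

/-- By Łoś's theorem and elementarity of the class, the ultrapower is again big. The remaining work
is to check that taking germs respects the algebraic operations. -/
theorem Mdl.IsBig.exists_germExt {I : Ideal (MvPolynomial (Fin n) ℤ)} {A : Mdl.{u} n Φ}
    (hA : A.IsBig I) {ι : Type u} (U : Ultrafilter ι) :
    ∃ A' : Mdl.{u} n Φ, A'.IsBig I ∧ Nonempty (GermExt A A' U) := by
  obtain ⟨T, hT⟩ := elem_isBig.{u} (Φ := Φ) I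
  -- The algebraic structure on the ultrapower is supplied abstractly by `isBig_iff`; `core`
  -- identifies it with the interpreted symbols, and hence with operations on germs.
  obtain ⟨⟨N, core⟩, h, hbig⟩ := isBig_iff.1 ((hT _).1 ((elementary_diagUP (N := A.N) (U := U)).models
    ((hT _).2 (isBig_iff.2 ⟨A, rfl, hA⟩))))
  change N = A.N.ultrapower U at h
  subst h
  refine ⟨_, hbig, ⟨?_⟩⟩
  refine
    { j := embUP A.N U
      elem := elementary_diagUP
      kg :=
        { toFun := fun g => A.N.mkUP U (s := GSort.K) g
          map_one' := ?_
          map_mul' := ?_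
          map_zero' := ?_
          map_add' := ?_ }
      mg :=
        { toFun := fun g => A.N.mkUP U (s := GSort.M) g
          map_zero' := ?_
          map_add' := ?_ }
      kg_surjective := fun x => exists_mkUP x
      kg_eq_iff := fun c d => mkUP_eq_iff
      mg_eq_iff := fun c d => mkUP_eq_iff
      mg_smul := ?_
      mg_X_smul := ?_
      kg_const := fun _ => rfl
      mg_const := fun _ => rfl }
  · refine Eq.trans (congrArg _ (_root_.funext fun i => A.core.kOne_eq.symm.trans
      (fn_kOne A.N (fun a => (Empty.elim a : ι → A.K) i)).symm)) ?_
    exact (fn_mkUP (N := A.N) (U := U) GFn.kOne fun a => Empty.elim a).symm.trans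
      ((fn_kOne _ _).trans core.kOne_eq)
  · intro c d
    refine Eq.trans (congrArg _ (_root_.funext fun i => (A.core.kMul_eq (c i) (d i)).symm.trans
      (fn_kMul A.N (fun a : Fin 2 => (![c, d] : Fin 2 → ι → A.K) a i)).symm)) ?_
    exact (fn_mkUP (N := A.N) (U := U) GFn.kMul (![c, d] : Fin 2 → ι → A.K)).symm.trans
      ((fn_kMul _ fun a : Fin 2 => A.N.mkUP U (s := GSort.K)
        ((![c, d] : Fin 2 → ι → A.K) a)).trans (core.kMul_eq _ _))
  · refine Eq.trans (congrArg _ (_root_.funext fun i => A.core.kZero_eq.symm.trans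
      (fn_kZero A.N (fun a => (Empty.elim a : ι → A.K) i)).symm)) ?_
    exact (fn_mkUP (N := A.N) (U := U) GFn.kZero fun a => Empty.elim a).symm.trans
      ((fn_kZero _ _).trans core.kZero_eq)
  · intro c d
    refine Eq.trans (congrArg _ (_root_.funext fun i => (A.core.kAdd_eq (c i) (d i)).symm.trans
      (fn_kAdd A.N (fun a : Fin 2 => (![c, d] : Fin 2 → ι → A.K) a i)).symm)) ?_
    exact (fn_mkUP (N := A.N) (U := U) GFn.kAdd (![c, d] : Fin 2 → ι → A.K)).symm.trans
      ((fn_kAdd _ fun a : Fin 2 => A.N.mkUP U (s := GSort.K)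
        ((![c, d] : Fin 2 → ι → A.K) a)).trans (core.kAdd_eq _ _))
  · refine Eq.trans (congrArg _ (_root_.funext fun i => A.core.mZero_eq.symm.trans
      (fn_mZero A.N (fun a => (Empty.elim a : ι → A.M) i)).symm)) ?_
    exact (fn_mkUP (N := A.N) (U := U) GFn.mZero fun a => Empty.elim a).symm.trans
      ((fn_mZero _ _).trans core.mZero_eq)
  · intro c d
    refine Eq.trans (congrArg _ (_root_.funext fun i => (A.core.mAdd_eq (c i) (d i)).symm.trans
      (fn_mAdd A.N (fun a : Fin 2 => (![c, d] : Fin 2 → ι → A.M) a i)).symm)) ?_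
    exact (fn_mkUP (N := A.N) (U := U) GFn.mAdd (![c, d] : Fin 2 → ι → A.M)).symm.trans
      ((fn_mAdd _ fun a : Fin 2 => A.N.mkUP U (s := GSort.M)
        ((![c, d] : Fin 2 → ι → A.M) a)).trans (core.mAdd_eq _ _))
  · intro c v
    let x : (a : Unit ⊕ Unit) → ι → A.N.carrier (Sum.elim (fun _ => GSort.K) (fun _ => GSort.M) a) :=
      fun a => match a with
        | .inl _ => c
        | .inr _ => v
    refine Eq.trans (congrArg _ (_root_.funext fun i => (A.core.smul_eq (c i) (v i)).symm.trans
      (fn_smul A.N (fun a => x a i)).symm)) ?_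
    exact (fn_mkUP (N := A.N) (U := U) GFn.smul x).symm.trans
      ((fn_smul _ fun a => A.N.mkUP U (x a)).trans (core.smul_eq _ _))
  · intro k v
    refine Eq.trans (congrArg _ (_root_.funext fun i => (A.core.t_eq k (v i)).symm)) ?_
    exact (fn_mkUP (N := A.N) (U := U) (GFn.T k) fun _ => v).symm.trans
      ((fn_T _ k fun _ => A.N.mkUP U (s := GSort.M) v).trans (core.t_eq _ _))

theorem GermExt.mg_smul_map {A A' : Mdl.{u} n Φ} {ι : Type u} {U : Ultrafilter ι}
    (G : GermExt A A' U) (p : MvPolynomial (Fin n) A.K) (v : ι → A.M) :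
    G.mg (fun i => p • v i) = map (embRingHom G.j) p • G.mg v := by
  refine map_poly_smul (M := ι → A.M) (embRingHom G.j) G.mg (fun c v => ?_) (fun j v => ?_) p v
  · rw [G.kg_const, ← G.mg_smul]
    rfl
  · exact G.mg_X_smul j v

/-! ### Extending field homomorphisms into ultrapowers -/

/-- The subalgebra generated by the finite set S maps to K₂ over K₀; off this subalgebra the map is
0, so it need only respect operations on S. -/
theorem exists_partial_homs {K₀ K₁ K₂ : Type*} [Field K₀] [Field K₁] [Field K₂] [IsAlgClosed K₂]
    (σ₁ : K₀ →+* K₁) (σ₂ : K₀ →+* K₂) (S : Finset K₁) : ∃ f : K₁ → K₂, (∀ c, f (σ₁ c) = σ₂ c) ∧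
      (∀ x ∈ S, ∀ y ∈ S, f (x + y) = f x + f y) ∧ ∀ x ∈ S, ∀ y ∈ S, f (x * y) = f x * f y := by
  classical
  let := σ₁.toAlgebra
  let := σ₂.toAlgebra
  let R := Algebra.adjoin K₀ (S : Set K₁)
  obtain ⟨ψ⟩ := exists_algHom_of_finiteType (K := K₀) (R := R) (L := K₂)
    (R.fg_iff_finiteType.1 ⟨S, rfl⟩)
  have hS : ∀ x ∈ S, x ∈ R := fun x hx => Algebra.subset_adjoin hx
  let f : K₁ → K₂ := fun x => if h : x ∈ R then ψ ⟨x, h⟩ else 0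
  have hf : ∀ x (h : x ∈ R), f x = ψ ⟨x, h⟩ := fun x h => dif_pos h
  refine ⟨f, fun c => ?_, fun x hx y hy => ?_, fun x hx y hy => ?_⟩
  · exact (hf _ (R.algebraMap_mem c)).trans (ψ.commutes c)
  · rw [hf x (hS x hx), hf y (hS y hy), hf _ (R.add_mem (hS x hx) (hS y hy)), ← map_add]
    rfl
  · rw [hf x (hS x hx), hf y (hS y hy), hf _ (R.mul_mem (hS x hx) (hS y hy)), ← map_mul]
    rfl

theorem exists_ultrafilter_finset (α : Type u) :
    ∃ U : Ultrafilter (Finset α), ∀ x, ∀ᶠ S in (U : Filter (Finset α)), x ∈ S := by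
  classical
  refine ⟨Ultrafilter.of Filter.atTop, fun x => Ultrafilter.of_le _ ?_⟩
  exact (Filter.eventually_ge_atTop {x}).mono fun S hS => hS (Finset.mem_singleton_self x)

/-- Two extensions of a field, the second one algebraically closed, can be amalgamated in an
ultrapower of the second. -/
theorem Mdl.IsBig.exists_amalgam {I : Ideal (MvPolynomial (Fin n) ℤ)} {A : Mdl.{u} n Φ}
    (hA : A.IsBig I) {K₀ K₁ : Type u} [Field K₀] [Field K₁] (σ₁ : K₀ →+* K₁) (σ₂ : K₀ →+* A.K) :
    ∃ A' : Mdl.{u} n Φ, A'.IsBig I ∧ ∃ j : Embedding A.N A'.N, Elementary A.N A'.N j.toFun ∧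
      ∃ τ : K₁ →+* A'.K, τ.comp σ₁ = (embRingHom j).comp σ₂ := by
  obtain ⟨U, hU⟩ := exists_ultrafilter_finset K₁
  obtain ⟨A', hA', ⟨G⟩⟩ := hA.exists_germExt U
  have := hA.closed
  -- Every identity to be checked involves at most two elements, which belong to almost all finite
  -- sets S; so the partial homomorphisms glue to a ring homomorphism on germs.
  choose f h1 h2 h3 using exists_partial_homs σ₁ σ₂
  refine ⟨A', hA', G.j, G.elem,
    { toFun := fun x => G.kg fun S => f S x
      map_one' := ?_
      map_mul' := fun x y => ?_
      map_zero' := ?_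
      map_add' := fun x y => ?_ }, ?_⟩
  · rw [← map_one σ₁, ← map_one G.kg]
    congr 1
    funext S
    rw [h1, map_one]
    rfl
  · rw [← map_mul, G.kg_eq_iff]
    filter_upwards [hU x, hU y] with S hx hy using h3 S x hx y hy
  · rw [← map_zero σ₁, ← map_zero G.kg]
    congr 1
    funext S
    rw [h1, map_zero]
    rfl
  · rw [← map_add, G.kg_eq_iff]
    filter_upwards [hU x, hU y] with S hx hy using h2 S x hx y hy
  · ext c
    change G.kg _ = embRingHom G.j (σ₂ c)
    rw [G.kg_const]
    congr 1
    funext S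
    exact h1 S c

end GrassModule

namespace GrassModule

open MSLanguage MvPolynomial

/-! ### Extension of scalars inside a module -/

section ScalarExtension

variable {n : ℕ} {K₀ K₁ K₂ M₀ M₁ M₂ : Type*} [Field K₀] [Field K₁] [Field K₂] [AddCommGroup M₀]
  [AddCommGroup M₁] [AddCommGroup M₂] [Module K₀ M₀] [Module K₁ M₁] [Module K₂ M₂]
  [Module (MvPolynomial (Fin n) K₀) M₀] [Module (MvPolynomial (Fin n) K₁) M₁]
  [Module (MvPolynomial (Fin n) K₂) M₂] [IsScalarTower K₁ (MvPolynomial (Fin n) K₁) M₁]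
  [IsScalarTower K₂ (MvPolynomial (Fin n) K₂) M₂]

theorem smul_mem_of_X_smul_mem {V : Submodule K₁ M₁}
    (hV : ∀ (j : Fin n), ∀ v ∈ V, (X j : MvPolynomial (Fin n) K₁) • v ∈ V)
    (p : MvPolynomial (Fin n) K₁) {v : M₁} (hv : v ∈ V) : p • v ∈ V := by
  induction p using MvPolynomial.induction_on generalizing v with
  | C c =>
    rw [C_smul_eq]
    exact V.smul_mem c hv
  | add p q hp hq =>
    rw [add_smul]
    exact V.add_mem (hp hv) (hq hv)
  | mul_X p j hp =>
    rw [mul_smul]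
    exact hp (hV j v hv)

/-- The submodule over the polynomial ring given by a subspace closed under the variables. -/
def submoduleOfXSMul (V : Submodule K₁ M₁)
    (hV : ∀ (j : Fin n), ∀ v ∈ V, (X j : MvPolynomial (Fin n) K₁) • v ∈ V) :
    Submodule (MvPolynomial (Fin n) K₁) M₁ where
  carrier := V
  add_mem' := V.add_mem
  zero_mem' := V.zero_mem
  smul_mem' p _ hv := smul_mem_of_X_smul_mem hV p hv

theorem span_range_eq_top_of_coe {Q : Submodule (MvPolynomial (Fin n) K₁) M₁} {ι : Type*}
    {g : ι → Q} (h : ∀ q ∈ Q, q ∈ Submodule.span K₁ (Set.range fun i => (g i : M₁))) :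
    Submodule.span K₁ (Set.range g) = ⊤ := by
  refine top_unique ?_
  rintro ⟨q, hq⟩ -
  have h3 := h q hq
  have h4 : (Set.range fun i => (g i : M₁)) = (Q.restrictScalars K₁).subtype '' Set.range g :=
    Set.range_comp (Q.restrictScalars K₁).subtype g
  rw [h4, ← Submodule.map_span] at h3
  obtain ⟨q', h5, h6⟩ := h3
  obtain rfl : q' = ⟨q, hq⟩ := Subtype.ext h6
  exact h5

/-- A K₀-basis of M₀ becomes a K₁-basis of Q, the K₁-span of ε₁(M₀), because ε₁ preserves
independence. Thus Q is K₁ ⊗ M₀, and ε₂ extends to it. As ε₂ preserves independence as well, so does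
the extension. -/
theorem exists_scalar_extension {σ₁ : K₀ →+* K₁} {σ₂ : K₀ →+* K₂} {ε₁ : M₀ →+ M₁} {ε₂ : M₀ →+ M₂}
    (h₁ : LinExt σ₁ ε₁) (h₂ : LinExt σ₂ ε₂)
    (hX₁ : ∀ j v, ε₁ ((X j : MvPolynomial (Fin n) K₀) • v) =
      (X j : MvPolynomial (Fin n) K₁) • ε₁ v)
    (hX₂ : ∀ j v, ε₂ ((X j : MvPolynomial (Fin n) K₀) • v) =
      (X j : MvPolynomial (Fin n) K₂) • ε₂ v)
    {τ : K₁ →+* K₂} (hτ : τ.comp σ₁ = σ₂) :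
    ∃ (Q : Submodule (MvPolynomial (Fin n) K₁) M₁) (E : Q →+ M₂), LinExt τ E ∧
      (∀ (j : Fin n) q, E ((X j : MvPolynomial (Fin n) K₁) • q) =
        (X j : MvPolynomial (Fin n) K₂) • E q) ∧
      ∀ v, ∃ h : ε₁ v ∈ Q, E ⟨ε₁ v, h⟩ = ε₂ v := by
  have hV : ∀ (j : Fin n), ∀ v ∈ Submodule.span K₁ (Set.range ε₁),
      (X j : MvPolynomial (Fin n) K₁) • v ∈ Submodule.span K₁ (Set.range ε₁) := by
    intro j v hv
    induction hv using Submodule.span_induction with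
    | mem v hv =>
      obtain ⟨w, rfl⟩ := hv
      rw [← hX₁]
      exact Submodule.subset_span ⟨_, rfl⟩
    | zero => rw [smul_zero]; exact Submodule.zero_mem _
    | add v w _ _ h h' => rw [smul_add]; exact Submodule.add_mem _ h h'
    | smul c v _ h =>
      rw [← C_smul_eq (n := n) c v, smul_comm, C_smul_eq]
      exact Submodule.smul_mem _ c h
  let Q := submoduleOfXSMul _ hV
  have hQ : ∀ v, ε₁ v ∈ Q := fun v => Submodule.subset_span (s := Set.range ε₁) ⟨v, rfl⟩
  let b := Module.Basis.ofVectorSpace K₀ M₀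
  have hεspan : ∀ v, ε₁ v ∈ Submodule.span K₁ (Set.range fun i => ε₁ (b i)) := by
    intro v
    have hv : v ∈ Submodule.span K₀ (Set.range b) := b.span_eq ▸ Submodule.mem_top
    induction hv using Submodule.span_induction with
    | mem v hv =>
      obtain ⟨i, rfl⟩ := hv
      exact Submodule.subset_span ⟨i, rfl⟩
    | zero => rw [map_zero]; exact Submodule.zero_mem _
    | add v w _ _ h h' => rw [map_add]; exact Submodule.add_mem _ h h'
    | smul c v _ h => rw [h₁.smul]; exact Submodule.smul_mem _ _ h
  let g : _ → Q := fun i => ⟨ε₁ (b i), hQ _⟩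
  have hgli : LinearIndependent K₁ g := by
    refine LinearIndependent.of_comp ((Q.restrictScalars K₁).subtype) ?_
    exact h₁.linearIndependent b.linearIndependent
  have hgspan : ⊤ ≤ Submodule.span K₁ (Set.range g) := by
    refine (span_range_eq_top_of_coe fun q hq => ?_).ge
    refine (Submodule.span_le.2 ?_) (show q ∈ Submodule.span K₁ (Set.range ε₁) from hq)
    rintro _ ⟨v, rfl⟩
    exact hεspan v
  let B := Module.Basis.mk hgli hgspan
  let : Module K₁ M₂ := Module.compHom M₂ τ
  let E : Q →ₗ[K₁] M₂ := B.constr ℕ fun i => ε₂ (b i)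
  have hEg : ∀ i, E (g i) = ε₂ (b i) := fun i => by
    rw [← B.constr_basis ℕ (fun i => ε₂ (b i)) i, Module.Basis.mk_apply]
  have hEsmul : ∀ c q, E.toAddMonoidHom (c • q) = τ c • E.toAddMonoidHom q :=
    fun c q => E.map_smul c q
  have hEε : ∀ v, E ⟨ε₁ v, hQ v⟩ = ε₂ v := by
    intro v
    have hv : v ∈ Submodule.span K₀ (Set.range b) := b.span_eq ▸ Submodule.mem_top
    induction hv using Submodule.span_induction with
    | mem v hv =>
      obtain ⟨i, rfl⟩ := hv
      exact hEg i
    | zero =>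
      have h0 : (⟨ε₁ 0, hQ 0⟩ : Q) = 0 := Subtype.ext (map_zero ε₁)
      rw [h0, map_zero, map_zero]
    | add v w _ _ h h' =>
      have h0 : (⟨ε₁ (v + w), hQ _⟩ : Q) = ⟨ε₁ v, hQ v⟩ + ⟨ε₁ w, hQ w⟩ :=
        Subtype.ext (map_add ε₁ v w)
      rw [h0, map_add, map_add, h, h']
    | smul c v _ h =>
      rw [h₂.smul, ← h, ← hτ]
      refine Eq.trans ?_ (hEsmul (σ₁ c) _)
      refine congrArg E ?_
      exact Subtype.ext (h₁.smul c v)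
  refine ⟨Q, E.toAddMonoidHom, linExt_of_basis B hEsmul ?_, ?_, fun v => ⟨hQ v, hEε v⟩⟩
  · have : (fun i => E.toAddMonoidHom (B i)) = fun i => ε₂ (b i) := by
      ext i
      rw [Module.Basis.mk_apply]
      exact hEg i
    rw [this]
    exact h₂.linearIndependent b.linearIndependent
  · intro j q
    have hq : q ∈ Submodule.span K₁ (Set.range g) := hgspan Submodule.mem_top
    induction hq using Submodule.span_induction with
    | mem q hq =>
      obtain ⟨i, rfl⟩ := hq
      have : (X j : MvPolynomial (Fin n) K₁) • g i =
          ⟨ε₁ ((X j : MvPolynomial (Fin n) K₀) • b i), hQ _⟩ := Subtype.ext (hX₁ j _).symm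
      rw [this]
      exact (hEε _).trans ((hX₂ j _).trans (congrArg _ (hEg i).symm))
    | zero => rw [smul_zero, map_zero, smul_zero]
    | add v w _ _ h h' => rw [smul_add, map_add, h, h', map_add, smul_add]
    | smul c v _ h =>
      have : (X j : MvPolynomial (Fin n) K₁) • c • v = c • (X j : MvPolynomial (Fin n) K₁) • v := by
        ext
        exact (smul_comm (X j : MvPolynomial (Fin n) K₁) c (v : M₁))
      rw [this, hEsmul, h, hEsmul, ← C_smul_eq (n := n) (τ c), smul_comm, C_smul_eq]

end ScalarExtension

/-! ### Spaces of linear maps of infinite rank -/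

section Amitsur

variable {K E V : Type*} [Field K] [Infinite K] [AddCommGroup E] [Module K E] [AddCommGroup V]
  [Module K V]

/-- Composing with a left inverse of the independent family a, a dependence at μ becomes an
eigenvector with eigenvalue μ of a fixed endomorphism of K^m. Only finitely many μ are excluded. -/
theorem exists_linearIndependent_smul_add {m : ℕ} {a : Fin m → V} (ha : LinearIndependent K a)
    (b : Fin m → V) : ∃ μ : K, μ ≠ 0 ∧ LinearIndependent K fun i => μ • a i + b i := by
  obtain ⟨L, hL⟩ := (Fintype.linearCombination K a).exists_leftInverse_of_injective
    (LinearMap.ker_eq_bot.2 (linearIndependent_iff_injective_fintypeLinearCombination.1 ha))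
  let B : Module.End K (Fin m → K) := L ∘ₗ Fintype.linearCombination K b
  obtain ⟨μ, hμ⟩ := ((Module.End.finite_hasEigenvalue (-B)).union (Set.finite_singleton 0)).exists_notMem
  simp only [Set.mem_union, Set.mem_singleton_iff, not_or] at hμ
  refine ⟨μ, hμ.2, Fintype.linearIndependent_iff.2 fun c hc => ?_⟩
  have h1 : μ • Fintype.linearCombination K a c + Fintype.linearCombination K b c = 0 := by
    rw [← hc, Fintype.linearCombination_apply, Fintype.linearCombination_apply, Finset.smul_sum,
      ← Finset.sum_add_distrib]
    exact Finset.sum_congr rfl fun i _ => by rw [smul_add, smul_comm]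
  have h2 : μ • c + B c = 0 := by
    have := congrArg L h1
    rw [map_add, map_smul, map_zero] at this
    rwa [← LinearMap.comp_apply, hL] at this
  by_contra hne
  refine hμ.1 (Module.End.hasEigenvalue_of_hasEigenvector (x := c) ⟨?_, fun h0 => hne fun i => ?_⟩)
  · rw [Module.End.mem_eigenspace_iff, LinearMap.neg_apply]
    exact (eq_neg_of_add_eq_zero_left h2).symm
  · rw [h0, Pi.zero_apply]

/-- If all nonzero linear combinations of the maps have infinite rank, then the maps have linearly
independent values at some point. -/
theorem exists_linearIndependent_apply {m : ℕ} (T : Fin m → E →ₗ[K] V)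
    (hT : ∀ c : Fin m → K, c ≠ 0 → ∀ W : Submodule K V, FiniteDimensional K W →
      ∃ s, ∑ i, c i • T i s ∉ W) : ∃ s, LinearIndependent K fun i => T i s := by
  induction m with
  | zero => exact ⟨0, linearIndependent_empty_type⟩
  | succ m ih =>
    obtain ⟨y, hy⟩ := ih (fun i => T i.succ) fun c hc W hW => by
      obtain ⟨s, hs⟩ := hT (Fin.cons 0 c) (fun h0 => hc (by
        ext i
        simpa using congrFun h0 i.succ)) W hW
      exact ⟨s, by simpa [Fin.sum_univ_succ] using hs⟩
    by_cases h0 : T 0 y ∈ Submodule.span K (Set.range fun i : Fin m => T i.succ y)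
    -- The map T₀ - ∑ a_i T_i vanishes at y and has infinite rank, so it sends some z outside the
    -- span of the T_i y. A point μy + z with suitable μ keeps the T_i independent and separates T₀
    -- from them.
    · obtain ⟨a, ha⟩ := (Submodule.mem_span_range_iff_exists_fun K).1 h0
      obtain ⟨z, hz⟩ := hT (Fin.cons 1 (-a)) (fun h => by simpa using congrFun h 0)
        (Submodule.span K (Set.range fun i : Fin m => T i.succ y))
        (FiniteDimensional.span_of_finite _ (Set.finite_range _))
      have hz' : T 0 z - ∑ i, a i • T i.succ z ∉
          Submodule.span K (Set.range fun i : Fin m => T i.succ y) := by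
        simpa [Fin.sum_univ_succ, sub_eq_add_neg] using hz
      obtain ⟨μ, hμ, hli⟩ := exists_linearIndependent_smul_add
        (linearIndependent_finCons.2 ⟨hy, hz'⟩) (Fin.cons 0 fun i => T i.succ z)
      refine ⟨μ • y + z, ?_⟩
      rw [linearIndependent_finSucc] at hli ⊢
      simp only [Fin.cons_zero, Fin.cons_succ, add_zero, Fin.tail_def] at hli ⊢
      have hsucc : ∀ i : Fin m, T i.succ (μ • y + z) = μ • T i.succ y + T i.succ z := fun i => by
        rw [map_add, map_smul]
      simp only [hsucc]
      refine ⟨hli.1, fun hmem => hli.2 (Submodule.smul_mem _ _ ?_)⟩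
      have : T 0 z - ∑ i, a i • T i.succ z =
          T 0 (μ • y + z) - ∑ i, a i • (μ • T i.succ y + T i.succ z) := by
        rw [map_add, map_smul, ← ha, Finset.smul_sum]
        simp only [smul_add, Finset.sum_add_distrib]
        have : ∀ i, a i • μ • T i.succ y = μ • a i • T i.succ y := fun i => smul_comm _ _ _
        simp only [this]
        abel
      rw [this]
      exact Submodule.sub_mem _ hmem (Submodule.sum_mem _ fun i _ =>
        Submodule.smul_mem _ _ (Submodule.subset_span ⟨i, rfl⟩))
    · exact ⟨y, linearIndependent_finSucc.2 ⟨hy, h0⟩⟩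

end Amitsur

end GrassModule

namespace GrassModule

open MSLanguage MvPolynomial

/-! ### Solutions with linearly independent values -/

section Star

variable {n : ℕ} {K M : Type*} [Field K] [Infinite K] [AddCommGroup M] [Module K M]
  [Module (MvPolynomial (Fin n) K) M] [IsScalarTower K (MvPolynomial (Fin n) K) M]

/-- The action of a polynomial as a linear map. -/
noncomputable def polyEnd (p : MvPolynomial (Fin n) K) : M →ₗ[K] M where
  toFun v := p • v
  map_add' := smul_add p
  map_smul' c v := smul_comm p c v

theorem sum_smul_smul {α : Type*} (s : Finset α) (c : α → K) (w : α → MvPolynomial (Fin n) K)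
    (x : M) : (∑ i ∈ s, c i • w i) • x = ∑ i ∈ s, c i • w i • x := by
  rw [Finset.sum_smul]
  exact Finset.sum_congr rfl fun i _ => smul_assoc _ _ _

/-- Fix a solution x₀ and vary it by the space S of solutions of the homogeneous system. The
solvability axiom for a single polynomial makes every nontrivial combination of the w_i act on S
with infinite rank, so `exists_linearIndependent_apply` gives an s at which all w_i are independent.
-/
theorem FSolvable.exists_independent {I : Ideal (MvPolynomial (Fin n) ℤ)} (H : FSolvable I K M)
    {F : Submodule (MvPolynomial (Fin n) K) (MvPolynomial (Fin n) K × M)}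
    (hF : ∀ y, (0, y) ∈ F → y = 0) (hI : ∀ p ∈ I, (map (Int.castRingHom K) p, 0) ∈ F)
    {α : Type*} [Fintype α] (w : α → MvPolynomial (Fin n) K)
    (hw : ∀ (c : α → K) (y : M), (∑ i, c i • w i, y) ∈ F → ∀ i, c i = 0)
    (U : Submodule K M) [FiniteDimensional K U] :
    ∃ x : M, (∀ f y, (f, y) ∈ F → f • x = y) ∧
      ∀ c : α → K, ∑ i, c i • w i • x ∈ U → ∀ i, c i = 0 := by
  obtain ⟨x₀, hx₀, -⟩ := H F hF hI 0 Fin.elim0 Fin.elim0 (fun j => j.elim0) (fun j => j.elim0)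
  let S : Submodule K M :=
    { carrier := {s | ∀ f y, (f, y) ∈ F → f • s = 0}
      zero_mem' := fun f y _ => smul_zero f
      add_mem' := fun {a b} ha hb f y h => by rw [smul_add, ha f y h, hb f y h, add_zero]
      smul_mem' := fun c s hs f y h => by rw [smul_comm, hs f y h, smul_zero] }
  -- Working modulo the vectors w_i x₀ as well makes the shift from s to x₀ + s harmless.
  let W : Submodule K M := U ⊔ Submodule.span K (Set.range fun i => w i • x₀)
  have hWx : ∀ i, w i • x₀ ∈ W := fun i =>
    Submodule.mem_sup_right (Submodule.subset_span ⟨i, rfl⟩)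
  have : FiniteDimensional K (Submodule.span K (Set.range fun i => w i • x₀)) :=
    FiniteDimensional.span_of_finite _ (Set.finite_range _)
  have hWfd : FiniteDimensional K W := Submodule.finiteDimensional_sup _ _
  let e := Fintype.equivFin α
  obtain ⟨s, hs⟩ := exists_linearIndependent_apply
    (fun i => W.mkQ ∘ₗ polyEnd (w (e.symm i)) ∘ₗ S.subtype) fun c hc W' hW' => by
      have hfd : FiniteDimensional K (W'.comap W.mkQ) := by
        refine Module.Finite.iff_fg.2 (Submodule.fg_of_fg_map_of_fg_inf_ker W.mkQ ?_ ?_)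
        · have := Submodule.finiteDimensional_of_le (Submodule.map_comap_le W.mkQ W')
          exact Module.Finite.iff_fg.1 this
        · have : FiniteDimensional K (W'.comap W.mkQ ⊓ LinearMap.ker W.mkQ : Submodule K M) := by
            refine Submodule.finiteDimensional_of_le (S₂ := W) ?_
            rw [Submodule.ker_mkQ]
            exact inf_le_right
          exact Module.Finite.iff_fg.1 this
      -- The homogeneous system keeps the first coordinates of F and sets all values to 0; the
      -- combination of the w_i is its only inequation.
      obtain ⟨s, hs, hs'⟩ := H ((F.map (LinearMap.fst _ _ _)).prod ⊥) (fun y hy => hy.2)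
        (fun p hp => ⟨⟨_, hI p hp, rfl⟩, rfl⟩) 1 (fun _ => ∑ i, c i • w (e.symm i))
        (fun _ => W'.comap W.mkQ) (fun _ => hfd) (by
          rintro - y ⟨⟨⟨f', y'⟩, h1, h2⟩, -⟩
          obtain rfl : f' = ∑ i, c i • w (e.symm i) := h2
          refine hc ?_
          ext i
          rw [← e.sum_comp] at h1
          simpa using hw (fun a => c (e a)) y' (by simpa using h1) (e.symm i))
      refine ⟨⟨s, fun f y h => hs f 0 ⟨⟨_, h, rfl⟩, rfl⟩⟩, fun hmem => hs' 0 ?_⟩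
      rw [Submodule.mem_comap, sum_smul_smul, map_sum]
      simpa [polyEnd] using hmem
  refine ⟨x₀ + s, fun f y h => ?_, fun c hc i => ?_⟩
  · rw [smul_add, hx₀ f y h, s.2 f y h, add_zero]
  · have h1 : ∑ i, c i • w i • (s : M) ∈ W := by
      have : ∑ i, c i • w i • (s : M) =
          ∑ i, c i • w i • (x₀ + s) - ∑ i, c i • w i • x₀ := by
        simp only [smul_add, Finset.sum_add_distrib]
        abel
      rw [this]
      exact Submodule.sub_mem _ (Submodule.mem_sup_left hc)
        (Submodule.sum_mem _ fun i _ => Submodule.smul_mem _ _ (hWx i))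
    have h2 := Fintype.linearIndependent_iff.1 hs (fun i => c (e.symm i)) (by
      rw [← Submodule.ker_mkQ W, LinearMap.mem_ker, map_sum, ← e.symm.sum_comp] at h1
      simpa [polyEnd] using h1) (e i)
    simpa using h2

end Star

end GrassModule

namespace GrassModule

open MSLanguage MvPolynomial

variable {n : ℕ} {Φ : Set PartFormula}

/-! ### Extending a map by one element -/

section Functional

variable {K₁ : Type u} {K₂ M₁ M₂ : Type*} [Field K₁] [Field K₂] [AddCommGroup M₁]
  [AddCommGroup M₂] [Module K₁ M₁] [Module K₂ M₂]
  [Module (MvPolynomial (Fin n) K₁) M₁]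
  [Module (MvPolynomial (Fin n) K₂) M₂] [IsScalarTower K₁ (MvPolynomial (Fin n) K₁) M₁]
  [IsScalarTower K₂ (MvPolynomial (Fin n) K₂) M₂]
  (τ : K₁ →+* K₂) {Q : Submodule (MvPolynomial (Fin n) K₁) M₁} (E : Q →+ M₂)

/-- The ideal of polynomials mapping an element into a submodule. -/
noncomputable def conductor (Q : Submodule (MvPolynomial (Fin n) K₁) M₁) (x : M₁) :
    Ideal (MvPolynomial (Fin n) K₁) :=
  Q.comap (LinearMap.toSpanSingleton _ M₁ x)

/-- The system of equations that the image of an element has to satisfy. -/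
noncomputable def imageSystem (x : M₁) :
    Submodule (MvPolynomial (Fin n) K₂) (MvPolynomial (Fin n) K₂ × M₂) :=
  Submodule.span _ (Set.range fun f : conductor Q x => (map τ f.1, E ⟨f.1 • x, f.2⟩))

variable {τ E} (hE : LinExt τ E) (hX : ∀ (j : Fin n) q, E ((X j : MvPolynomial (Fin n) K₁) • q) =
  (X j : MvPolynomial (Fin n) K₂) • E q) {x : M₁}

include hE hX

/-- The K₂-span of the images of a basis is already closed under the variables, because the
conductor is an ideal and E commutes with the operators. -/
theorem mem_span_of_mem_imageSystem {ι : Type*} (b : Module.Basis ι K₁ (conductor Q x))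
    {w : MvPolynomial (Fin n) K₂ × M₂} (hw : w ∈ imageSystem τ E x) :
    w ∈ Submodule.span K₂ (Set.range fun i => (map τ (b i).1, E ⟨(b i).1 • x, (b i).2⟩)) := by
  set V := Submodule.span K₂ (Set.range fun i => (map τ (b i).1, E ⟨(b i).1 • x, (b i).2⟩)) with hVdef
  have hJ : ∀ f : conductor Q x, (map τ f.1, E ⟨f.1 • x, f.2⟩) ∈ V := by
    intro f
    have hf : f ∈ Submodule.span K₁ (Set.range b) := b.span_eq ▸ Submodule.mem_top
    induction hf using Submodule.span_induction with
    | mem f hf =>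
      obtain ⟨i, rfl⟩ := hf
      exact Submodule.subset_span ⟨i, rfl⟩
    | zero =>
      have h0 : (map τ (0 : conductor Q x).1,
          E ⟨(0 : conductor Q x).1 • x, (0 : conductor Q x).2⟩) = 0 := by
        refine Prod.ext (map_zero _) ?_
        rw [Prod.snd_zero, ← map_zero E]
        exact congrArg E (Subtype.ext (zero_smul _ x))
      rw [h0]
      exact V.zero_mem
    | add f g _ _ h h' =>
      have h0 : (map τ (f + g).1, E ⟨(f + g).1 • x, (f + g).2⟩) =
          (map τ f.1, E ⟨f.1 • x, f.2⟩) + (map τ g.1, E ⟨g.1 • x, g.2⟩) := by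
        refine Prod.ext (map_add (map τ) f.1 g.1) ?_
        rw [Prod.snd_add, ← map_add E]
        exact congrArg E (Subtype.ext (add_smul f.1 g.1 x))
      rw [h0]
      exact V.add_mem h h'
    | smul c f _ h =>
      have h0 : (map τ (c • f).1, E ⟨(c • f).1 • x, (c • f).2⟩) =
          τ c • (map τ f.1, E ⟨f.1 • x, f.2⟩) := by
        refine Prod.ext ?_ ?_
        · exact (linExt_map τ (Fin n)).smul c f.1
        · rw [Prod.smul_snd, ← hE.smul]
          exact congrArg E (Subtype.ext (smul_assoc c f.1 x))
      rw [h0]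
      exact V.smul_mem _ h
  have hV : ∀ (j : Fin n), ∀ v ∈ V, (X j : MvPolynomial (Fin n) K₂) • v ∈ V := by
    intro j v hv
    induction hv using Submodule.span_induction with
    | mem v hv =>
      obtain ⟨i, rfl⟩ := hv
      have h0 : (X j : MvPolynomial (Fin n) K₂) • (map τ (b i).1, E ⟨(b i).1 • x, (b i).2⟩) =
          (map τ ((X j : MvPolynomial (Fin n) K₁) • b i).1,
            E ⟨((X j : MvPolynomial (Fin n) K₁) • b i).1 • x,
              ((X j : MvPolynomial (Fin n) K₁) • b i).2⟩) := by
        refine Prod.ext ?_ ?_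
        · simp
        · rw [Prod.smul_snd, ← hX]
          exact congrArg E (Subtype.ext (smul_assoc (X j) (b i).1 x).symm)
      beta_reduce
      rw [h0]
      exact hJ _
    | zero => rw [smul_zero]; exact Submodule.zero_mem _
    | add v w _ _ h h' => rw [smul_add]; exact Submodule.add_mem _ h h'
    | smul c v _ h =>
      rw [smul_comm]
      exact Submodule.smul_mem _ c h
  have : imageSystem τ E x ≤ submoduleOfXSMul V hV := by
    rw [imageSystem, Submodule.span_le]
    rintro _ ⟨f, rfl⟩
    exact hJ f
  exact this hw

/-- A K₁-basis of the conductor stays independent in K₂[T], so a vanishing first coordinate forces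
all coefficients to vanish. -/
theorem imageSystem_functional {y : M₂} (hy : (0, y) ∈ imageSystem τ E x) : y = 0 := by
  let b := Module.Basis.ofVectorSpace K₁ (conductor Q x)
  obtain ⟨c, hc⟩ := (Finsupp.mem_span_range_iff_exists_finsupp).1
    (mem_span_of_mem_imageSystem hE hX b hy)
  have hli : LinearIndependent K₂ fun i => map τ (b i).1 :=
    (linExt_map τ (Fin n)).linearIndependent (v := fun i => (b i).1)
      (b.linearIndependent.map' ((conductor Q x).restrictScalars K₁).subtype
        (Submodule.ker_subtype _))
  have h1 : c = 0 := by
    rw [linearIndependent_iff] at hli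
    refine hli c ?_
    have := congrArg Prod.fst hc
    rw [Finsupp.sum, Prod.fst_sum] at this
    rw [Finsupp.linearCombination_apply, Finsupp.sum]
    exact this
  rw [h1, Finsupp.sum_zero_index] at hc
  exact (congrArg Prod.snd hc).symm

/-- A family of polynomials complementing the conductor stays independent modulo the system. -/
theorem exists_complement (x : M₁) : ∃ (κ : Type u) (w : κ → MvPolynomial (Fin n) K₁),
    (∀ p, ∃ f ∈ conductor Q x, p - f ∈ Submodule.span K₁ (Set.range w)) ∧
    ∀ (s : Finset κ) (c : κ → K₂) (y : M₂),
      (∑ i ∈ s, c i • map τ (w i), y) ∈ imageSystem τ E x → ∀ i ∈ s, c i = 0 := by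
  let J := (conductor Q x).restrictScalars K₁
  let b := Module.Basis.ofVectorSpace K₁ J
  let B := Module.Basis.ofVectorSpace K₁ (MvPolynomial (Fin n) K₁ ⧸ J)
  choose w hw using fun i => J.mkQ_surjective (B i)
  refine ⟨_, w, fun p => ?_, fun s c y h => ?_⟩
  · have hp : J.mkQ p ∈ Submodule.span K₁ (Set.range B) := B.span_eq ▸ Submodule.mem_top
    obtain ⟨c, hc⟩ := (Finsupp.mem_span_range_iff_exists_finsupp).1 hp
    refine ⟨p - c.sum fun i r => r • w i, ?_, ?_⟩
    · have : J.mkQ (p - c.sum fun i r => r • w i) = 0 := by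
        rw [map_sub, map_finsuppSum, sub_eq_zero, ← hc]
        exact Finset.sum_congr rfl fun i _ => by beta_reduce; rw [map_smul, hw]
      rw [← LinearMap.mem_ker, Submodule.ker_mkQ] at this
      exact this
    · rw [sub_sub_cancel]
      exact Submodule.sum_mem _ fun i _ => Submodule.smul_mem _ _ (Submodule.subset_span ⟨i, rfl⟩)
  -- Lifts of a basis of K₁[T] modulo the conductor, joined to a basis of the conductor, are
  -- independent, and remain so over K₂.
  · have hli : LinearIndependent K₁ (Sum.elim (fun i => (b i : MvPolynomial (Fin n) K₁)) w) := by
      refine LinearIndependent.sumElim_of_quotient b.linearIndependent w ?_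
      have : (Submodule.Quotient.mk ∘ w : _ → MvPolynomial (Fin n) K₁ ⧸ J) = B := _root_.funext hw
      rw [this]
      exact B.linearIndependent
    have hli' := (linExt_map τ (Fin n)).linearIndependent hli
    obtain ⟨d, hd⟩ := (Finsupp.mem_span_range_iff_exists_finsupp).1
      (mem_span_of_mem_imageSystem hE hX b h)
    have h1 : ∑ i ∈ s, c i • map τ (w i) - ∑ i ∈ d.support, d i • map τ (b i).1 = 0 := by
      have := congrArg Prod.fst hd
      rw [Finsupp.sum, Prod.fst_sum] at this
      rw [sub_eq_zero]
      exact this.symm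
    rw [linearIndependent_iff'] at hli'
    intro i hi
    have h2 := hli' (d.support.disjSum s) (Sum.elim (fun i => -d i) c) (by
      rw [Finset.sum_disjSum]
      simp only [Sum.elim_inl, Sum.elim_inr, neg_smul, Finset.sum_neg_distrib]
      rw [neg_add_eq_sub]
      exact h1) (.inr i) (by simpa using hi)
    exact h2

end Functional

end GrassModule

/-! ### The extension step: adjoining one vector. -/

namespace GrassModule

open MSLanguage MvPolynomial

variable {n : ℕ} {Φ : Set PartFormula}

theorem GermExt.mg_sum {A A' : Mdl.{u} n Φ} {ι : Type u} {U : Ultrafilter ι}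
    (G : GermExt A A' U) {α : Type*} (s : Finset α) (c : α → ι → A.K) (v : α → ι → A.M) :
    ∑ a ∈ s, G.kg (c a) • G.mg (v a) = G.mg fun i => ∑ a ∈ s, c a i • v a i := by
  simp only [← G.mg_smul, ← map_sum]
  congr 1
  ext i
  simp

/-- Families of germs that are eventually independent are independent. -/
theorem GermExt.linearIndependent {A A' : Mdl.{u} n Φ} {α : Type u} {U : Ultrafilter (Finset α)}
    (G : GermExt A A' U) (hU : ∀ x, ∀ᶠ S in (U : Filter (Finset α)), x ∈ S)
    {v : α → Finset α → A.M}
    (hv : ∀ (S : Finset α) (c : α → A.K), ∑ a ∈ S, c a • v a S = 0 → ∀ a ∈ S, c a = 0) :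
    LinearIndependent A'.K fun a => G.mg (v a) := by
  classical
  rw [linearIndependent_iff']
  intro s g hg a ha
  choose c hc using fun a => G.kg_surjective (g a)
  simp only [← hc] at hg ⊢
  rw [G.mg_sum, ← map_zero G.mg, G.mg_eq_iff] at hg
  rw [← map_zero G.kg, G.kg_eq_iff]
  have hs : ∀ᶠ S in (U : Filter (Finset α)), ∀ a ∈ s, a ∈ S :=
    (Filter.eventually_all_finset s).2 fun a _ => hU a
  filter_upwards [hg, hs] with S h1 h2
  -- The relation involves only s, while independence is known over all of S; the coefficients are
  -- extended by 0.
  have h3 := hv S (fun a => if a ∈ s then c a S else 0) (by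
    rw [← Finset.sum_subset (s₁ := s) h2]
    · refine Eq.trans (Finset.sum_congr rfl fun a ha => ?_) h1
      rw [if_pos ha]
    · intro a _ ha
      rw [if_neg ha, zero_smul]) a (h2 a ha)
  rwa [if_pos ha] at h3

/-- The image of x must solve `imageSystem`, and its multiples by the complement w of the conductor
must be independent over the image of Q. Each finite part of these independence requirements has a
solution in A, and the germ of these solutions meets them all. -/
theorem Mdl.IsBig.exists_extension {I : Ideal (MvPolynomial (Fin n) ℤ)} {A : Mdl.{u} n Φ}
    (hA : A.IsBig I) {K₁ M₁ : Type u} [Field K₁] [AddCommGroup M₁] [Module K₁ M₁]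
    [Module (MvPolynomial (Fin n) K₁) M₁] [IsScalarTower K₁ (MvPolynomial (Fin n) K₁) M₁]
    (hI : ∀ p ∈ I, ∀ v : M₁, map (Int.castRingHom K₁) p • v = 0) {τ : K₁ →+* A.K}
    {Q : Submodule (MvPolynomial (Fin n) K₁) M₁} {E : Q →+ A.M} (hE : LinExt τ E)
    (hX : ∀ (j : Fin n) q, E ((X j : MvPolynomial (Fin n) K₁) • q) =
      (X j : MvPolynomial (Fin n) A.K) • E q) (x : M₁) :
    ∃ A' : Mdl.{u} n Φ, A'.IsBig I ∧ ∃ j : Embedding A.N A'.N, Elementary A.N A'.N j.toFun ∧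
      ∃ (Q' : Submodule (MvPolynomial (Fin n) K₁) M₁) (E' : Q' →+ A'.M),
        LinExt ((embRingHom j).comp τ) E' ∧
        (∀ (j : Fin n) q, E' ((X j : MvPolynomial (Fin n) K₁) • q) =
          (X j : MvPolynomial (Fin n) A'.K) • E' q) ∧ x ∈ Q' ∧
        ∀ q (hq : q ∈ Q), ∃ hq' : q ∈ Q', E' ⟨q, hq'⟩ = embAddHom j (E ⟨q, hq⟩) := by
  classical
  have := hA.closed
  have hinf : Infinite A.K := IsAlgClosed.instInfinite
  obtain ⟨κ, w, hw, hw'⟩ := exists_complement hE hX x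
  let b := Module.Basis.ofVectorSpace K₁ Q
  let F := imageSystem τ E x
  have hIF : ∀ p ∈ I, (map (Int.castRingHom A.K) p, (0 : A.M)) ∈ F := by
    intro p hp
    have h0 : map (Int.castRingHom K₁) p ∈ conductor Q x := by
      change map (Int.castRingHom K₁) p • x ∈ Q
      rw [hI p hp]
      exact Q.zero_mem
    have h1 : (map (Int.castRingHom A.K) p, (0 : A.M)) =
        (map τ (map (Int.castRingHom K₁) p), E ⟨map (Int.castRingHom K₁) p • x, h0⟩) := by
      refine Prod.ext ?_ ?_
      · rw [MvPolynomial.map_map, RingHom.ext_int (τ.comp (Int.castRingHom K₁))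
          (Int.castRingHom A.K)]
      · rw [← map_zero E]
        exact congrArg E (Subtype.ext (hI p hp x).symm)
    rw [h1]
    exact Submodule.subset_span ⟨⟨_, h0⟩, rfl⟩
  let α := κ ⊕ Module.Basis.ofVectorSpaceIndex K₁ Q
  -- S is a finite part of the future basis of Q'. Its κ-half is made independent modulo the span of
  -- the images of its other half, which are independent already.
  have hsol : ∀ S : Finset α, ∃ y : A.M, (∀ f z, (f, z) ∈ F → f • y = z) ∧
      ∀ c : α → A.K, ∑ a ∈ S, c a • Sum.elim (fun k => map τ (w k) • y) (fun i => E (b i)) a = 0 →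
        ∀ a ∈ S, c a = 0 := by
    intro S
    let U := Submodule.span A.K (↑(S.toRight.image fun i => E (b i)) : Set A.M)
    obtain ⟨y, hy, hy'⟩ := hA.solvable.exists_independent (F := F)
      (fun y => imageSystem_functional hE hX) hIF (α := S.toLeft) (fun k => map τ (w k))
      (fun c y h k => by
        have := hw' S.toLeft (fun k => if hk : k ∈ S.toLeft then c ⟨k, hk⟩ else 0) y (by
          rw [← Finset.sum_coe_sort]
          simpa using h) k k.2
        simpa using this) U
    refine ⟨y, hy, fun c hc => ?_⟩
    rw [Finset.sum_sum_eq_sum_toLeft_add_sum_toRight] at hc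
    simp only [Sum.elim_inl, Sum.elim_inr] at hc
    have h1 : ∀ k ∈ S.toLeft, c (.inl k) = 0 := fun k hk => by
      refine hy' (fun k => c (.inl k)) ?_ ⟨k, hk⟩
      rw [Finset.sum_coe_sort S.toLeft fun k => c (.inl k) • map τ (w k) • y,
        eq_neg_of_add_eq_zero_left hc]
      refine U.neg_mem (U.sum_mem fun i hi => U.smul_mem _ (Submodule.subset_span ?_))
      exact Finset.mem_coe.2 (Finset.mem_image_of_mem (fun i => E (b i)) hi)
    have h2 : ∀ i ∈ S.toRight, c (.inr i) = 0 := by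
      refine linearIndependent_iff'.1 (hE.linearIndependent b.linearIndependent) S.toRight
        (fun i => c (.inr i)) ?_
      rwa [Finset.sum_eq_zero fun k hk => by rw [h1 k hk, zero_smul], zero_add] at hc
    rintro (k | i) ha
    · exact h1 k (Finset.mem_toLeft.2 ha)
    · exact h2 i (Finset.mem_toRight.2 ha)
  choose y hy hy' using hsol
  obtain ⟨U, hU⟩ := exists_ultrafilter_finset α
  obtain ⟨A', hA', ⟨G⟩⟩ := hA.exists_germExt U
  let y' : A'.M := G.mg y
  let τ' := (embRingHom G.j).comp τ
  have hpoly : ∀ p : MvPolynomial (Fin n) K₁, map τ' p • y' = G.mg fun S => map τ p • y S := by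
    intro p
    rw [G.mg_smul_map, MvPolynomial.map_map]
  have hEpoly : ∀ (p : MvPolynomial (Fin n) K₁) (q : Q), E (p • q) = map τ p • E q :=
    map_poly_smul τ E hE.smul hX
  have hj : ∀ (p : MvPolynomial (Fin n) A.K) (v : A.M), embAddHom G.j (p • v) =
      map (embRingHom G.j) p • embAddHom G.j v :=
    map_poly_smul _ _ (embAddHom_linExt G.j hA.grass hA'.grass).smul (embAddHom_X_smul G.j)
  have hcond : ∀ (f : MvPolynomial (Fin n) K₁) (hf : f • x ∈ Q),
      map τ' f • y' = embAddHom G.j (E ⟨f • x, hf⟩) := by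
    intro f hf
    rw [hpoly, G.mg_const]
    congr 1
    funext S
    exact hy S _ _ (Submodule.subset_span ⟨⟨f, hf⟩, rfl⟩)
  let Q' := Q ⊔ Submodule.span (MvPolynomial (Fin n) K₁) {x}
  have hQ' : ∀ z : Q', ∃ (q : Q) (f : MvPolynomial (Fin n) K₁), (z : M₁) = q + f • x := by
    rintro ⟨z, hz⟩
    obtain ⟨q, hq, z', hz', rfl⟩ := Submodule.mem_sup.1 hz
    obtain ⟨f, rfl⟩ := Submodule.mem_span_singleton.1 hz'
    exact ⟨⟨q, hq⟩, f, rfl⟩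
  choose qq ff hqf using hQ'
  let e : Q' → A'.M := fun z => embAddHom G.j (E (qq z)) + map τ' (ff z) • y'
  -- Two decompositions q + fx differ by a polynomial in the conductor, where the system satisfied
  -- by y' makes the values agree.
  have he : ∀ (z : Q') (q : Q) (f : MvPolynomial (Fin n) K₁), (z : M₁) = q + f • x →
      e z = embAddHom G.j (E q) + map τ' f • y' := by
    intro z q f hz
    have h1 : (ff z - f) • x = ((q - qq z : Q) : M₁) := by
      rw [sub_smul, Submodule.coe_sub, sub_eq_sub_iff_add_eq_add, add_comm, ← hqf, hz]
    have h2 : (ff z - f) • x ∈ Q := h1 ▸ (q - qq z).2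
    have h3 := hcond _ h2
    have h4 : (⟨(ff z - f) • x, h2⟩ : Q) = q - qq z := Subtype.ext h1
    rw [h4, map_sub, map_sub, map_sub, sub_smul, sub_eq_sub_iff_add_eq_add] at h3
    change embAddHom G.j (E (qq z)) + map τ' (ff z) • y' = _
    rw [add_comm, h3]
  let E' : Q' →+ A'.M := AddMonoidHom.mk' e fun z z' => by
    rw [he (z + z') (qq z + qq z') (ff z + ff z') (by
      rw [Submodule.coe_add, Submodule.coe_add, hqf, hqf z', add_smul]
      abel), map_add, map_add, map_add, add_smul]
    change _ = embAddHom G.j (E (qq z)) + map τ' (ff z) • y' +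
      (embAddHom G.j (E (qq z')) + map τ' (ff z') • y')
    abel
  have hE'poly : ∀ (p : MvPolynomial (Fin n) K₁) (z : Q'), E' (p • z) = map τ' p • E' z := by
    intro p z
    refine (he (p • z) (p • qq z) (p * ff z) ?_).trans ?_
    · rw [Submodule.coe_smul, Submodule.coe_smul, hqf, smul_add, mul_smul]
    · rw [hEpoly, hj, MvPolynomial.map_map, map_mul, mul_smul, ← smul_add]
      rfl
  have hxQ' : ∀ p : MvPolynomial (Fin n) K₁, p • x ∈ Q' := fun p =>
    Q'.smul_mem p (Submodule.mem_sup_right (Submodule.mem_span_singleton_self x))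
  have hQQ' : ∀ q ∈ Q, q ∈ Q' := fun q hq => Submodule.mem_sup_left hq
  have hE'q : ∀ q (hq : q ∈ Q), E' ⟨q, hQQ' q hq⟩ = embAddHom G.j (E ⟨q, hq⟩) := fun q hq =>
    (he _ ⟨q, hq⟩ 0 (by simp)).trans (by simp)
  have hE'x : ∀ p : MvPolynomial (Fin n) K₁, E' ⟨p • x, hxQ' p⟩ = map τ' p • y' := fun p =>
    (he _ 0 p (by simp)).trans (by simp)
  -- These vectors span Q' over K₁, as every polynomial is an element of the conductor plus a
  -- combination of the w_k; `linExt_of_span` then only needs their images to be independent.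
  let g : α → Q' := Sum.elim (fun k => ⟨w k • x, hxQ' _⟩) (fun i => ⟨b i, hQQ' _ (b i).2⟩)
  refine ⟨A', hA', G.j, G.elem, Q', E', linExt_of_span g ?_ (fun c z => ?_) ?_, fun j z => ?_,
    by simpa using hxQ' 1, fun q hq => ⟨hQQ' q hq, hE'q q hq⟩⟩
  · refine span_range_eq_top_of_coe (n := n) fun z hz => ?_
    set V := Submodule.span K₁ (Set.range fun a => (g a : M₁)) with hV
    have h1 : ∀ q ∈ Q, q ∈ V := by
      intro q hq
      have h2 : (⟨q, hq⟩ : Q) ∈ Submodule.span K₁ (Set.range b) := b.span_eq ▸ Submodule.mem_top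
      have h3 := Submodule.mem_map_of_mem (f := (Q.restrictScalars K₁).subtype) h2
      refine (Submodule.map_span_le _ _ _).2 ?_ h3
      rintro _ ⟨i, rfl⟩
      exact Submodule.subset_span ⟨.inr i, rfl⟩
    have h2 : ∀ p : MvPolynomial (Fin n) K₁, p • x ∈ V := by
      intro p
      obtain ⟨f, hf, hpf⟩ := hw p
      have h3 : (p - f) • x ∈ V := by
        have h4 := Submodule.mem_map_of_mem
          (f := (LinearMap.toSpanSingleton (MvPolynomial (Fin n) K₁) M₁ x).restrictScalars K₁) hpf
        refine (Submodule.map_span_le _ _ _).2 ?_ h4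
        rintro _ ⟨k, rfl⟩
        exact Submodule.subset_span ⟨.inl k, rfl⟩
      have h5 := V.add_mem h3 (h1 _ (show f • x ∈ Q from hf))
      rwa [← add_smul, sub_add_cancel] at h5
    obtain ⟨q, hq, z', hz', rfl⟩ := Submodule.mem_sup.1 hz
    obtain ⟨f, rfl⟩ := Submodule.mem_span_singleton.1 hz'
    exact V.add_mem (h1 q hq) (h2 f)
  · have h0 : (C c : MvPolynomial (Fin n) K₁) • z = c • z := Subtype.ext (C_smul_eq c (z : M₁))
    rw [← h0, hE'poly, map_C, C_smul_eq]
  · have : (fun a => E' (g a)) = fun a => G.mg fun S =>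
        Sum.elim (fun k => map τ (w k) • y S) (fun i => E (b i)) a := by
      ext a
      rcases a with k | i
      · exact (hE'x _).trans (hpoly _)
      · exact (hE'q _ _).trans (G.mg_const _)
    rw [this]
    exact G.linearIndependent hU hy'
  · have := hE'poly (X j) z
    rwa [map_X] at this

end GrassModule

/-! ### Existence of big models. -/

namespace GrassModule

open MSLanguage MvPolynomial

/-! ### Modules in which all systems are solvable -/

section InjectiveModules

theorem exists_injective_module (A N : Type u) [CommRing A] [AddCommGroup N] [Module A N] :
    ∃ (E : Type u) (_ : AddCommGroup E) (_ : Module A E), Module.Injective A E ∧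
      ∃ f : N →ₗ[A] E, Function.Injective f := by
  obtain ⟨⟨J, hJ, f, hf⟩⟩ :=
    CategoryTheory.EnoughInjectives.presentation (ModuleCat.of A N)
  refine ⟨J, inferInstance, inferInstance, ?_, f.hom, (ModuleCat.mono_iff_injective f).1 hf⟩
  have : CategoryTheory.Injective (ModuleCat.of A J) := hJ
  exact Module.injective_module_of_injective_object A J

/-- Compatibility says that f_i ↦ v_i is a well-defined homomorphism on the ideal generated by the
f_i. Injectivity extends it to A, and x is the image of 1. -/
theorem exists_smul_eq_of_injective {A E : Type u} [CommRing A] [AddCommGroup E] [Module A E]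
    (hE : Module.Injective A E) {m : ℕ} (f : Fin m → A) (v : Fin m → E)
    (h : ∀ t : Fin m → A, ∑ i, t i * f i = 0 → ∑ i, t i • v i = 0) :
    ∃ x : E, ∀ i, f i • x = v i := by
  classical
  let L := Fintype.linearCombination A f
  let V := Fintype.linearCombination A v
  have hLV : L.ker ≤ V.ker := fun t ht => by
    rw [LinearMap.mem_ker, Fintype.linearCombination_apply] at ht ⊢
    exact h t ht
  let L' : ((Fin m → A) ⧸ L.ker) →ₗ[A] A := L.ker.liftQ L le_rfl
  have hL' : Function.Injective L' := LinearMap.ker_eq_bot.1 (Submodule.ker_liftQ_eq_bot _ _ _ le_rfl)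
  obtain ⟨e, he⟩ := hE.out L' hL' (L.ker.liftQ V hLV)
  refine ⟨e 1, fun i => ?_⟩
  have h1 := he (Submodule.Quotient.mk (Pi.single i 1))
  rw [Submodule.liftQ_apply, Submodule.liftQ_apply, Fintype.linearCombination_apply_single,
    Fintype.linearCombination_apply_single, one_smul, one_smul] at h1
  rw [← map_smul, smul_eq_mul, mul_one, h1]

variable {K A E : Type u} [Field K] [CommRing A] [Algebra K A] [AddCommGroup E] [Module A E]
  [Module K E] [IsScalarTower K A E]

theorem linearIndependent_pi_single {a : E} (ha : a ≠ 0) :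
    LinearIndependent K fun k : ℕ => (Pi.single k a : ℕ → E) := by
  classical
  refine linearIndependent_iff'.2 fun s c hc k hk => ?_
  have h1 := congrFun hc k
  rw [Finset.sum_apply, Finset.sum_eq_single k, Pi.smul_apply, Pi.single_eq_same, Pi.zero_apply] at h1
  · exact (smul_eq_zero.1 h1).resolve_right ha
  · intro l _ hl
    rw [Pi.smul_apply, Pi.single_eq_of_ne hl.symm, smul_zero]
  · exact fun h => absurd hk h

/-- In a countable power of an injective module containing all cyclic modules, all systems are
solvable. -/
theorem solvable_pi_of_injective [Infinite K] (hE : Module.Injective A E)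
    (hA : ∀ J : Ideal A, ∀ g ∉ J, ∃ a : E, (∀ f ∈ J, f • a = 0) ∧ g • a ≠ 0) :
    Solvable K A (ℕ → E) := by
  classical
  intro m k f v g U hU hv hg
  choose x₀ hx₀ using fun l => exists_smul_eq_of_injective hE f (fun i => v i l) fun t ht => by
    have := congrFun (hv t ht) l
    simpa using this
  let S : Submodule K (ℕ → E) := ⨅ i, ((LinearMap.lsmul A (ℕ → E) (f i)).restrictScalars K).ker
  have hS : ∀ s, s ∈ S ↔ ∀ i, f i • s = 0 := fun s => by simp [S]
  -- Homogenization: solutions are x₀ + c⁻¹s with c ≠ 0, and each inequation, like c ≠ 0, excludes a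
  -- subspace of S × K. Over an infinite field, finitely many proper subspaces do not cover the
  -- space.
  let G : Fin k → S × K →ₗ[K] (ℕ → E) := fun j =>
    (LinearMap.lsmul A (ℕ → E) (g j)).restrictScalars K ∘ₗ
      S.subtype.coprod (LinearMap.toSpanSingleton K (ℕ → E) x₀)
  have hG : ∀ j s c, G j (s, c) = g j • ((s : ℕ → E) + c • x₀) := fun j s c => by simp [G]
  let p : Option (Fin k) → Submodule K (S × K) := fun j =>
    j.elim (LinearMap.snd K S K).ker fun j => (U j).comap (G j)
  have hp : ¬ ∃ j, p j = ⊤ := by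
    rintro ⟨_ | j, hj⟩
    · have : ((0 : S), (1 : K)) ∈ p none := hj ▸ Submodule.mem_top
      exact one_ne_zero (α := K) this
    -- Placing a in the different coordinates gives infinitely many homogeneous solutions with
    -- independent images under g_j, too many for the finite-dimensional U_j.
    · obtain ⟨a, ha, hga⟩ := hA _ _ (hg j)
      have h1 : ∀ l : ℕ, (Pi.single l (g j • a) : ℕ → E) ∈ U j := by
        intro l
        have h2 : (Pi.single l a : ℕ → E) ∈ S := (hS _).2 fun i => by
          rw [← Pi.single_smul, ha _ (Ideal.subset_span ⟨i, rfl⟩), Pi.single_zero]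
        have h3 : ((⟨_, h2⟩ : S), (0 : K)) ∈ p (some j) := hj ▸ Submodule.mem_top
        have h4 : G j (⟨_, h2⟩, 0) ∈ U j := h3
        rwa [hG, zero_smul, add_zero, ← Pi.single_smul] at h4
      have := hU j
      exact Module.Finite.not_linearIndependent_of_infinite (R := K)
        (fun l => (⟨_, h1 l⟩ : U j))
        (LinearIndependent.of_comp (U j).subtype (linearIndependent_pi_single hga))
  have hcover := mt Subspace.exists_eq_top_of_iUnion_eq_univ hp
  obtain ⟨⟨s, c⟩, hsc⟩ := (Set.ne_univ_iff_exists_notMem _).1 hcover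
  rw [Set.mem_iUnion, not_exists] at hsc
  have hc : c ≠ 0 := hsc none
  refine ⟨x₀ + c⁻¹ • (s : ℕ → E), fun i => ?_, fun j hj => hsc (some j) ?_⟩
  · have h1 := (hS s).1 s.2 i
    rw [smul_add, smul_comm, h1, smul_zero, add_zero]
    exact _root_.funext fun l => hx₀ l i
  · have h2 := (U j).smul_mem c hj
    change G j (s, c) ∈ U j
    rwa [← smul_comm, smul_add, smul_inv_smul₀ hc, add_comm, ← hG] at h2

/-- Every module embeds into one in which all systems are solvable. -/
theorem exists_solvable_module (K : Type u) {A M : Type u} [Field K] [Infinite K] [CommRing A]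
    [Algebra K A] [AddCommGroup M] [Module A M] :
    ∃ (E : Type u) (_ : AddCommGroup E) (_ : Module A E) (_ : Module K E)
      (_ : IsScalarTower K A E), Solvable K A E ∧ ∃ f : M →ₗ[A] E, Function.Injective f := by
  -- The factor A ⧸ J contributes the class of 1, which is annihilated exactly by J.
  obtain ⟨E, _, _, hE, f, hf⟩ := exists_injective_module A (M × ((J : Ideal A) → A ⧸ J))
  let : Module K E := Module.compHom E (algebraMap K A)
  have : IsScalarTower K A E := ⟨fun c a v => by
    rw [Algebra.smul_def, mul_smul]
    rfl⟩
  refine ⟨ℕ → E, inferInstance, inferInstance, inferInstance, inferInstance,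
    solvable_pi_of_injective hE fun J g hg => ⟨f (0, Pi.single J 1), fun a ha => ?_, fun h0 => ?_⟩,
    (LinearMap.pi fun _ => f) ∘ₗ LinearMap.inl A _ _, fun v w hvw => ?_⟩
  · rw [← map_smul, ← map_zero f]
    congr 1
    rw [Prod.smul_mk, smul_zero, ← Pi.single_smul, Algebra.smul_def, mul_one,
      Ideal.Quotient.algebraMap_eq, Ideal.Quotient.eq_zero_iff_mem.2 ha, Pi.single_zero]
    rfl
  · rw [← map_smul, ← map_zero f] at h0
    have h1 : g • (Pi.single J 1 : (J : Ideal A) → A ⧸ J) J = 0 :=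
      congrFun (congrArg Prod.snd (hf h0)) J
    rw [Pi.single_eq_same, Algebra.smul_def, mul_one, Ideal.Quotient.algebraMap_eq] at h1
    exact hg (Ideal.Quotient.eq_zero_iff_mem.1 h1)
  · exact congrArg Prod.fst (hf (congrFun hvw 0))

end InjectiveModules

/-! ### Embedding into a big model -/

section Embeds

variable {n : ℕ}

theorem linExt_id {K M M' : Type*} [Field K] [AddCommGroup M] [AddCommGroup M'] [Module K M]
    [Module K M'] {f : M →+ M'} (hs : ∀ (c : K) v, f (c • v) = c • f v)
    (hf : Function.Injective f) : LinExt (RingHom.id K) f where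
  smul := hs
  indep _ _ hv := hv.map' { f with map_smul' := hs } (LinearMap.ker_eq_bot.2 hf)

theorem exists_fSolvable_module {I : Ideal (MvPolynomial (Fin n) ℤ)} {K M : Type u} [Field K]
    [Infinite K] [AddCommGroup M] [Module K M] [Module (MvPolynomial (Fin n) K) M]
    [IsScalarTower K (MvPolynomial (Fin n) K) M]
    (hI : ∀ p ∈ I, ∀ v : M, map (Int.castRingHom K) p • v = 0) :
    ∃ (E : Type u) (_ : AddCommGroup E) (_ : Module K E) (_ : Module (MvPolynomial (Fin n) K) E)
      (_ : IsScalarTower K (MvPolynomial (Fin n) K) E) (f : M →+ E),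
      (∀ p ∈ I, ∀ v : E, map (Int.castRingHom K) p • v = 0) ∧ FSolvable I K E ∧
      LinExt (RingHom.id K) f ∧
      ∀ (j : Fin n) v, f ((X j : MvPolynomial (Fin n) K) • v) =
        (X j : MvPolynomial (Fin n) K) • f v := by
  let := algModule hI
  obtain ⟨E, _, _, _, _, hE, f, hf⟩ := exists_solvable_module K (A := Alg I K) (M := M)
  let mk := Ideal.Quotient.mk (I.map (map (Int.castRingHom K)))
  let : Module (MvPolynomial (Fin n) K) E := Module.compHom E mk
  have hmk : ∀ (p : MvPolynomial (Fin n) K) (v : E), (mk p : Alg I K) • v = p • v :=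
    fun _ _ => rfl
  have hf' : ∀ (p : MvPolynomial (Fin n) K) v, f (p • v) = p • f v := fun p v =>
    f.map_smul (mk p) v
  have : IsScalarTower K (MvPolynomial (Fin n) K) E := ⟨fun c p v => smul_assoc c (mk p) v⟩
  refine ⟨E, inferInstance, inferInstance, inferInstance, inferInstance, f.toAddMonoidHom,
    fun p hp v => ?_, (solvable_iff_fSolvable hmk).1 hE, linExt_id (fun c v => ?_) hf,
    fun j v => hf' _ _⟩
  · rw [← hmk, show mk (map (Int.castRingHom K) p) = 0 from
      Ideal.Quotient.eq_zero_iff_mem.2 (Ideal.mem_map_of_mem _ hp)]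
    exact zero_smul (Alg I K) v
  · rw [← C_smul_eq (n := n) c v, ← C_smul_eq (n := n) c]
    exact hf' _ _

/-- The operators extend to the base change to the algebraic closure. A K-basis of M becomes a basis
there, which gives preservation of independence. -/
theorem exists_isAlgClosed_module {I : Ideal (MvPolynomial (Fin n) ℤ)} {K M : Type u} [Field K]
    [AddCommGroup M] [Module K M] [Module (MvPolynomial (Fin n) K) M]
    [IsScalarTower K (MvPolynomial (Fin n) K) M]
    (hI : ∀ p ∈ I, ∀ v : M, map (Int.castRingHom K) p • v = 0) :
    ∃ (K' M' : Type u) (_ : Field K') (_ : AddCommGroup M') (_ : Module K' M')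
      (_ : Module (MvPolynomial (Fin n) K') M') (_ : IsScalarTower K' (MvPolynomial (Fin n) K') M')
      (σ : K →+* K') (e : M →+ M'), IsAlgClosed K' ∧
      (∀ p ∈ I, ∀ v : M', map (Int.castRingHom K') p • v = 0) ∧ LinExt σ e ∧
      ∀ (j : Fin n) v, e ((X j : MvPolynomial (Fin n) K) • v) =
        (X j : MvPolynomial (Fin n) K') • e v := by
  let K' := AlgebraicClosure K
  let M' := TensorProduct K K' M
  let T₀ : Fin n → Module.End K M := fun j =>
    (LinearMap.lsmul (MvPolynomial (Fin n) K) M (X j)).restrictScalars K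
  let T : Fin n → Module.End K' M' := fun j => (T₀ j).baseChange K'
  have hT : ∀ i j, T i * T j = T j * T i := fun i j => by
    have h0 : T₀ i * T₀ j = T₀ j * T₀ i := LinearMap.ext fun v => smul_comm _ _ v
    change (T₀ i).baseChange K' * (T₀ j).baseChange K' = (T₀ j).baseChange K' * (T₀ i).baseChange K'
    rw [← LinearMap.baseChange_mul, h0, LinearMap.baseChange_mul]
  let : Module (MvPolynomial (Fin n) K') M' := polyModule T hT
  have : IsScalarTower K' (MvPolynomial (Fin n) K') M' := polyModule_tower T hT
  let σ := algebraMap K K'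
  let e : M →+ M' := (TensorProduct.mk K K' M 1).toAddMonoidHom
  have hs : ∀ c v, e (c • v) = σ c • e v := fun c v =>
    ((TensorProduct.mk K K' M 1).map_smul c v).trans (algebraMap_smul K' c (e v)).symm
  have hX : ∀ (j : Fin n) v, e ((X j : MvPolynomial (Fin n) K) • v) =
      (X j : MvPolynomial (Fin n) K') • e v := fun j v =>
    ((polyModule_X_smul T hT j (e v)).trans (LinearMap.baseChange_tmul _ _ _)).symm
  refine ⟨K', M', inferInstance, inferInstance, inferInstance, inferInstance, inferInstance, σ, e,
    inferInstance, fun p hp v => ?_, ?_, hX⟩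
  · induction v using TensorProduct.induction_on with
    | zero => rw [smul_zero]
    | add v w hv hw => rw [smul_add, hv, hw, add_zero]
    | tmul c v =>
      have h1 : TensorProduct.tmul K c v = c • e v := by
        change _ = c • TensorProduct.tmul K 1 v
        rw [TensorProduct.smul_tmul', smul_eq_mul, mul_one]
      have h2 := map_poly_smul σ e hs hX (map (Int.castRingHom K) p) v
      rw [hI p hp, map_zero, MvPolynomial.map_map,
        RingHom.ext_int (σ.comp (Int.castRingHom K)) (Int.castRingHom K')] at h2
      have h3 : c • e v = (C c : MvPolynomial (Fin n) K') • e v := (C_smul_eq c (e v)).symm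
      rw [h1, h3, smul_comm, ← h2, smul_zero]
  · let b := Module.Basis.ofVectorSpace K M
    refine linExt_of_basis b hs ?_
    have h1 : (fun i => e (b i)) = b.baseChange K' :=
      _root_.funext fun i => (Module.Basis.baseChange_apply K' b i).symm
    exact h1 ▸ (b.baseChange K').linearIndependent

theorem exists_isBig_extension {Φ : Set PartFormula} {I : Ideal (MvPolynomial (Fin n) ℤ)}
    {A : Mdl.{u} n Φ} (hA : A.IsGrass I)
    (hΦ : ∀ (K' : Type u) [Field K'] (σ : A.K →+* K'), ∀ P ∈ Φ, P.Transfers σ) :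
    ∃ B : Mdl.{u} n Φ, B.IsBig I ∧ Nonempty (Embedding A.N B.N) := by
  obtain ⟨K', M', _, _, _, _, _, σ, e, _, hI, he, hX⟩ := exists_isAlgClosed_module hA.kill
  have : Infinite K' := IsAlgClosed.instInfinite
  obtain ⟨E, _, _, _, _, f, hE, hs, hf, hX'⟩ := exists_fSolvable_module hI
  have hB : (stdMdl n Φ K' E).IsBig I :=
    { grass := stdMdl_isGrass n Φ K' E hE
      closed := inferInstanceAs (IsAlgClosed K')
      solvable := hs }
  obtain ⟨g, -, -⟩ := exists_embedding (A := A) (B := stdMdl n Φ K' E) hA hB.grass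
    (σ := (RingHom.id K').comp σ) (e := f.comp e) (hf.comp he)
    (fun j v => (congrArg f (hX j v)).trans (hX' j (e v))) (hΦ K' _)
  exact ⟨_, hB, ⟨g⟩⟩

end Embeds

end GrassModule

/-! ### Completeness over a common substructure. -/

namespace MSLanguage

variable {L : MSLanguage} {N N' : Struc.{u} L}

theorem Embedding.eval (f : Embedding N N') {Γ : List L.Srt} (c : N.Assign Γ) {s : L.Srt}
    (t : Term L Γ s) : f.toFun s (t.eval N c) = t.eval N' fun i => f.toFun _ (c i) := by
  induction t with
  | var i => rfl
  | app g ts ih =>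
    refine (f.map_fn g _).trans (congrArg (N'.fn g) ?_)
    exact _root_.funext ih

theorem Struc.Assign.cons_map (f : (s : L.Srt) → N.carrier s → N'.carrier s) {Γ : List L.Srt}
    {s : L.Srt} (x : N.carrier s) (c : N.Assign Γ) :
    (fun i => f ((s :: Γ).get i) (Struc.Assign.cons x c i)) =
      Struc.Assign.cons (f s x) fun i => f (Γ.get i) (c i) := by
  funext i
  refine Fin.cases rfl (fun _ => rfl) i

end MSLanguage

namespace GrassModule

open MSLanguage MvPolynomial

variable {n : ℕ} {Φ : Set PartFormula}

/-! ### Model completeness over the base theory -/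

/-- C₁ is the standard model on the whole field of A and a subspace Q' of its module containing x
and the image of C. Field amalgamation, extension of scalars and the adjunction of x, in this order,
produce its map into B'. -/
theorem Mdl.IsBig.exists_common_extension {I : Ideal (MvPolynomial (Fin n) ℤ)}
    {C A B : Mdl.{u} n Φ} (hC : C.IsGrass I) (hA : A.IsBig I) (hB : B.IsBig I)
    (e₁ : Embedding C.N A.N) (e₂ : Embedding C.N B.N) (x : A.M) :
    ∃ C₁ B' : Mdl.{u} n Φ, C₁.IsGrass I ∧ B'.IsBig I ∧ ∃ (j : Embedding B.N B'.N)
      (f₁ : Embedding C₁.N A.N) (f₂ : Embedding C₁.N B'.N), Elementary B.N B'.N j.toFun ∧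
      (∀ a, ∃ y, embK f₁ y = a) ∧ (∃ y, embM f₁ y = x) ∧
      (∀ y, ∃ z, embK f₁ z = embK e₁ y ∧ embK f₂ z = embK j (embK e₂ y)) ∧
      ∀ y, ∃ z, embM f₁ z = embM e₁ y ∧ embM f₂ z = embM j (embM e₂ y) := by
  obtain ⟨B₀, hB₀, j₀, hj₀, τ, hτ⟩ := hB.exists_amalgam (embRingHom e₁) (embRingHom e₂)
  obtain ⟨Q, E, hE, hX, hv⟩ := exists_scalar_extension (embAddHom_linExt e₁ hC hA.grass)
    (embAddHom_linExt (j₀.comp e₂) hC hB₀.grass) (embAddHom_X_smul e₁)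
    (embAddHom_X_smul (j₀.comp e₂)) (τ := τ) hτ
  obtain ⟨B', hB', j₁, hj₁, Q', E', hE', hX', hx, hq⟩ := hB₀.exists_extension hA.grass.kill hE hX x
  have hC₁ : (stdMdl n Φ A.K Q').IsGrass I :=
    stdMdl_isGrass n Φ A.K Q' fun p hp v => Subtype.ext (hA.grass.kill p hp v)
  -- Taking all of the field of A makes C₁ algebraically closed, so every formula transfers along
  -- both maps, homogeneous or not.
  have : IsAlgClosed (stdMdl n Φ A.K Q').K := hA.closed
  have hQ' : LinExt (RingHom.id A.K) (Q'.restrictScalars A.K).subtype.toAddMonoidHom :=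
    linExt_id (fun _ _ => rfl) Subtype.val_injective
  obtain ⟨f₁, hf₁, hf₁'⟩ := exists_embedding (A := stdMdl n Φ A.K Q') (B := A) hC₁ hA.grass
    (σ := RingHom.id A.K) (e := (Q'.restrictScalars A.K).subtype.toAddMonoidHom)
    hQ' (fun _ _ => rfl) fun P _ => P.transfers_of_isAlgClosed _
  obtain ⟨f₂, hf₂, hf₂'⟩ := exists_embedding (A := stdMdl n Φ A.K Q') (B := B') hC₁ hB'.grass
    (σ := (embRingHom j₁).comp τ) (e := E') hE' hX' fun P _ => P.transfers_of_isAlgClosed _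
  refine ⟨_, B', hC₁, hB', j₁.comp j₀, f₁, f₂, hj₁.comp hj₀, fun a => ⟨a, hf₁ a⟩,
    ⟨⟨x, hx⟩, hf₁' _⟩, fun y => ⟨embRingHom e₁ y, hf₁ (embRingHom e₁ y),
      (hf₂ (embRingHom e₁ y)).trans ?_⟩, fun y => ?_⟩
  · exact congrArg (embRingHom j₁) (RingHom.congr_fun hτ y)
  · obtain ⟨h1, h2⟩ := hv y
    obtain ⟨h3, h4⟩ := hq _ h1
    exact ⟨⟨_, h3⟩, hf₁' _, (hf₂' _).trans (h4.trans (congrArg (embAddHom j₁) h2))⟩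

theorem Mdl.IsBig.exists_common_extension_sort {I : Ideal (MvPolynomial (Fin n) ℤ)}
    {C A B : Mdl.{u} n Φ} (hC : C.IsGrass I) (hA : A.IsBig I) (hB : B.IsBig I)
    (e₁ : Embedding C.N A.N) (e₂ : Embedding C.N B.N) (s : GSort) (x : A.N.carrier s) :
    ∃ C₁ B' : Mdl.{u} n Φ, C₁.IsGrass I ∧ B'.IsBig I ∧ ∃ (j : Embedding B.N B'.N)
      (f₁ : Embedding C₁.N A.N) (f₂ : Embedding C₁.N B'.N), Elementary B.N B'.N j.toFun ∧
      (∃ y, f₁.toFun s y = x) ∧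
      ∀ t y, ∃ z, f₁.toFun t z = e₁.toFun t y ∧ f₂.toFun t z = j.toFun t (e₂.toFun t y) := by
  -- Only an element of the module sort has to be adjoined; for the other sorts 0 is adjoined
  -- instead, as C₁ already contains all scalars and with them all matrices.
  have hx₀ : ∃ x₀ : A.M, s = .M → HEq x₀ x := by
    by_cases h : s = .M
    · subst h
      exact ⟨x, fun _ => HEq.rfl⟩
    · exact ⟨0, fun h' => absurd h' h⟩
  obtain ⟨x₀, hx₀⟩ := hx₀
  obtain ⟨C₁, B', hC₁, hB', j, f₁, f₂, hj, hK, ⟨y₀, hy₀⟩, hCK, hCM⟩ :=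
    Mdl.IsBig.exists_common_extension hC hA hB e₁ e₂ x₀
  refine ⟨C₁, B', hC₁, hB', j, f₁, f₂, hj, ?_, ?_⟩
  · cases s with
    | K => exact hK x
    | M => exact ⟨y₀, hy₀.trans (eq_of_heq (hx₀ rfl))⟩
    | G i =>
      obtain ⟨X, rfl⟩ := hA.grass.pi_surjective i x
      choose Y hY using fun a b => hK (X a b)
      refine ⟨piS C₁.N i Y, (emb_pi f₁ i Y).trans ?_⟩
      simp only [hY]
  · rintro (_ | _ | i) y
    · exact hCK y
    · exact hCM y
    · obtain ⟨X, rfl⟩ := hC.pi_surjective i y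
      choose Y hY hY' using fun a b => hCK (X a b)
      refine ⟨piS C₁.N i Y, (emb_pi f₁ i Y).trans ((emb_pi e₁ i X).trans ?_).symm,
        (emb_pi f₂ i Y).trans (((congrArg _ (emb_pi e₂ i X)).trans (emb_pi j i _)).trans ?_).symm⟩
      · simp only [hY]
      · simp only [hY']

/-- Induction on φ with C, A and B varying. An element of A tested by a quantifier is absorbed into
a larger common substructure, while B is replaced by an elementary extension that satisfies the same
formulas. -/
theorem realize_iff_of_isBig {I : Ideal (MvPolynomial (Fin n) ℤ)} {Γ : List (lang n Φ).Srt}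
    (φ : Formula (lang n Φ) Γ) : ∀ {C A B : Mdl.{u} n Φ}, C.IsGrass I → A.IsBig I → B.IsBig I →
      ∀ (e₁ : Embedding C.N A.N) (e₂ : Embedding C.N B.N) (c : C.N.Assign Γ),
        φ.Realize A.N (fun i => e₁.toFun (Γ.get i) (c i)) ↔
          φ.Realize B.N (fun i => e₂.toFun (Γ.get i) (c i)) := by
  induction φ with
  | falsum => exact fun _ _ _ _ _ _ => Iff.rfl
  | eq t₁ t₂ =>
    intro C A B _ _ _ e₁ e₂ c
    simp only [Formula.Realize, ← Embedding.eval]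
    exact (e₁.inj _).eq_iff.trans (e₂.inj _).eq_iff.symm
  | rel r ts =>
    intro C A B _ _ _ e₁ e₂ c
    simp only [Formula.Realize, ← Embedding.eval]
    exact (e₁.map_rel r _).symm.trans (e₂.map_rel r _)
  | imp φ ψ ih₁ ih₂ =>
    exact fun hC hA hB e₁ e₂ c => imp_congr (ih₁ hC hA hB e₁ e₂ c) (ih₂ hC hA hB e₁ e₂ c)
  | all s φ ih =>
    rename_i Γ
    have key : ∀ {C A B : Mdl.{u} n Φ}, C.IsGrass I → A.IsBig I → B.IsBig I →
        ∀ (e₁ : Embedding C.N A.N) (e₂ : Embedding C.N B.N) (c : C.N.Assign Γ),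
          (Formula.all s φ).Realize B.N (fun i => e₂.toFun (Γ.get i) (c i)) →
            (Formula.all s φ).Realize A.N (fun i => e₁.toFun (Γ.get i) (c i)) := by
      intro C A B hC hA hB e₁ e₂ c h x
      obtain ⟨C₁, B', hC₁, hB', j, f₁, f₂, hj, ⟨x₁, rfl⟩, hz⟩ :=
        Mdl.IsBig.exists_common_extension_sort hC hA hB e₁ e₂ s x
      choose c₁ h1 h2 using fun i => hz (Γ.get i) (c i)
      have h3 := (hj _ _ _).2 h (f₂.toFun s x₁)
      simp only [← h2] at h3
      simp only [← h1]
      rw [← Struc.Assign.cons_map f₁.toFun, ih hC₁ hA hB' f₁ f₂, Struc.Assign.cons_map]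
      exact h3
    intro C A B hC hA hB e₁ e₂ c
    exact ⟨key hC hB hA e₂ e₁ c, key hC hA hB e₁ e₂ c⟩

/-- D is the extra condition on the base theory, trivial in (a) and algebraic closedness in (b); it
serves only to make the predicates transfer when a base model is embedded into a big one. -/
theorem isModelCompletion_of {I : Ideal (MvPolynomial (Fin n) ℤ)}
    {T T' : MSLanguage.Theory (lang n Φ)} {D : Mdl.{u} n Φ → Prop}
    (hT : ∀ N : Struc.{u} (lang n Φ), N.Models T ↔ ∃ A : Mdl.{u} n Φ, A.N = N ∧ A.IsGrass I ∧ D A)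
    (hT' : Axiomatizes.{u} T' (IsBig I)) (hD : ∀ A : Mdl.{u} n Φ, A.IsBig I → D A)
    (hΦ : ∀ A : Mdl.{u} n Φ, D A → ∀ (K' : Type u) [Field K'] (σ : A.K →+* K'), ∀ P ∈ Φ,
      P.Transfers σ) : IsModelCompletion.{u} T' T where
  extends_base N h := by
    obtain ⟨A, rfl, hA⟩ := isBig_iff.1 ((hT' N).1 h)
    exact (hT _).2 ⟨A, rfl, hA.grass, hD A hA⟩
  embeds N h := by
    obtain ⟨A, rfl, hA, hDA⟩ := (hT N).1 h
    obtain ⟨B, hB, hAB⟩ := exists_isBig_extension hA (hΦ A hDA)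
    exact ⟨B.N, (hT' _).2 (isBig_iff.2 ⟨B, rfl, hB⟩), hAB⟩
  complete C N₁ N₂ hC h₁ h₂ e₁ e₂ Γ φ c := by
    obtain ⟨C, rfl, hC, -⟩ := (hT C).1 hC
    obtain ⟨A, rfl, hA⟩ := isBig_iff.1 ((hT' N₁).1 h₁)
    obtain ⟨B, rfl, hB⟩ := isBig_iff.1 ((hT' N₂).1 h₂)
    exact realize_iff_of_isBig φ hC hA hB e₁ e₂ c

end GrassModule

theorem mainTheorem1 (n : ℕ) (I : Ideal (MvPolynomial (Fin n) ℤ)) :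
    (∃ T T' : MSLanguage.Theory (GrassModule.lang n {P | P.Homogeneous}),
      GrassModule.Axiomatizes.{u} T (GrassModule.IsBase I) ∧
      GrassModule.Axiomatizes.{u} T' (GrassModule.IsBig I) ∧
      MSLanguage.IsModelCompletion.{u} T' T) ∧
    (∃ T T' : MSLanguage.Theory (GrassModule.lang n Set.univ),
      GrassModule.Axiomatizes.{u} T (GrassModule.IsBaseACF I) ∧
      GrassModule.Axiomatizes.{u} T' (GrassModule.IsBig I) ∧
      MSLanguage.IsModelCompletion.{u} T' T) := by
  constructor
  · obtain ⟨T, hT⟩ := GrassModule.elem_isBase.{u} (Φ := {P | P.Homogeneous}) I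
    obtain ⟨T', hT'⟩ := GrassModule.elem_isBig.{u} (Φ := {P | P.Homogeneous}) I
    refine ⟨T, T', hT, hT', GrassModule.isModelCompletion_of (I := I) (D := fun _ => True)
      (fun N => ?_) hT' (fun _ _ => trivial) fun A _ K' _ σ P hP => ?_⟩
    · simpa using (hT N).trans GrassModule.isBase_iff
    · exact GrassModule.PartFormula.Homogeneous.transfers hP σ
  · obtain ⟨T, hT⟩ := GrassModule.elem_isBaseACF.{u} (Φ := Set.univ) I
    obtain ⟨T', hT'⟩ := GrassModule.elem_isBig.{u} (Φ := Set.univ) I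
    refine ⟨T, T', hT, hT', GrassModule.isModelCompletion_of (I := I)
      (D := fun A => IsAlgClosed A.K) (fun N => (hT N).trans GrassModule.isBaseACF_iff) hT'
      (fun _ hA => hA.closed) fun A _ K' _ σ P _ => P.transfers_of_isAlgClosed σ⟩
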